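/- **Theorem.** Let $K$ be an algebraically closed field, let $r'\ge r$ be non-negative integers, and let $X'\subset\mathbb P^{r'}=\mathbb P^{r'}_K$ be a non-degenerate (i.e. contained in no hyperplane) irreducible closed subvariety of dimension $\ge 2$. Let $S=K[x_0,\dots,x_r]$ and $S'=K[x_0,\dots,x_{r'}]$; let $I_Z$ denote the homogeneous vanishing ideal of a closed subvariety $Z$ of $\mathbb P^{n}$ in the polynomial ring $P$ in $n+1$ variables, write $\beta_{i,j}(P/I_Z)=\dim_K \mathrm{Tor}^{P}_i(K,P/I_Z)_{i+j}$, and let $\mathrm{reg}(Z)=1+\max\{j : \beta_{i,j}(P/I_Z)\neq 0 \text{ for some } i\ge 0\}$ be the Castelnuovo–Mumford regularity of $Z$. Assume that $X'$ satisfies the property $N_{2,p}$ for some integer $p\ge\max\{2,r'-r+1\}$, that is, $\beta_{i,j}(S'/I_{X'})=0$ whenever $1\le i\le p$ and $j\ne 1$. Let $\Lambda=\mathbb P^{r'-r-1}\subset\mathbb P^{r'}$ be a linear subspace with $X'\cap\Lambda=\emptyset$, let $\mathbb P^{r'}\setminus\Lambda\to\mathbb P^r$ be a linear projection with center $\Lambda$,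 let $X\subset\mathbb P^r$ be the image of $X'$, and let $\pi_\Lambda:X'\to X$ be the induced finite morphism. Assume that $\pi_\Lambda$ is almost non-singular, i.e. that the least closed subset $W\subset X$ for which $\pi_\Lambda$ restricts to an isomorphism $X'\setminus\pi_\Lambda^{-1}(W)\to X\setminus W$ is finite. Then: (a) the homogeneous vanishing ideal $I_X\subset S$ is generated by homogeneous polynomials of degrees $\le r'-r+2$; (b) $\mathrm{reg}(X)\le\max\{\mathrm{reg}(X'),\,r'-r+2\}$. -/

import Mathlib

open scoped LinearAlgebra.Projectivization

namespace ProjVar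

/-- The set of (closed) points of projective `n`-space over the field `K`. -/
abbrev PSpace (K : Type*) [Field K] (n : ℕ) : Type _ := ℙ K (Fin (n + 1) → K)

/-- The homogeneous coordinate ring `K[x_0, …, x_n]` of projective `n`-space. -/
abbrev CoordRing (K : Type*) [Field K] (n : ℕ) : Type _ := MvPolynomial (Fin (n + 1)) K

section Zariski

variable {K : Type*} [Field K] {n m : ℕ}

/-- The homogeneous polynomial `F` vanishes at the point `p`. (For homogeneous `F` this does not
depend on the representative of `p`; it is only used for such `F`.) -/
def VanishesAt (F : CoordRing K n) (p : PSpace K n) : Prop :=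
  MvPolynomial.eval p.rep F = 0

/-- The common zeros of a set of polynomials. -/
def zeroSet (T : Set (CoordRing K n)) : Set (PSpace K n) :=
  {p | ∀ F ∈ T, VanishesAt F p}

/-- An algebraic set: the zero set of a set of homogeneous polynomials. -/
def IsAlgebraicSet (Z : Set (PSpace K n)) : Prop :=
  ∃ T : Set (CoordRing K n), (∀ F ∈ T, ∃ d : ℕ, F.IsHomogeneous d) ∧ Z = zeroSet T

/-- The Zariski topology on projective space: the closed sets are the algebraic sets. -/
instance zariskiTopology : TopologicalSpace (PSpace K n) :=
  TopologicalSpace.ofClosed {Z | IsAlgebraicSet Z}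
    (by
      refine ⟨{1}, ?_, ?_⟩
      · rintro F rfl
        exact ⟨0, MvPolynomial.isHomogeneous_one _ _⟩
      · ext p
        simp [zeroSet, VanishesAt])
    (by
      intro A hA
      refine ⟨{F | (∃ d : ℕ, F.IsHomogeneous d) ∧ ∃ Z ∈ A, ∀ p ∈ Z, VanishesAt F p},
        fun F hF => hF.1, ?_⟩
      ext p
      constructor
      · rintro hp F ⟨-, Z, hZ, hF⟩
        exact hF p (hp Z hZ)
      · intro hp Z hZ
        obtain ⟨T, hT, rfl⟩ := hA hZ
        exact fun F hF => hp F ⟨hT F hF, _, hZ, fun q hq => hq F hF⟩)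
    (by
      rintro _ ⟨T, hT, rfl⟩ _ ⟨U, hU, rfl⟩
      refine ⟨{H | ∃ F ∈ T, ∃ G ∈ U, H = F * G}, ?_, ?_⟩
      · rintro _ ⟨F, hF, G, hG, rfl⟩
        obtain ⟨d, hd⟩ := hT F hF
        obtain ⟨e, he⟩ := hU G hG
        exact ⟨d + e, hd.mul he⟩
      · ext p
        constructor
        · rintro (hp | hp) _ ⟨F, hF, G, hG, rfl⟩
          · have h1 : MvPolynomial.eval p.rep F = 0 := hp F hF
            simp [VanishesAt, h1]
          · have h1 : MvPolynomial.eval p.rep G = 0 := hp G hG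
            simp [VanishesAt, h1]
        · intro hp
          by_contra hcon
          simp only [Set.mem_union, not_or] at hcon
          obtain ⟨h1, h2⟩ := hcon
          simp only [zeroSet, Set.mem_ofPred_eq, not_forall] at h1 h2
          obtain ⟨F, hF, hFp⟩ := h1
          obtain ⟨G, hG, hGp⟩ := h2
          have h3 : MvPolynomial.eval p.rep (F * G) = 0 := hp _ ⟨F, hF, G, hG, rfl⟩
          rw [map_mul] at h3
          exact (mul_eq_zero.mp h3).elim hFp hGp)

/-- A (projective) variety: an irreducible closed subset of projective space. -/
def IsVariety (Z : Set (PSpace K n)) : Prop :=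
  IsClosed Z ∧ IsIrreducible Z

/-- `Z` is non-degenerate: it is contained in no hyperplane. -/
def IsNondegenerate (Z : Set (PSpace K n)) : Prop :=
  ∀ F : CoordRing K n, F.IsHomogeneous 1 → (∀ p ∈ Z, VanishesAt F p) → F = 0

/-- The homogeneous vanishing ideal `I_Z`, generated by the homogeneous polynomials that
vanish on `Z`. -/
noncomputable def vanishingIdeal (Z : Set (PSpace K n)) : Ideal (CoordRing K n) :=
  Ideal.span {F | (∃ d : ℕ, F.IsHomogeneous d) ∧ ∀ p ∈ Z, VanishesAt F p}

/-- `f` is regular on `Y` (with values in projective `m`-space): locally on `Y` it is given by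
`m + 1` homogeneous polynomials of one and the same degree without common zero. -/
def IsRegularOn (f : PSpace K n → PSpace K m) (Y : Set (PSpace K n)) : Prop :=
  ∀ q ∈ Y, ∃ (d : ℕ) (F : Fin (m + 1) → CoordRing K n),
    (∀ j, (F j).IsHomogeneous d) ∧
    (fun j => MvPolynomial.eval q.rep (F j)) ≠ 0 ∧
    ∀ q' ∈ Y, ∀ h : (fun j => MvPolynomial.eval q'.rep (F j)) ≠ 0,
      f q' = Projectivization.mk K (fun j => MvPolynomial.eval q'.rep (F j)) h

/-- `f` restricts to an isomorphism from `Y` onto `Z` (as quasi-projective varieties):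
it is regular and has a regular inverse. -/
def IsIsoBetween (f : PSpace K n → PSpace K m) (Y : Set (PSpace K n)) (Z : Set (PSpace K m)) :
    Prop :=
  Set.MapsTo f Y Z ∧ IsRegularOn f Y ∧
    ∃ g : PSpace K m → PSpace K n, Set.MapsTo g Z Y ∧ IsRegularOn g Z ∧
      Set.LeftInvOn g f Y ∧ Set.RightInvOn g f Z

/-- The singular locus of the morphism `f : Y → f(Y)`: the least closed subset `W` of `f(Y)`
such that `f` restricts to an isomorphism `Y \ f⁻¹(W) → f(Y) \ W`. -/
def singularLocus (f : PSpace K n → PSpace K m) (Y : Set (PSpace K n)) : Set (PSpace K m) :=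
  ⋂₀ {W | W ⊆ f '' Y ∧ IsClosed W ∧ IsIsoBetween f (Y \ f ⁻¹' W) (f '' Y \ W)}

/-- The morphism `f : Y → f(Y)` is almost non-singular: its singular locus is finite. -/
def IsAlmostNonsingular (f : PSpace K n → PSpace K m) (Y : Set (PSpace K n)) : Prop :=
  (singularLocus f Y).Finite

/-- The center `Λ = ℙ(ker L)` of the linear projection given by the linear map `L`. -/
def center (L : (Fin (n + 1) → K) →ₗ[K] (Fin (m + 1) → K)) : Set (PSpace K n) :=
  {p | L p.rep = 0}

open Classical in
/-- The linear projection `[v] ↦ [L v]` given by the linear map `L`; it is meaningful outside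
the center of `L` only (on the center it takes an arbitrary value). -/
noncomputable def linearProjection (L : (Fin (n + 1) → K) →ₗ[K] (Fin (m + 1) → K)) :
    PSpace K n → PSpace K m := fun p =>
  if h : L p.rep ≠ 0 then Projectivization.mk K (L p.rep) h
  else Projectivization.mk K (fun _ => (1 : K)) (fun h => one_ne_zero (congrFun h 0))

end Zariski

section Betti

variable {K : Type*} [Field K] {n : ℕ}

/-- The degree `d` part of the graded ring `S / I`, for a homogeneous ideal `I` of
`S = K[x_0, …, x_n]`. -/
noncomputable def gradedPiece (I : Ideal (CoordRing K n)) (d : ℕ) : Submodule K (CoordRing K n ⧸ I) :=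
  (MvPolynomial.homogeneousSubmodule (Fin (n + 1)) K d).map
    (Ideal.Quotient.mkₐ K I).toLinearMap

/-- The differential of the Koszul complex `K(x_0, …, x_n; S / I) = ⋀ Kⁿ⁺¹ ⊗ S / I`. A chain is
written through its coefficients with respect to the basis vectors
`e_σ = e_{s_1} ∧ … ∧ e_{s_i}`, `σ = {s_1 < … < s_i}`, and
`∂ e_σ = ∑_a (-1)^(a-1) x_{s_a} e_{σ \ {s_a}}`. -/
noncomputable def koszulDifferential (I : Ideal (CoordRing K n)) :
    (Finset (Fin (n + 1)) → CoordRing K n ⧸ I) →ₗ[K]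
      (Finset (Fin (n + 1)) → CoordRing K n ⧸ I) where
  toFun c τ := ∑ k ∈ τᶜ, (-1) ^ (τ.filter (fun l => l < k)).card *
    (Ideal.Quotient.mk I (MvPolynomial.X k) * c (insert k τ))
  map_add' c c' := by
    funext τ
    simp only [Pi.add_apply, mul_add, Finset.sum_add_distrib]
  map_smul' a c := by
    funext τ
    simp only [Pi.smul_apply, RingHom.id_apply, Finset.smul_sum, mul_smul_comm]

/-- The Koszul chains of homological degree `i` and internal degree `m`, i.e. the subspace
`⋀^i Kⁿ⁺¹ ⊗ (S / I)_{m - i}` (which is zero for `m < i`). -/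
noncomputable def koszulChains (I : Ideal (CoordRing K n)) (i m : ℕ) :
    Submodule K (Finset (Fin (n + 1)) → CoordRing K n ⧸ I) :=
  Submodule.pi Set.univ fun σ =>
    if σ.card = i ∧ i ≤ m then gradedPiece I (m - i) else ⊥

/-- The cycles of homological degree `i` and internal degree `m`. -/
noncomputable def koszulCycles (I : Ideal (CoordRing K n)) (i m : ℕ) :
    Submodule K (Finset (Fin (n + 1)) → CoordRing K n ⧸ I) :=
  koszulChains I i m ⊓ LinearMap.ker (koszulDifferential I)

/-- The boundaries of homological degree `i` and internal degree `m`. -/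
noncomputable def koszulBoundaries (I : Ideal (CoordRing K n)) (i m : ℕ) :
    Submodule K (Finset (Fin (n + 1)) → CoordRing K n ⧸ I) :=
  (koszulChains I (i + 1) m).map (koszulDifferential I)

/-- `Tor_i^S(K, S / I)_m`, the degree `m` part of the graded module `Tor_i^S(K, S / I)`, computed
from the Koszul complex, which is the minimal graded free resolution of `K` over `S`. -/
abbrev TorPiece (I : Ideal (CoordRing K n)) (i m : ℕ) : Type _ :=
  koszulCycles I i m ⧸ (koszulBoundaries I i m).submoduleOf (koszulCycles I i m)

/-- The Betti number `β_{i,j}(S / I) = dim_K Tor_i^S(K, S / I)_{i+j}`.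
(These numbers vanish for negative `j`.) -/
noncomputable def bettiNumber (I : Ideal (CoordRing K n)) (i j : ℕ) : ℕ :=
  Module.finrank K (TorPiece I i (i + j))

/-- The Green-Lazarsfeld property `N_{2,p}` of a closed subset of projective space:
`β_{i,j}(S / I_Z) = 0` whenever `1 ≤ i ≤ p` and `j ≠ 1`. -/
def SatisfiesN2 (Z : Set (PSpace K n)) (p : ℕ) : Prop :=
  ∀ i j : ℕ, 1 ≤ i → i ≤ p → j ≠ 1 → bettiNumber (vanishingIdeal Z) i j = 0

/-- The Castelnuovo-Mumford regularity of `S / I`: the largest `j` with `β_{i,j}(S / I) ≠ 0` for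
some `i`, as a supremum in `ℕ∞`. -/
noncomputable def ringRegularity (I : Ideal (CoordRing K n)) : ℕ∞ :=
  sSup {a | ∃ i j : ℕ, bettiNumber I i j ≠ 0 ∧ a = (j : ℕ∞)}

/-- The Castelnuovo-Mumford regularity `reg(Z) = reg(S / I_Z) + 1` of a nonempty closed subset
`Z` of projective space. -/
noncomputable def regularity (Z : Set (PSpace K n)) : ℕ∞ :=
  ringRegularity (vanishingIdeal Z) + 1

/-- The homogeneous ideal `I` is generated by homogeneous polynomials of degrees `≤ d`. -/
def GeneratedInDegreesLE (I : Ideal (CoordRing K n)) (d : ℕ) : Prop :=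
  I = Ideal.span {F | F ∈ I ∧ ∃ e ≤ d, F.IsHomogeneous e}

end Betti

end ProjVar

/-! Put t = r' - r and R = S'/I_{X'}, regarded as an S-module through the projection. The kernel of
S → R is I_X (`projHom_eq_zero_iff`), so S/I_X embeds in R; let M be the cokernel. The plan is to
bound the Koszul homology of R and of M over S, and to read off that of S/I_X.

Since Λ misses X', the variables of S' are nilpotent on R modulo the linear forms of S
(`exists_mk_X_pow_eq_sum`). Dropping t variables that are nilpotent modulo the others from a Koszul
complex costs t homological degrees and nothing in the coefficient degree
(`KoszulVanishing.of_insert_of_isNilpotent`, `koszulVanishing_projHom`). Hence N_{2,p} with p ≥ t+1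
still controls Tor_0 and Tor_1 of R over S. Together with non-degeneracy this says that R is
generated by 1 and t linear forms, and that M is the cokernel of a matrix φ of linear forms with t
rows (`IsLinearCover.exists_eq_sum_of_mem_imagePiece`).

Almost non-singularity means that M is supported on finitely many points, so M/ℓM has finite length
for a general linear form ℓ (`IsLinearCover.exists_elimVar_nilpotent`). The core is a statement
about matrices of linear forms with t rows and finite length cokernel: the Buchsbaum-Rim complex is
exact at its q-th term in internal degrees ≥ q+t (`brExact_of_finite_length`). It is proved by
induction on the number of variables. A power of each variable annihilates the homology
(`exists_brD_eq_pow_smul`), while exactness modulo a variable makes that variable injective on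
homology in the relevant degrees (`exists_brD_eq_of_elimForm_smul`). Used modulo ℓ, it shows that ℓ
maps M_j onto M_{j+1} for j ≥ t and is injective on M_j for j ≥ t+1 (`coker_surjective`,
`coker_injective`; M is generated in degree 1).

A linear form acts as zero on Koszul homology, so a form that is bijective in this range kills the
homology of M with coefficients in degrees ≥ t+1 (`exists_sub_contraction_mem`). The vanishing for R
therefore descends to S/I_X with coefficients in degrees ≥ t+2
(`IsLinearCover.koszulVanishing_image`). Homological degree 1 gives (a), all homological degrees
together give (b). -/

namespace ProjVar

/-! ### Contraction and exterior multiplication in coordinates -/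

section ExteriorOperators

variable {ι : Type*} [LinearOrder ι] {A : Type*} [CommRing A]

/-- The sign of the position of `k` relative to `τ`. -/
def posSign (A : Type*) [CommRing A] (τ : Finset ι) (k : ι) : A :=
  (-1) ^ (τ.filter (fun l => l < k)).card

lemma posSign_mul_self (τ : Finset ι) (k : ι) : posSign A τ k * posSign A τ k = 1 := by
  rw [posSign, ← pow_add, ← two_mul, pow_mul]; simp

lemma posSign_insert {τ : Finset ι} {k : ι} (hk : k ∉ τ) (l : ι) :
    posSign A (insert k τ) l = (if k < l then -1 else 1) * posSign A τ l := by
  unfold posSign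
  rw [Finset.filter_insert]
  split_ifs with h
  · rw [Finset.card_insert_of_notMem (by simp [hk]), pow_succ]; ring
  · simp

lemma posSign_insert_self (τ : Finset ι) (k : ι) :
    posSign A (insert k τ) k = posSign A τ k := by
  unfold posSign
  rw [Finset.filter_insert, if_neg (lt_irrefl k)]

lemma posSign_erase_self (τ : Finset ι) (k : ι) :
    posSign A (τ.erase k) k = posSign A τ k := by
  unfold posSign
  congr 2
  ext l
  simp only [Finset.mem_filter, Finset.mem_erase]
  exact ⟨fun h => ⟨h.1.2, h.2⟩, fun h => ⟨⟨h.2.ne, h.1⟩, h.2⟩⟩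

lemma posSign_erase {τ : Finset ι} {k : ι} (hk : k ∈ τ) (l : ι) :
    posSign A (τ.erase k) l = (if k < l then -1 else 1) * posSign A τ l := by
  have h := posSign_insert (A := A) (Finset.notMem_erase k τ) l
  rw [Finset.insert_erase hk] at h
  rw [h, ← mul_assoc]
  split_ifs <;> simp

/-- Contraction with the `k`-th dual basis vector. -/
def interior (A : Type*) [CommRing A] (k : ι) : Module.End A (Finset ι → A) where
  toFun c τ := if k ∈ τ then 0 else posSign A τ k * c (insert k τ)
  map_add' c c' := by funext τ; simp only [Pi.add_apply]; split_ifs <;> ring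
  map_smul' a c := by
    funext τ; simp only [Pi.smul_apply, smul_eq_mul, RingHom.id_apply]; split_ifs <;> ring

/-- Exterior multiplication with the `k`-th basis vector. -/
def exterior (A : Type*) [CommRing A] (k : ι) : Module.End A (Finset ι → A) where
  toFun c τ := if k ∈ τ then posSign A τ k * c (τ.erase k) else 0
  map_add' c c' := by funext τ; simp only [Pi.add_apply]; split_ifs <;> ring
  map_smul' a c := by
    funext τ; simp only [Pi.smul_apply, smul_eq_mul, RingHom.id_apply]; split_ifs <;> ring

lemma interior_apply (k : ι) (c : Finset ι → A) (τ : Finset ι) :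
    interior A k c τ = if k ∈ τ then 0 else posSign A τ k * c (insert k τ) := rfl

lemma exterior_apply (k : ι) (c : Finset ι → A) (τ : Finset ι) :
    exterior A k c τ = if k ∈ τ then posSign A τ k * c (τ.erase k) else 0 := rfl

lemma interior_mul_interior (k l : ι) :
    interior A k * interior A l = -(interior A l * interior A k) := by
  ext1 c
  funext τ
  simp only [Module.End.mul_apply, LinearMap.neg_apply, Pi.neg_apply, interior_apply,
    Finset.mem_insert]
  rcases eq_or_ne k l with rfl | hkl
  · simp
  by_cases hk : k ∈ τ
  · simp [hk]
  by_cases hl : l ∈ τ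
  · simp [hl]
  simp only [hk, hl, hkl, hkl.symm, or_false, if_false, posSign_insert hk, posSign_insert hl,
    Finset.insert_comm k l]
  rcases lt_or_gt_of_ne hkl with h | h <;> simp only [h, h.not_gt, if_true, if_false] <;> ring

lemma interior_mul_exterior_self (k : ι) :
    interior A k * exterior A k + exterior A k * interior A k = 1 := by
  ext1 c
  funext τ
  simp only [Module.End.mul_apply, LinearMap.add_apply, Pi.add_apply, interior_apply,
    exterior_apply, Finset.mem_insert, true_or, if_true, Module.End.one_apply,
    Finset.notMem_erase, if_false]
  by_cases hk : k ∈ τ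
  · simp only [hk, if_true, Finset.insert_erase, posSign_erase_self, zero_add, ← mul_assoc,
      posSign_mul_self, one_mul]
  · simp only [hk, if_false, posSign_insert_self, Finset.erase_insert hk, ← mul_assoc,
      posSign_mul_self, one_mul, add_zero]

lemma interior_mul_exterior_of_ne {k l : ι} (hkl : k ≠ l) :
    interior A k * exterior A l + exterior A l * interior A k = 0 := by
  ext1 c
  funext τ
  simp only [Module.End.mul_apply, LinearMap.add_apply, Pi.add_apply, interior_apply,
    exterior_apply, Finset.mem_insert, Finset.mem_erase, LinearMap.zero_apply, Pi.zero_apply]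
  by_cases hk : k ∈ τ
  · simp [hk, hkl]
  by_cases hl : l ∈ τ
  · simp only [hk, hl, hkl.symm, if_true, if_false, and_false, or_true, posSign_insert hk,
      posSign_erase hl, Finset.erase_insert_of_ne hkl]
    rcases lt_or_gt_of_ne hkl with h | h <;> simp only [h, h.not_gt, if_true, if_false] <;> ring
  · simp [hk, hl, hkl.symm]

lemma exterior_interior (k : ι) (c : Finset ι → A) (τ : Finset ι) :
    exterior A k (interior A k c) τ = if k ∈ τ then c τ else 0 := by
  simp only [exterior_apply, interior_apply, Finset.notMem_erase, if_false, posSign_erase_self]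
  split_ifs with h
  · rw [← mul_assoc, posSign_mul_self, one_mul, Finset.insert_erase h]
  · rfl

variable [Fintype ι]

/-- Contraction with the linear form with coefficients `v`: the Koszul differential. -/
def contraction (v : ι → A) : Module.End A (Finset ι → A) := ∑ k, v k • interior A k

/-- Exterior multiplication with the vector with coordinates `u`. -/
def wedge (u : ι → A) : Module.End A (Finset ι → A) := ∑ k, u k • exterior A k

lemma contraction_mul_contraction (v w : ι → A) :
    contraction v * contraction w = -(contraction w * contraction v) := by
  simp only [contraction, Finset.sum_mul_sum, smul_mul_smul_comm]
  rw [Finset.sum_comm, ← Finset.sum_neg_distrib]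
  refine Finset.sum_congr rfl fun k _ => ?_
  rw [← Finset.sum_neg_distrib]
  refine Finset.sum_congr rfl fun l _ => ?_
  rw [interior_mul_interior, smul_neg, mul_comm]

lemma contraction_contraction_swap (v w : ι → A) (c : Finset ι → A) :
    contraction v (contraction w c) = -contraction w (contraction v c) := by
  simpa using LinearMap.congr_fun (contraction_mul_contraction v w) c

lemma contraction_apply (v : ι → A) (c : Finset ι → A) (τ : Finset ι) :
    contraction v c τ = ∑ k ∈ τᶜ, posSign A τ k * (v k * c (insert k τ)) := by
  simp only [contraction, LinearMap.coe_sum, Finset.sum_apply, LinearMap.smul_apply,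
    Pi.smul_apply, interior_apply, smul_eq_mul]
  rw [← Finset.sum_subset (Finset.subset_univ τᶜ)]
  · refine Finset.sum_congr rfl fun k hk => ?_
    rw [if_neg (Finset.mem_compl.mp hk)]; ring
  · intro k _ hk
    rw [if_pos (by simpa using hk), mul_zero]

/-- Anticommutation alone only gives that twice the square vanishes, so the terms (k, l) and (l, k)
are cancelled in pairs; this also covers characteristic 2. -/
lemma contraction_contraction_self (v : ι → A) (c : Finset ι → A) :
    contraction v (contraction v c) = 0 := by
  have key : contraction v * contraction v = 0 := by
    simp only [contraction, Finset.sum_mul_sum, smul_mul_smul_comm]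
    rw [← Finset.sum_product']
    refine Finset.sum_involution (fun p _ => (p.2, p.1)) ?_ ?_ ?_ ?_
    · rintro ⟨k, l⟩ -
      simp only
      rw [interior_mul_interior k l, mul_comm (v l)]
      simp
    · rintro ⟨k, l⟩ - h heq
      simp only [Prod.mk.injEq] at heq
      apply h
      have : interior A k * interior A k = 0 := by
        refine LinearMap.ext fun c => funext fun τ => ?_
        simp [interior_apply]
      simp [heq.1, this]
    · simp
    · simp
  simpa using LinearMap.congr_fun key c

/-- The Clifford relation. All the homotopies below, for Koszul as well as for Buchsbaum-Rim
complexes, come from it. -/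
lemma contraction_mul_wedge (v u : ι → A) :
    contraction v * wedge u + wedge u * contraction v = (∑ k, u k * v k) • 1 := by
  simp only [contraction, wedge, Finset.sum_mul_sum, smul_mul_smul_comm]
  rw [Finset.sum_comm (f := fun k l => (u k * v l) • (exterior A k * interior A l)),
    ← Finset.sum_add_distrib, Finset.sum_smul]
  refine Finset.sum_congr rfl fun k _ => ?_
  rw [← Finset.sum_add_distrib, Finset.sum_eq_single k]
  · rw [mul_comm (v k), ← smul_add, interior_mul_exterior_self]
  · intro l _ hl
    rw [mul_comm (v k), ← smul_add, interior_mul_exterior_of_ne hl.symm, smul_zero]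
  · simp

lemma contraction_wedge (v u : ι → A) (c : Finset ι → A) :
    contraction v (wedge u c) = (∑ k, u k * v k) • c - wedge u (contraction v c) := by
  rw [eq_sub_iff_add_eq]
  simpa using LinearMap.congr_fun (contraction_mul_wedge v u) c

lemma contraction_exterior (v : ι → A) (k : ι) (c : Finset ι → A) :
    contraction v (exterior A k c) = v k • c - exterior A k (contraction v c) := by
  have h := contraction_wedge v (Pi.single k 1) c
  have hw : wedge (Pi.single k (1 : A)) = exterior A k := by
    rw [wedge, Finset.sum_eq_single k]
    · simp
    · intro l _ hl; simp [hl]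
    · simp
  rw [hw, Finset.sum_eq_single k] at h
  · simpa using h
  · intro l _ hl; simp [hl]
  · simp

lemma interior_contraction (v : ι → A) (k : ι) (c : Finset ι → A) :
    interior A k (contraction v c) = -contraction v (interior A k c) := by
  have hw : contraction (Pi.single k (1 : A)) = interior A k := by
    rw [contraction, Finset.sum_eq_single k]
    · simp
    · intro l _ hl; simp [hl]
    · simp
  rw [← hw, contraction_contraction_swap]

lemma wedge_apply (u : ι → A) (c : Finset ι → A) (τ : Finset ι) :
    wedge u c τ = ∑ k ∈ τ, posSign A τ k * (u k * c (τ.erase k)) := by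
  simp only [wedge, LinearMap.coe_sum, Finset.sum_apply, LinearMap.smul_apply,
    Pi.smul_apply, exterior_apply, smul_eq_mul]
  rw [← Finset.sum_subset (Finset.subset_univ τ)]
  · refine Finset.sum_congr rfl fun k hk => ?_
    rw [if_pos hk]; ring
  · intro k _ hk
    rw [if_neg hk, mul_zero]

lemma map_contraction {B : Type*} [CommRing B] (f : A →+* B) (v : ι → A) (c : Finset ι → A)
    (τ : Finset ι) :
    f (contraction v c τ) = contraction (fun k => f (v k)) (fun σ => f (c σ)) τ := by
  simp [contraction_apply, posSign, map_sum, map_mul]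

end ExteriorOperators

end ProjVar

namespace ProjVar

/-! ### The Buchsbaum-Rim complex and its homotopies -/

section BuchsbaumRim

variable {ι : Type*} [LinearOrder ι] [Fintype ι] {A : Type*} [CommRing A] {t : ℕ}

/-- The composition of the contractions with the rows of `φ` whose indices are in `l`. -/
def contractionList (φ : Fin t → ι → A) (l : List (Fin t)) : Module.End A (Finset ι → A) :=
  (l.map fun i => contraction (φ i)).prod

lemma contractionList_cons (φ : Fin t → ι → A) (i : Fin t) (l : List (Fin t)) (c : Finset ι → A) :
    contractionList φ (i :: l) c = contraction (φ i) (contractionList φ l c) := by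
  simp [contractionList]

lemma contraction_contractionList (φ : Fin t → ι → A) (v : ι → A) (l : List (Fin t))
    (c : Finset ι → A) :
    contraction v (contractionList φ l c) =
      (-1 : A) ^ l.length • contractionList φ l (contraction v c) := by
  induction l with
  | nil => simp [contractionList]
  | cons i l ih =>
    rw [contractionList_cons, contraction_contraction_swap, ih, contractionList_cons, map_smul,
      List.length_cons, pow_succ, mul_neg_one, neg_smul]

lemma contractionList_contraction_of_mem (φ : Fin t → ι → A) {l : List (Fin t)} {j : Fin t}
    (hj : j ∈ l) (c : Finset ι → A) : contractionList φ l (contraction (φ j) c) = 0 := by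
  induction l with
  | nil => simp at hj
  | cons i l ih =>
    rw [contractionList_cons]
    by_cases h : j ∈ l
    · rw [ih h, map_zero]
    · obtain rfl : j = i := (List.mem_cons.mp hj).resolve_right h
      rw [contraction_contractionList, contraction_contraction_self, map_zero, smul_zero]

lemma contraction_contractionList_of_mem (φ : Fin t → ι → A) {l : List (Fin t)} {j : Fin t}
    (hj : j ∈ l) (c : Finset ι → A) : contraction (φ j) (contractionList φ l c) = 0 := by
  rw [contraction_contractionList, contractionList_contraction_of_mem φ hj, smul_zero]

/-- The terms of the Buchsbaum-Rim complex are direct summands of this module: the value at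
`a : Fin t → ℕ` is the coefficient (in the exterior algebra) of the divided power monomial with
exponent `a`. -/
abbrev BRModule (ι A : Type*) (t : ℕ) : Type _ := (Fin t → ℕ) → Finset ι → A

/-- The differential `∧^{k+1} F ⊗ D_{j+1} → ∧^k F ⊗ D_j`. -/
def brLower (φ : Fin t → ι → A) : BRModule ι A t →ₗ[A] BRModule ι A t where
  toFun c a := ∑ i, contraction (φ i) (c (a + Pi.single i 1))
  map_add' c c' := by funext a; simp [Finset.sum_add_distrib]
  map_smul' r c := by funext a; simp [Finset.smul_sum]

/-- The map `F → Aᵗ` given by `φ`. -/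
def brAugment (φ : Fin t → ι → A) : BRModule ι A t →ₗ[A] BRModule ι A t where
  toFun c a := ∑ i, if a = Pi.single i 1 then contraction (φ i) (c 0) else 0
  map_add' c c' := by
    funext a; simp only [Pi.add_apply, map_add, ← Finset.sum_add_distrib]
    exact Finset.sum_congr rfl fun i _ => by split_ifs <;> simp
  map_smul' r c := by
    funext a; simp only [Pi.smul_apply, map_smul, Finset.smul_sum, RingHom.id_apply]
    exact Finset.sum_congr rfl fun i _ => by split_ifs <;> simp

/-- The splicing map `∧^{t+1} F → F`. -/
def brSplice (φ : Fin t → ι → A) : BRModule ι A t →ₗ[A] BRModule ι A t where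
  toFun c a := if a = 0 then contractionList φ (List.finRange t) (c 0) else 0
  map_add' c c' := by funext a; simp only [Pi.add_apply, map_add]; split_ifs <;> simp
  map_smul' r c := by
    funext a; simp only [Pi.smul_apply, map_smul, RingHom.id_apply]; split_ifs <;> simp

/-- The differentials of the Buchsbaum-Rim complex of `φ`, indexed by the homological degree of
their source. -/
def brD (φ : Fin t → ι → A) : ℕ → (BRModule ι A t →ₗ[A] BRModule ι A t)
  | 0 => 0
  | 1 => brAugment φ
  | 2 => brSplice φ
  | _ + 3 => brLower φ

lemma brLower_apply (φ : Fin t → ι → A) (c : BRModule ι A t) (a : Fin t → ℕ) :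
    brLower φ c a = ∑ i, contraction (φ i) (c (a + Pi.single i 1)) := rfl

lemma brAugment_apply (φ : Fin t → ι → A) (c : BRModule ι A t) (a : Fin t → ℕ) :
    brAugment φ c a = ∑ i, if a = Pi.single i 1 then contraction (φ i) (c 0) else 0 := rfl

lemma brSplice_apply (φ : Fin t → ι → A) (c : BRModule ι A t) (a : Fin t → ℕ) :
    brSplice φ c a = if a = 0 then contractionList φ (List.finRange t) (c 0) else 0 := rfl

lemma single_one_injective {i j : Fin t} (h : (Pi.single i 1 : Fin t → ℕ) = Pi.single j 1) :
    i = j := by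
  by_contra hij
  have := congrFun h i
  simp [hij] at this

lemma brAugment_single (φ : Fin t → ι → A) (c : BRModule ι A t) (i : Fin t) :
    brAugment φ c (Pi.single i 1) = contraction (φ i) (c 0) := by
  rw [brAugment_apply, Finset.sum_eq_single i]
  · simp
  · intro j _ hj
    rw [if_neg fun h => hj (single_one_injective h).symm]
  · simp

lemma brAugment_of_ne (φ : Fin t → ι → A) (c : BRModule ι A t) {a : Fin t → ℕ}
    (ha : ∀ i, a ≠ Pi.single i 1) : brAugment φ c a = 0 := by
  rw [brAugment_apply]
  exact Finset.sum_eq_zero fun i _ => if_neg (ha i)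

/-- Around the splice, a row is contracted twice. Further up, the terms indexed by (i, j) and (j, i)
cancel because contractions anticommute while divided power exponents commute. -/
lemma brD_comp (φ : Fin t → ι → A) (q : ℕ) (c : BRModule ι A t) :
    brD φ q (brD φ (q + 1) c) = 0 := by
  match q with
  | 0 => rfl
  | 1 =>
    funext a
    change brAugment φ (brSplice φ c) a = 0
    rw [brAugment_apply]
    refine Finset.sum_eq_zero fun i _ => ?_
    split_ifs
    · rw [brSplice_apply, if_pos rfl, contraction_contractionList_of_mem φ (List.mem_finRange i)]
    · rfl
  | 2 =>
    funext a
    change brSplice φ (brLower φ c) a = 0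
    rw [brSplice_apply]
    split_ifs
    · rw [brLower_apply, map_sum]
      exact Finset.sum_eq_zero fun i _ =>
        contractionList_contraction_of_mem φ (List.mem_finRange i) _
    · rfl
  | q + 3 =>
    funext a
    change ∑ i, contraction (φ i) (∑ j, contraction (φ j) (c (a + Pi.single i 1 + Pi.single j 1)))
      = 0
    simp only [map_sum]
    rw [← Finset.sum_product']
    refine Finset.sum_involution (fun p _ => (p.2, p.1)) ?_ ?_ ?_ ?_
    · rintro ⟨i, j⟩ -
      simp only
      rw [contraction_contraction_swap, add_right_comm]
      simp
    · rintro ⟨i, j⟩ - h heq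
      simp only [Prod.mk.injEq] at heq
      exact h (by simp [heq.1, contraction_contraction_self])
    · simp
    · simp

/-- The contracting homotopy in the direction `i`. -/
def brRaise (u : ι → A) (i : Fin t) : BRModule ι A t →ₗ[A] BRModule ι A t where
  toFun c a := if a i = 0 then 0 else wedge u (c (a - Pi.single i 1))
  map_add' c c' := by funext a; simp only [Pi.add_apply, map_add]; split_ifs <;> simp
  map_smul' r c := by
    funext a; simp only [Pi.smul_apply, map_smul, RingHom.id_apply]; split_ifs <;> simp

/-- The error term of the homotopy `brRaise`. -/
def brRetract (φ : Fin t → ι → A) (u : ι → A) (i : Fin t) :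
    BRModule ι A t →ₗ[A] BRModule ι A t where
  toFun c a := if a i = 0 then wedge u (contraction (φ i) (c a)) else 0
  map_add' c c' := by funext a; simp only [Pi.add_apply, map_add]; split_ifs <;> simp
  map_smul' r c := by
    funext a; simp only [Pi.smul_apply, map_smul, RingHom.id_apply]; split_ifs <;> simp

/-- The vector `u` is mapped by the matrix to F times the i-th basis vector. The Clifford relation
then makes `brRaise u i` a homotopy between multiplication by F and a remainder living only where
the exponent in direction i is zero. -/
lemma brLower_brRaise (φ : Fin t → ι → A) {u : ι → A} {i : Fin t} {F : A}
    (hu : ∀ j, ∑ k, u k * φ j k = if j = i then F else 0) (c : BRModule ι A t) :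
    brLower φ (brRaise u i c) = F • c - brRaise u i (brLower φ c) - brRetract φ u i c := by
  funext a
  have e1 : brLower φ (brRaise u i c) a = contraction (φ i) (wedge u (c a)) +
      ∑ j ∈ Finset.univ.erase i, if a i = 0 then 0 else
        contraction (φ j) (wedge u (c (a - Pi.single i 1 + Pi.single j 1))) := by
    change ∑ j, contraction (φ j) (if (a + Pi.single j 1 : Fin t → ℕ) i = 0 then 0 else
      wedge u (c (a + Pi.single j 1 - Pi.single i 1))) = _
    rw [← Finset.add_sum_erase _ _ (Finset.mem_univ i)]
    congr 1
    · simp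
    · refine Finset.sum_congr rfl fun j hj => ?_
      have hji : j ≠ i := Finset.ne_of_mem_erase hj
      have : (a + Pi.single j 1 : Fin t → ℕ) i = a i := by simp [hji.symm]
      rw [this]
      split_ifs with h
      · simp
      · congr 4
        funext k
        simp only [Pi.sub_apply, Pi.add_apply]
        rcases eq_or_ne k i with rfl | hk
        · simp [hji.symm]
        · simp [hk]
  have e2 : brRaise u i (brLower φ c) a = if a i = 0 then 0 else
      wedge u (contraction (φ i) (c a)) + ∑ j ∈ Finset.univ.erase i,
        wedge u (contraction (φ j) (c (a - Pi.single i 1 + Pi.single j 1))) := by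
    change (if a i = 0 then 0 else wedge u (∑ j, contraction (φ j)
      (c (a - Pi.single i 1 + Pi.single j 1)))) = _
    split_ifs with h
    · rfl
    · rw [map_sum, ← Finset.add_sum_erase _ _ (Finset.mem_univ i)]
      congr 4
      funext k
      simp only [Pi.sub_apply, Pi.add_apply]
      rcases eq_or_ne k i with rfl | hk
      · simp only [Pi.single_eq_same]; omega
      · simp [hk]
  have e3 : brRetract φ u i c a = if a i = 0 then wedge u (contraction (φ i) (c a)) else 0 := rfl
  rw [Pi.sub_apply, Pi.sub_apply, Pi.smul_apply, e1, e2, e3, contraction_wedge, hu, if_pos rfl]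
  split_ifs with h
  · simp
  · rw [← sub_sub, sub_zero, sub_eq_add_neg _ (Finset.sum _ _), ← Finset.sum_neg_distrib]
    congr 1
    refine Finset.sum_congr rfl fun j hj => ?_
    rw [contraction_wedge, hu, if_neg (Finset.ne_of_mem_erase hj), zero_smul, zero_sub]

/-- The composition of the error terms of the homotopies. -/
def retractList (φ : Fin t → ι → A) (u : Fin t → ι → A) (l : List (Fin t)) :
    Module.End A (Finset ι → A) :=
  (l.map fun i => wedge (u i) * contraction (φ i)).prod

lemma retractList_cons (φ u : Fin t → ι → A) (i : Fin t) (l : List (Fin t)) (c : Finset ι → A) :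
    retractList φ u (i :: l) c = wedge (u i) (contraction (φ i) (retractList φ u l c)) := by
  simp [retractList]

/-- Passing one wedge and one contraction produces two signs, which cancel; the scalar terms vanish
because the index is not in the list. -/
lemma contraction_retractList {φ u : Fin t → ι → A} {F : A}
    (hu : ∀ i j, ∑ k, u i k * φ j k = if j = i then F else 0) {i : Fin t} {l : List (Fin t)}
    (hi : i ∉ l) (c : Finset ι → A) :
    contraction (φ i) (retractList φ u l c) = retractList φ u l (contraction (φ i) c) := by
  induction l with
  | nil => rfl
  | cons j l ih =>
    rw [List.mem_cons, not_or] at hi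
    rw [retractList_cons, retractList_cons, contraction_wedge, hu, if_neg hi.1, zero_smul,
      zero_sub, contraction_contraction_swap, ih hi.2, map_neg, neg_neg]

/-- All contractions can be moved to the right of the wedges, where they form the iterated
contraction that is assumed to vanish. -/
lemma retractList_eq_zero {φ u : Fin t → ι → A} {F : A}
    (hu : ∀ i j, ∑ k, u i k * φ j k = if j = i then F else 0) {l : List (Fin t)}
    (hl : l.Nodup) (c : Finset ι → A) (hc : contractionList φ l c = 0) :
    retractList φ u l c = 0 := by
  induction l generalizing c with
  | nil => exact hc
  | cons i l ih =>
    rw [List.nodup_cons] at hl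
    rw [retractList_cons, contraction_retractList hu hl.1, ih hl.2, map_zero]
    rw [contractionList_cons, contraction_contractionList] at hc
    have := congrArg (fun x => (-1 : A) ^ l.length • x) hc
    simpa [smul_smul, ← mul_pow] using this

end BuchsbaumRim

end ProjVar

namespace ProjVar

open MvPolynomial

lemma homogeneousComponent_mul_of_isHomogeneous {σ K : Type*} [CommRing K]
    {x : MvPolynomial σ K} {m : ℕ} (hx : x.IsHomogeneous m) (g : ℕ) (f : MvPolynomial σ K) :
    homogeneousComponent (m + g) (x * f) = x * homogeneousComponent g f := by
  conv_lhs => rw [← sum_homogeneousComponent f, Finset.mul_sum, map_sum]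
  have h : ∀ i, homogeneousComponent (m + g) (x * homogeneousComponent i f) =
      if i = g then x * homogeneousComponent i f else 0 := fun i => by
    rw [homogeneousComponent_of_mem (hx.mul (homogeneousComponent_isHomogeneous i f))]
    simp [eq_comm]
  simp only [h, Finset.sum_ite_eq']
  split_ifs with hg
  · rfl
  · rw [homogeneousComponent_eq_zero, mul_zero]
    simpa using hg

/-! ### Gradings on forms and on the Buchsbaum-Rim modules -/

section Pieces

variable {ι τ K : Type*} [CommRing K] {t : ℕ}

/-- The exterior forms of degree `s` whose coefficients are homogeneous of degree `g`. -/
def forms (ι τ K : Type*) [CommRing K] (s g : ℕ) :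
    Submodule K (Finset ι → MvPolynomial τ K) where
  carrier := {c | ∀ σ, (c σ).IsHomogeneous g ∧ (c σ ≠ 0 → σ.card = s)}
  add_mem' {a b} ha hb σ := by
    refine ⟨(ha σ).1.add (hb σ).1, fun h => ?_⟩
    by_cases h1 : a σ = 0
    · exact (hb σ).2 fun h2 => h (by simp [h1, h2])
    · exact (ha σ).2 h1
  zero_mem' σ := ⟨isHomogeneous_zero _ _ _, fun h => absurd rfl h⟩
  smul_mem' r c hc σ := ⟨(homogeneousSubmodule τ K g).smul_mem r (hc σ).1, fun h =>
    (hc σ).2 fun h' => h (by simp [h'])⟩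

lemma smul_mem_forms {s g e : ℕ} {F : MvPolynomial τ K} (hF : F.IsHomogeneous e)
    {c : Finset ι → MvPolynomial τ K} (hc : c ∈ forms ι τ K s g) :
    F • c ∈ forms ι τ K s (g + e) := fun σ => by
  refine ⟨?_, fun h => (hc σ).2 fun h' => h (by simp [h'])⟩
  rw [add_comm]
  exact hF.mul (hc σ).1

lemma posSign_mul_isHomogeneous [LinearOrder ι] {σ : Finset ι} {k : ι} {f : MvPolynomial τ K} {g : ℕ}
    (hf : f.IsHomogeneous g) : (posSign (MvPolynomial τ K) σ k * f).IsHomogeneous g := by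
  rcases neg_one_pow_eq_or (MvPolynomial τ K) (σ.filter (fun l => l < k)).card with h | h <;>
    simp only [posSign, h, one_mul, neg_one_mul, hf, hf.neg]

/-- The elements of exterior degree `s`, divided power degree `α` and coefficient degree `g`. -/
def pieces (ι τ K : Type*) [CommRing K] (t α s g : ℕ) :
    Submodule K (BRModule ι (MvPolynomial τ K) t) where
  carrier := {c | ∀ a, c a ∈ forms ι τ K s g ∧ (c a ≠ 0 → ∑ i, a i = α)}
  add_mem' {x y} hx hy a := by
    refine ⟨add_mem (hx a).1 (hy a).1, fun h => ?_⟩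
    by_cases h1 : x a = 0
    · exact (hy a).2 fun h2 => h (by simp [h1, h2])
    · exact (hx a).2 h1
  zero_mem' a := ⟨zero_mem _, fun h => absurd rfl h⟩
  smul_mem' r c hc a := ⟨(forms ι τ K s g).smul_mem r (hc a).1, fun h =>
    (hc a).2 fun h' => h (by simp [h'])⟩

lemma smul_mem_pieces {α s g e : ℕ} {F : MvPolynomial τ K} (hF : F.IsHomogeneous e)
    {c : BRModule ι (MvPolynomial τ K) t} (hc : c ∈ pieces ι τ K t α s g) :
    F • c ∈ pieces ι τ K t α s (g + e) := fun a =>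
  ⟨smul_mem_forms hF (hc a).1, fun h => (hc a).2 fun h' => h (by simp [h'])⟩

variable [LinearOrder ι] [Fintype ι]

lemma contraction_mem_forms {s g e : ℕ} {v : ι → MvPolynomial τ K}
    (hv : ∀ k, (v k).IsHomogeneous e) {c : Finset ι → MvPolynomial τ K}
    (hc : c ∈ forms ι τ K (s + 1) g) : contraction v c ∈ forms ι τ K s (g + e) := fun σ => by
  rw [contraction_apply]
  refine ⟨IsHomogeneous.sum _ _ _ fun k _ => posSign_mul_isHomogeneous ?_, fun h => ?_⟩
  · rw [add_comm]; exact (hv k).mul (hc _).1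
  · obtain ⟨k, hk, h⟩ := Finset.exists_ne_zero_of_sum_ne_zero h
    have := (hc (insert k σ)).2 fun h' => h (by simp [h'])
    rw [Finset.card_insert_of_notMem (Finset.mem_compl.mp hk)] at this
    omega

lemma contraction_eq_zero_of_mem_forms {g : ℕ} (v : ι → MvPolynomial τ K)
    {c : Finset ι → MvPolynomial τ K} (hc : c ∈ forms ι τ K 0 g) : contraction v c = 0 := by
  funext σ
  rw [contraction_apply]
  refine Finset.sum_eq_zero fun k _ => ?_
  by_contra h
  have := (hc (insert k σ)).2 fun h' => h (by simp [h'])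
  simp at this

lemma wedge_mem_forms {s g e : ℕ} {u : ι → MvPolynomial τ K}
    (hu : ∀ k, (u k).IsHomogeneous e) {c : Finset ι → MvPolynomial τ K}
    (hc : c ∈ forms ι τ K s g) : wedge u c ∈ forms ι τ K (s + 1) (g + e) := fun σ => by
  rw [wedge_apply]
  refine ⟨IsHomogeneous.sum _ _ _ fun k _ => posSign_mul_isHomogeneous ?_, fun h => ?_⟩
  · rw [add_comm]; exact (hu k).mul (hc _).1
  · obtain ⟨k, hk, h⟩ := Finset.exists_ne_zero_of_sum_ne_zero h
    have := (hc (σ.erase k)).2 fun h' => h (by simp [h'])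
    rw [← this, Finset.card_erase_add_one hk]

lemma contractionList_mem_forms {s g : ℕ} {φ : Fin t → ι → MvPolynomial τ K}
    (hφ : ∀ i k, (φ i k).IsHomogeneous 1) (l : List (Fin t)) {c : Finset ι → MvPolynomial τ K}
    (hc : c ∈ forms ι τ K (s + l.length) g) :
    contractionList φ l c ∈ forms ι τ K s (g + l.length) := by
  induction l generalizing s with
  | nil => exact hc
  | cons i l ih =>
    rw [contractionList_cons, List.length_cons, ← add_assoc]
    refine contraction_mem_forms (hφ i) (ih ?_)
    rwa [add_right_comm, add_assoc]

lemma sum_add_single (a : Fin t → ℕ) (i : Fin t) :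
    ∑ j, (a + Pi.single i 1 : Fin t → ℕ) j = ∑ j, a j + 1 := by
  simp [Finset.sum_add_distrib]

lemma brLower_mem_pieces {α s g : ℕ} {φ : Fin t → ι → MvPolynomial τ K}
    (hφ : ∀ i k, (φ i k).IsHomogeneous 1) {c : BRModule ι (MvPolynomial τ K) t}
    (hc : c ∈ pieces ι τ K t (α + 1) (s + 1) g) :
    brLower φ c ∈ pieces ι τ K t α s (g + 1) := fun a => by
  rw [brLower_apply]
  refine ⟨sum_mem fun i _ => contraction_mem_forms (hφ i) (hc _).1, fun h => ?_⟩
  obtain ⟨i, -, h⟩ := Finset.exists_ne_zero_of_sum_ne_zero h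
  have := (hc (a + Pi.single i 1)).2 fun h' => h (by simp [h'])
  rw [sum_add_single] at this
  omega

lemma brLower_eq_zero_of_mem_pieces {s g : ℕ} (φ : Fin t → ι → MvPolynomial τ K)
    {c : BRModule ι (MvPolynomial τ K) t} (hc : c ∈ pieces ι τ K t 0 s g) :
    brLower φ c = 0 := by
  funext a
  rw [brLower_apply]
  refine Finset.sum_eq_zero fun i _ => ?_
  by_contra h
  have := (hc (a + Pi.single i 1)).2 fun h' => h (by simp [h'])
  rw [sum_add_single] at this
  omega

lemma brRaise_mem_pieces {α s g e : ℕ} {u : ι → MvPolynomial τ K}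
    (hu : ∀ k, (u k).IsHomogeneous e) (i : Fin t) {c : BRModule ι (MvPolynomial τ K) t}
    (hc : c ∈ pieces ι τ K t α s g) :
    brRaise u i c ∈ pieces ι τ K t (α + 1) (s + 1) (g + e) := fun a => by
  change (if a i = 0 then 0 else _) ∈ _ ∧ ((if a i = 0 then 0 else _) ≠ 0 → _)
  split_ifs with hi
  · exact ⟨zero_mem _, fun h => absurd rfl h⟩
  refine ⟨wedge_mem_forms hu (hc _).1, fun h => ?_⟩
  have := (hc (a - Pi.single i 1)).2 fun h' => h (by simp [h'])
  rw [← this, ← sum_add_single (a - Pi.single i 1) i]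
  refine Finset.sum_congr rfl fun j _ => ?_
  rcases eq_or_ne j i with rfl | hj
  · simp; omega
  · simp [hj]

lemma retractList_mem_forms {s g e : ℕ} {φ u : Fin t → ι → MvPolynomial τ K}
    (hφ : ∀ i k, (φ i k).IsHomogeneous 1) (hu : ∀ i k, (u i k).IsHomogeneous e)
    (l : List (Fin t)) {c : Finset ι → MvPolynomial τ K} (hc : c ∈ forms ι τ K s g) :
    retractList φ u l c ∈ forms ι τ K s (g + l.length * (e + 1)) := by
  induction l with
  | nil => simpa [retractList] using hc
  | cons i l ih =>
    rw [retractList_cons]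
    cases s with
    | zero =>
      rw [contraction_eq_zero_of_mem_forms _ ih, map_zero]
      exact zero_mem _
    | succ s =>
      have := wedge_mem_forms (hu i) (contraction_mem_forms (hφ i) ih)
      convert this using 1
      rw [List.length_cons]; congr 1; ring

end Pieces

/-! ### Annihilation of the Buchsbaum-Rim homology -/

section Torsion

variable {ι τ K : Type*} [LinearOrder ι] [Fintype ι] [CommRing K] {t : ℕ}
  {φ u : Fin t → ι → MvPolynomial τ K} {F : MvPolynomial τ K} {e : ℕ}

/-- Applying the homotopies for the directions in `l` one after the other multiplies the cycle by a
power of F, up to a remainder concentrated where all these exponents vanish. The degree of `w` is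
one less than the displayed sum; for empty `l` that could be negative, which is why it is stated
conditionally and `w = 0` is recorded. -/
lemma exists_brLower_eq_sub_retractList
    (hφ : ∀ i k, (φ i k).IsHomogeneous 1) (hu : ∀ i k, (u i k).IsHomogeneous e)
    (hF : F.IsHomogeneous (e + 1))
    (h : ∀ i j, ∑ k, u i k * φ j k = if j = i then F else 0) {α s g : ℕ}
    {z : BRModule ι (MvPolynomial τ K) t} (hz : z ∈ pieces ι τ K t α s g)
    (hz0 : brLower φ z = 0) (l : List (Fin t)) :
    ∃ w, (∀ d, d + 1 = g + l.length * (e + 1) → w ∈ pieces ι τ K t (α + 1) (s + 1) d) ∧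
      (l = [] → w = 0) ∧ brLower φ w = F ^ l.length • z -
        fun a => if ∀ i ∈ l, a i = 0 then retractList φ u l (z a) else 0 := by
  induction l with
  | nil =>
    refine ⟨0, fun _ _ => zero_mem _, fun _ => rfl, ?_⟩
    funext a
    simp [retractList]
  | cons i l ih =>
    obtain ⟨w, hw, hw0, hwz⟩ := ih
    set P : BRModule ι (MvPolynomial τ K) t :=
      fun a => if ∀ i ∈ l, a i = 0 then retractList φ u l (z a) else 0 with hP
    -- The remainder is again a cycle, so the next homotopy applies to it without a correction term.
    have hP0 : brLower φ P = 0 := by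
      have h1 : P = F ^ l.length • z - brLower φ w := by rw [hwz]; abel
      rw [h1, map_sub, map_smul, hz0, smul_zero, zero_sub, neg_eq_zero]
      exact brD_comp φ 3 w
    have hPp : P ∈ pieces ι τ K t α s (g + l.length * (e + 1)) := fun a => by
      simp only [hP]
      split_ifs
      · exact ⟨retractList_mem_forms hφ hu l (hz a).1, fun h => (hz a).2 fun h' => h (by simp [h'])⟩
      · exact ⟨zero_mem _, fun h => absurd rfl h⟩
    refine ⟨F • w + brRaise (u i) i P, fun d hd => add_mem ?_ ?_, by simp, ?_⟩
    · by_cases hl : l = []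
      · rw [hw0 hl, smul_zero]
        exact zero_mem _
      · have hpos : 1 ≤ l.length * (e + 1) :=
          Nat.mul_pos (List.length_pos_iff.mpr hl) (Nat.succ_pos e)
        rw [List.length_cons, add_mul, one_mul] at hd
        obtain ⟨d', hd'⟩ : ∃ d', d' + 1 = g + l.length * (e + 1) :=
          ⟨g + l.length * (e + 1) - 1, by omega⟩
        obtain rfl : d = d' + (e + 1) := by omega
        exact smul_mem_pieces hF (hw d' hd')
    · rw [List.length_cons, add_mul, one_mul] at hd
      obtain rfl : d = g + l.length * (e + 1) + e := by omega
      exact brRaise_mem_pieces (hu i) i hPp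
    · rw [map_add, map_smul, hwz, brLower_brRaise φ (h i), hP0, map_zero, sub_zero, smul_sub,
        sub_add_sub_cancel, List.length_cons, pow_succ', mul_smul]
      congr 1
      funext a
      simp only [hP, brRetract, LinearMap.coe_mk, AddHom.coe_mk, List.forall_mem_cons]
      by_cases h1 : a i = 0
      · by_cases h2 : ∀ j ∈ l, a j = 0
        · rw [if_pos h1, if_pos h2, if_pos ⟨h1, h2⟩, retractList_cons]
        · rw [if_pos h1, if_neg h2, if_neg fun h => h2 h.2, map_zero, map_zero]
      · rw [if_neg h1, if_neg fun h => h1 h.1]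

/-- Wedging the cycle with the vectors `u i` inverts the iterated contraction up to a power of F.
The induction needs that the rows not yet used still annihilate the result. -/
lemma exists_contractionList_eq (hu : ∀ i k, (u i k).IsHomogeneous e)
    (h : ∀ i j, ∑ k, u i k * φ j k = if j = i then F else 0) {s g : ℕ}
    {z : Finset ι → MvPolynomial τ K} (hz : z ∈ forms ι τ K s g)
    (hz0 : ∀ i, contraction (φ i) z = 0) {l : List (Fin t)} (hl : l.Nodup) :
    ∃ w ∈ forms ι τ K (s + l.length) (g + l.length * e), contractionList φ l w = F ^ l.length • z ∧
      ∀ j ∉ l, contraction (φ j) w = 0 := by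
  induction l with
  | nil => exact ⟨z, by simpa using hz, by simp [contractionList], fun j _ => hz0 j⟩
  | cons i l ih =>
    rw [List.nodup_cons] at hl
    obtain ⟨w, hw, hwz, hw0⟩ := ih hl.2
    -- The sign compensates for moving the contraction with row i past the `l.length` contractions
    -- already present.
    refine ⟨(-1 : K) ^ l.length • wedge (u i) w, Submodule.smul_mem _ _ ?_, ?_, fun j hj => ?_⟩
    · convert wedge_mem_forms (hu i) hw using 1
      rw [List.length_cons]; congr 1; ring
    · have e1 : ((-1 : K) ^ l.length • wedge (u i) w : Finset ι → MvPolynomial τ K) =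
          (-1 : MvPolynomial τ K) ^ l.length • wedge (u i) w := by
        rcases neg_one_pow_eq_or K l.length with h1 | h1 <;>
        rcases Nat.even_or_odd l.length with h2 | h2 <;> simp [h2.neg_one_pow]
      rw [e1, contractionList_cons, contraction_contractionList, map_smul, map_smul, smul_smul,
        ← mul_pow, neg_one_mul, neg_neg, one_pow, one_smul, contraction_wedge, h, if_pos rfl,
        hw0 i hl.1, map_zero, sub_zero, map_smul, hwz, smul_smul, List.length_cons, pow_succ']
    · rw [List.mem_cons, not_or] at hj
      have e2 : contraction (φ j) (wedge (u i) w) = 0 := by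
        rw [contraction_wedge, h, if_neg hj.1, hw0 j hj.2, map_zero, zero_smul, sub_zero]
      rw [LinearMap.map_smul_of_tower, e2, smul_zero]

/-- The degree of the divided power factor of the terms of the Buchsbaum-Rim complex. -/
def brExp : ℕ → ℕ
  | 0 => 1
  | 1 => 0
  | k + 2 => k

/-- The exterior degree of the terms of the Buchsbaum-Rim complex; also the degree of the
generators of these terms. -/
def brWt (t : ℕ) : ℕ → ℕ
  | 0 => 0
  | 1 => 1
  | k + 2 => t + 1 + k

variable (ι τ K t) in
/-- The component of internal degree `d` of the `q`-th term of the Buchsbaum-Rim complex. -/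
def brPieces (q d : ℕ) : Submodule K (BRModule ι (MvPolynomial τ K) t) :=
  pieces ι τ K t (brExp q) (brWt t q) (d - brWt t q)

/-- This is the origin of the bound q + t: from that internal degree on, the generators of the next
term have appeared and no subtraction of weights is truncated. -/
lemma brWt_le (ht : 1 ≤ t) (q : ℕ) : brWt t (q + 1) ≤ q + t := by
  rcases q with _ | q <;> simp only [brWt] <;> omega

lemma brD_mem_brPieces (hφ : ∀ i k, (φ i k).IsHomogeneous 1) (ht : 1 ≤ t) {q d : ℕ}
    (hd : q + t ≤ d) {c : BRModule ι (MvPolynomial τ K) t} (hc : c ∈ brPieces ι τ K t (q + 1) d) :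
    brD φ (q + 1) c ∈ brPieces ι τ K t q d := by
  unfold brPieces at *
  match q with
  | 0 =>
    intro a
    change brAugment φ c a ∈ _ ∧ (brAugment φ c a ≠ 0 → _)
    by_cases ha : ∃ i, a = Pi.single i 1
    · obtain ⟨i, rfl⟩ := ha
      rw [brAugment_single]
      refine ⟨?_, fun _ => by simp [brExp]⟩
      have := contraction_mem_forms (hφ i) (hc 0).1
      simp only [brWt] at this ⊢
      rwa [Nat.sub_add_cancel (by omega)] at this
    · rw [brAugment_of_ne φ c (not_exists.mp ha)]
      exact ⟨zero_mem _, fun h => absurd rfl h⟩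
  | 1 =>
    intro a
    change brSplice φ c a ∈ _ ∧ (brSplice φ c a ≠ 0 → _)
    rw [brSplice_apply]
    split_ifs with ha
    · refine ⟨?_, fun _ => by simp [brExp, ha]⟩
      have hc0 := (hc 0).1
      have := contractionList_mem_forms (s := 1) (g := d - (t + 1)) hφ (List.finRange t)
        (c := c 0) (by simpa [brWt, add_comm] using hc0)
      rw [List.length_finRange] at this
      convert this using 1
      simp only [brWt]; congr 1; omega
    · exact ⟨zero_mem _, fun h => absurd rfl h⟩
  | q + 2 =>
    have := brLower_mem_pieces hφ (α := q) (s := t + 1 + q) (g := d - (t + 1 + (q + 1))) hc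
    change brLower φ c ∈ _
    convert this using 1
    simp only [brWt]; congr 1; omega

/-- If `F` annihilates the cokernel of `φ`, then `F ^ t` annihilates the homology of the
Buchsbaum-Rim complex of `φ`. -/
lemma exists_brD_eq_pow_smul (hφ : ∀ i k, (φ i k).IsHomogeneous 1)
    (hu : ∀ i k, (u i k).IsHomogeneous e) (hF : F.IsHomogeneous (e + 1))
    (h : ∀ i j, ∑ k, u i k * φ j k = if j = i then F else 0) (ht : 1 ≤ t) {q d : ℕ}
    (hd : q + t ≤ d)
    {z : BRModule ι (MvPolynomial τ K) t} (hz : z ∈ brPieces ι τ K t q d) (hz0 : brD φ q z = 0) :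
    ∃ w ∈ brPieces ι τ K t (q + 1) (d + t * (e + 1)), brD φ (q + 1) w = F ^ t • z := by
  unfold brPieces at *
  match q with
  | 0 =>
    -- In homological degree 0 a single factor F suffices; the factor `F ^ (t - 1)` only makes the
    -- exponent uniform in q.
    refine ⟨F ^ (t - 1) • fun a => if a = 0 then ∑ i, wedge (u i) (z (Pi.single i 1)) else 0, ?_, ?_⟩
    · have : (fun a => if a = 0 then ∑ i, wedge (u i) (z (Pi.single i 1)) else 0) ∈
          pieces ι τ K t 0 1 (d + e) := fun a => by
        simp only
        split_ifs with ha
        · exact ⟨sum_mem fun i _ => wedge_mem_forms (hu i) (hz _).1, fun _ => by simp [ha]⟩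
        · exact ⟨zero_mem _, fun h => absurd rfl h⟩
      convert smul_mem_pieces (hF.pow (t - 1)) this using 1
      obtain ⟨t, rfl⟩ := Nat.exists_eq_add_of_le' ht
      simp only [brWt, Nat.add_sub_cancel]
      have : (t + 1) * (e + 1) = (e + 1) * t + e + 1 := by ring
      congr 1; omega
    · have e1 : F ^ t = F ^ (t - 1) * F := by rw [← pow_succ, Nat.sub_add_cancel ht]
      rw [map_smul, e1, mul_smul]
      congr 1
      funext a
      change brAugment φ _ a = F • z a
      by_cases ha : ∃ i, a = Pi.single i 1
      · obtain ⟨i, rfl⟩ := ha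
        rw [brAugment_single, if_pos rfl, map_sum, Finset.sum_eq_single i]
        · rw [contraction_wedge, h, if_pos rfl,
            contraction_eq_zero_of_mem_forms _ (hz _).1, map_zero, sub_zero]
        · intro j _ hj
          rw [contraction_wedge, h, if_neg hj.symm,
            contraction_eq_zero_of_mem_forms _ (hz _).1, map_zero, sub_zero, zero_smul]
        · simp
      · rw [brAugment_of_ne φ _ (not_exists.mp ha)]
        by_contra hne
        have h1 : ∑ i, a i = 1 := (hz a).2 fun h' => hne (by simp [h'])
        apply ha
        obtain ⟨i, -, hi⟩ := Finset.exists_ne_zero_of_sum_ne_zero (h1 ▸ one_ne_zero)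
        have h2 := Finset.add_sum_erase Finset.univ a (Finset.mem_univ i)
        have h3 : ∑ j ∈ Finset.univ.erase i, a j = 0 := by omega
        refine ⟨i, funext fun j => ?_⟩
        rcases eq_or_ne j i with rfl | hj
        · simp; omega
        · simpa [hj] using Finset.sum_eq_zero_iff.mp h3 j (by simp [hj])
  | 1 =>
    have hz1 : ∀ i, contraction (φ i) (z 0) = 0 := fun i => by
      rw [← brAugment_single]; exact congrFun hz0 _
    obtain ⟨w, hw, hwz, -⟩ := exists_contractionList_eq hu h (hz 0).1 hz1 (List.nodup_finRange t)
    rw [List.length_finRange] at hw hwz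
    refine ⟨fun a => if a = 0 then w else 0, fun a => ?_, ?_⟩
    · simp only
      split_ifs with ha
      · refine ⟨?_, fun _ => by simp [ha, brExp]⟩
        have e1 : t * (e + 1) = t * e + t := by ring
        convert hw using 1
        simp only [brWt]
        congr 1 <;> omega
      · exact ⟨zero_mem _, fun h => absurd rfl h⟩
    · funext a
      change brSplice φ _ a = F ^ t • z a
      rw [brSplice_apply, if_pos rfl]
      by_cases ha : a = 0
      · rw [if_pos ha, hwz, ha]
      · rw [if_neg ha]
        by_contra hne
        have h1 : ∑ i, a i = 0 := (hz a).2 fun h' => hne (by simp [h'])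
        exact ha (funext fun i => by simpa using Finset.sum_eq_zero_iff.mp h1 i (Finset.mem_univ i))
  | k + 2 =>
    -- At the splice (k = 0) this holds because there is no divided power to lower; the actual cycle
    -- condition there is used below to kill the remainder.
    have hlow : brLower φ z = 0 := by
      cases k with
      | zero => exact brLower_eq_zero_of_mem_pieces φ hz
      | succ k => exact hz0
    obtain ⟨w, hw, -, hwz⟩ := exists_brLower_eq_sub_retractList hφ hu hF h hz hlow (List.finRange t)
    rw [List.length_finRange] at hw hwz
    have hpos : 1 ≤ t * (e + 1) := Nat.mul_pos ht (Nat.succ_pos e)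
    refine ⟨w, hw _ ?_, ?_⟩
    · simp only [brWt]; omega
    · change brLower φ w = _
      rw [hwz, sub_eq_self]
      funext a
      simp only [List.mem_finRange, true_imp_iff, Pi.zero_apply, ite_eq_right_iff]
      intro ha
      obtain rfl : a = 0 := funext ha
      -- The remainder survives only at exponent 0. For k = 0 it dies by the splice condition, for k
      -- > 0 because z has no component of exponent 0.
      cases k with
      | zero =>
        refine retractList_eq_zero h (List.nodup_finRange t) _ ?_
        have := congrFun hz0 0
        change brSplice φ z 0 = 0 at this
        rwa [brSplice_apply, if_pos rfl] at this
      | succ k =>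
        have : z 0 = 0 := by
          by_contra hne
          have := (hz 0).2 hne
          simp [brExp] at this
        rw [this, map_zero]

end Torsion

end ProjVar

namespace ProjVar

open MvPolynomial

set_option linter.unusedSectionVars false

/-! ### Elimination of one variable by a linear form -/

section Specialization

variable {K : Type*} [CommRing K] {n : ℕ}

/-- The substitution `X₀ ↦ lam`, `X_{i+1} ↦ X_i`. -/
noncomputable def elimVar (lam : MvPolynomial (Fin n) K) :
    MvPolynomial (Fin (n + 1)) K →ₐ[K] MvPolynomial (Fin n) K :=
  aeval (Fin.cons lam X : Fin (n + 1) → MvPolynomial (Fin n) K)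

/-- The generator of the kernel of `elimVar lam`. -/
noncomputable def elimForm (lam : MvPolynomial (Fin n) K) : MvPolynomial (Fin (n + 1)) K :=
  X 0 - rename Fin.succ lam

lemma elimVar_rename (lam f : MvPolynomial (Fin n) K) :
    elimVar lam (rename Fin.succ f) = f := by
  rw [elimVar, aeval_rename]
  have : (Fin.cons lam X : Fin (n + 1) → MvPolynomial (Fin n) K) ∘ Fin.succ = X := by
    funext i; simp
  rw [this, aeval_X_left_apply]

lemma elimVar_elimForm (lam : MvPolynomial (Fin n) K) : elimVar lam (elimForm lam) = 0 := by
  rw [elimForm, map_sub, elimVar_rename]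
  simp [elimVar]

lemma elimForm_isHomogeneous {lam : MvPolynomial (Fin n) K} (hlam : lam.IsHomogeneous 1) :
    (elimForm lam).IsHomogeneous 1 :=
  (isHomogeneous_X _ _).sub hlam.rename_isHomogeneous

lemma elimVar_isHomogeneous {lam : MvPolynomial (Fin n) K} (hlam : lam.IsHomogeneous 1) {d : ℕ}
    {f : MvPolynomial (Fin (n + 1)) K} (hf : f.IsHomogeneous d) :
    (elimVar lam f).IsHomogeneous d := by
  rw [← one_mul d]
  refine hf.aeval _ fun i => ?_
  refine Fin.cases ?_ (fun j => ?_) i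
  · simpa using hlam
  · simpa using isHomogeneous_X K j

lemma elimForm_dvd_sub (lam : MvPolynomial (Fin n) K) (f : MvPolynomial (Fin (n + 1)) K) :
    elimForm lam ∣ f - rename Fin.succ (elimVar lam f) := by
  induction f using MvPolynomial.induction_on with
  | C a => simp
  | add f g hf hg =>
    rw [map_add, map_add, add_sub_add_comm]
    exact dvd_add hf hg
  | mul_X f i hf =>
    have hX : elimForm lam ∣ X i - rename Fin.succ (elimVar lam (X i)) := by
      refine Fin.cases ?_ (fun j => ?_) i
      · simp [elimVar, elimForm]
      · simp [elimVar]
    rw [map_mul, map_mul]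
    have e : f * X i - rename Fin.succ (elimVar lam f) * rename Fin.succ (elimVar lam (X i)) =
      (f - rename Fin.succ (elimVar lam f)) * X i +
        rename Fin.succ (elimVar lam f) * (X i - rename Fin.succ (elimVar lam (X i))) := by ring
    rw [e]
    exact dvd_add (hf.mul_right _) (hX.mul_left _)

/-- The last clause lets the quotient be chosen coefficientwise without enlarging the support of a
chain. -/
lemma exists_elimForm_mul_eq {lam : MvPolynomial (Fin n) K} (hlam : lam.IsHomogeneous 1) {g : ℕ}
    {f : MvPolynomial (Fin (n + 1)) K} (hf : f.IsHomogeneous (g + 1)) (h0 : elimVar lam f = 0) :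
    ∃ h : MvPolynomial (Fin (n + 1)) K, h.IsHomogeneous g ∧ f = elimForm lam * h ∧
      (f = 0 → h = 0) := by
  by_cases hf0 : f = 0
  · exact ⟨0, isHomogeneous_zero _ _ _, by simp [hf0], fun _ => rfl⟩
  obtain ⟨h, hh⟩ := elimForm_dvd_sub lam f
  rw [h0, map_zero, sub_zero] at hh
  refine ⟨homogeneousComponent g h, homogeneousComponent_isHomogeneous g h, ?_,
    fun h => absurd h hf0⟩
  rw [← homogeneousComponent_mul_of_isHomogeneous (elimForm_isHomogeneous hlam), ← hh,
    add_comm 1 g, homogeneousComponent_eq_self hf]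

lemma elimForm_ne_zero [Nontrivial K] (lam : MvPolynomial (Fin n) K) : elimForm lam ≠ 0 := by
  intro h
  have h1 := congrArg (aeval (Fin.cons 1 (fun _ => 0) : Fin (n + 1) → K)) h
  have h2 := congrArg (aeval (Fin.cons 0 (fun _ => 0) : Fin (n + 1) → K)) h
  rw [elimForm, map_sub, aeval_rename, map_zero, sub_eq_zero, aeval_X] at h1 h2
  have e : ∀ a : K, (Fin.cons a (fun _ => 0) : Fin (n + 1) → K) ∘ Fin.succ = fun _ => 0 := by
    intro a; funext i; simp
  rw [e, ← (e 0), ← h2] at h1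
  simp at h1

end Specialization

/-! ### Base change of the Buchsbaum-Rim complex -/

section Functoriality

variable {ι : Type*} [LinearOrder ι] [Fintype ι] {t : ℕ}

lemma map_contractionList {A B : Type*} [CommRing A] [CommRing B] (f : A →+* B)
    (φ : Fin t → ι → A) (l : List (Fin t)) (c : Finset ι → A) (σ : Finset ι) :
    f (contractionList φ l c σ) =
      contractionList (fun i k => f (φ i k)) l (fun σ => f (c σ)) σ := by
  induction l generalizing σ with
  | nil => rfl
  | cons i l ih =>
    rw [contractionList_cons, contractionList_cons, map_contraction]
    exact congrFun (congrArg _ (_root_.funext ih)) σ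

lemma map_brD {A B : Type*} [CommRing A] [CommRing B] (f : A →+* B)
    (φ : Fin t → ι → A) (q : ℕ) (c : BRModule ι A t) (a : Fin t → ℕ) (σ : Finset ι) :
    f (brD φ q c a σ) = brD (fun i k => f (φ i k)) q (fun a σ => f (c a σ)) a σ := by
  match q with
  | 0 => exact map_zero f
  | 1 =>
    change f (brAugment φ c a σ) = brAugment _ _ a σ
    rw [brAugment_apply, brAugment_apply, Finset.sum_apply, Finset.sum_apply, map_sum]
    refine Finset.sum_congr rfl fun i _ => ?_
    split_ifs
    · rw [map_contraction]
    · exact map_zero f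
  | 2 =>
    change f (brSplice φ c a σ) = brSplice _ _ a σ
    rw [brSplice_apply, brSplice_apply]
    split_ifs
    · rw [map_contractionList]
    · exact map_zero f
  | q + 3 =>
    change f (brLower φ c a σ) = brLower _ _ a σ
    rw [brLower_apply, brLower_apply, Finset.sum_apply, Finset.sum_apply, map_sum]
    exact Finset.sum_congr rfl fun i _ => by rw [map_contraction]

lemma map_mem_brPieces {σ τ K : Type*} [CommRing K]
    (f : MvPolynomial σ K →ₐ[K] MvPolynomial τ K)
    (hf : ∀ g p, p.IsHomogeneous g → (f p).IsHomogeneous g) {q d : ℕ}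
    {c : BRModule ι (MvPolynomial σ K) t} (hc : c ∈ brPieces ι σ K t q d) :
    (fun a s => f (c a s)) ∈ brPieces ι τ K t q d := fun a => by
  refine ⟨fun s => ⟨hf _ _ ((hc a).1 s).1, fun h => ((hc a).1 s).2 fun h' => h (by simp [h'])⟩,
    fun h => (hc a).2 fun h' => h ?_⟩
  funext s
  simp [h']

end Functoriality

/-! ### Exactness in high degrees and its consequences for the cokernel -/

section Step

variable {ι : Type*} [LinearOrder ι] [Fintype ι] {t n : ℕ} {K : Type*} [Field K]

/-- The Buchsbaum-Rim complex of `φ` is exact at the `q`-th term in internal degree `d`. -/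
def BRExact {τ : Type*} (φ : Fin t → ι → MvPolynomial τ K) (q d : ℕ) : Prop :=
  ∀ z ∈ brPieces ι τ K t q d, brD φ q z = 0 → ∃ w ∈ brPieces ι τ K t (q + 1) d, brD φ (q + 1) w = z

lemma exists_elimForm_smul_eq {lam : MvPolynomial (Fin n) K} (hlam : lam.IsHomogeneous 1)
    {q d : ℕ} (hd : brWt t q ≤ d) {c : BRModule ι (MvPolynomial (Fin (n + 1)) K) t}
    (hc : c ∈ brPieces ι (Fin (n + 1)) K t q (d + 1))
    (h0 : (fun a σ => elimVar lam (c a σ)) = 0) :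
    ∃ y ∈ brPieces ι (Fin (n + 1)) K t q d, c = elimForm lam • y := by
  unfold brPieces at *
  rw [Nat.sub_add_comm hd] at hc
  choose y hy hcy hy0 using fun a σ =>
    exists_elimForm_mul_eq hlam ((hc a).1 σ).1 (congrFun (congrFun h0 a) σ)
  refine ⟨y, fun a => ⟨fun σ => ⟨hy a σ, fun h => ((hc a).1 σ).2 fun h' => h (hy0 a σ h')⟩,
    fun h => (hc a).2 fun h' => h ?_⟩, ?_⟩
  · funext σ
    exact hy0 a σ (congrFun h' σ)
  · funext a σ
    exact hcy a σ

lemma brWt_lt (ht : 1 ≤ t) (q : ℕ) : brWt t q < q + t := by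
  cases q with
  | zero => rw [brWt]; omega
  | succ q => have := brWt_le ht q; omega

variable {φ : Fin t → ι → MvPolynomial (Fin (n + 1)) K} {lam : MvPolynomial (Fin n) K}

lemma elimVar_brD (lam : MvPolynomial (Fin n) K) (φ : Fin t → ι → MvPolynomial (Fin (n + 1)) K)
    (q : ℕ) (c : BRModule ι (MvPolynomial (Fin (n + 1)) K) t) (a : Fin t → ℕ) (σ : Finset ι) :
    elimVar lam (brD φ q c a σ) =
      brD (fun i k => elimVar lam (φ i k)) q (fun a σ => elimVar lam (c a σ)) a σ :=
  map_brD (elimVar lam).toRingHom φ q c a σ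

lemma exists_lift_of_brExact (hlam : lam.IsHomogeneous 1)
    {q d : ℕ} (hex : BRExact (fun i k => elimVar lam (φ i k)) q d)
    {z : BRModule ι (MvPolynomial (Fin (n + 1)) K) t} (hz : z ∈ brPieces ι (Fin (n + 1)) K t q d)
    (hz0 : (fun a σ => elimVar lam (brD φ q z a σ)) = 0) :
    ∃ w ∈ brPieces ι (Fin (n + 1)) K t (q + 1) d,
      (fun a σ => elimVar lam ((z - brD φ (q + 1) w) a σ)) = 0 := by
  obtain ⟨w, hw, hwz⟩ := hex _ (map_mem_brPieces (elimVar lam)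
    (fun g p => elimVar_isHomogeneous hlam) hz) (by
      rw [← hz0]; funext a σ; exact (elimVar_brD lam φ q z a σ).symm)
  refine ⟨fun a σ => rename Fin.succ (w a σ), map_mem_brPieces (rename Fin.succ)
    (fun g p hp => hp.rename_isHomogeneous) hw, ?_⟩
  funext a σ
  have h1 := elimVar_brD lam φ (q + 1) (fun a σ => rename Fin.succ (w a σ)) a σ
  simp only [elimVar_rename, hwz] at h1
  simp only [Pi.sub_apply, map_sub, h1, sub_self, Pi.zero_apply]

/-- Exactness modulo a linear form ℓ makes ℓ surjective on homology: modulo ℓ the cycle bounds, and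
lifting the bounding chain leaves a multiple of ℓ, whose quotient is a cycle because ℓ is a
nonzerodivisor. -/
lemma exists_eq_elimForm_smul_add (hφ : ∀ i k, (φ i k).IsHomogeneous 1)
    (ht : 1 ≤ t) (hlam : lam.IsHomogeneous 1)
    (hex : ∀ q d, q + t ≤ d → BRExact (fun i k => elimVar lam (φ i k)) q d) {q d : ℕ}
    (hd : q + t ≤ d + 1) {z : BRModule ι (MvPolynomial (Fin (n + 1)) K) t}
    (hz : z ∈ brPieces ι (Fin (n + 1)) K t q (d + 1)) (hz0 : brD φ q z = 0) :
    ∃ y ∈ brPieces ι (Fin (n + 1)) K t q d, ∃ w ∈ brPieces ι (Fin (n + 1)) K t (q + 1) (d + 1),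
      brD φ q y = 0 ∧ z = elimForm lam • y + brD φ (q + 1) w := by
  obtain ⟨w, hw, hzw⟩ := exists_lift_of_brExact hlam (hex q (d + 1) hd) hz
    (by rw [hz0]; funext a σ; exact map_zero _)
  obtain ⟨y, hy, hyz⟩ := exists_elimForm_smul_eq hlam (by have := brWt_lt ht q; omega)
    (sub_mem hz (brD_mem_brPieces hφ ht hd hw)) hzw
  refine ⟨y, hy, w, hw, ?_, by rw [← hyz]; abel⟩
  have h1 := congrArg (brD φ q) hyz
  rw [map_sub, hz0, brD_comp, sub_zero, map_smul] at h1
  exact (smul_eq_zero.mp h1.symm).resolve_left (elimForm_ne_zero lam)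

/-- Exactness modulo ℓ, one term further up, makes ℓ injective on homology: if ℓz = ∂w, then w is a
cycle modulo ℓ, so w = ℓu + ∂v and ∂u = z. The homological and the internal degree both rise by one,
so the bound q + t ≤ d is preserved. -/
lemma exists_brD_eq_of_elimForm_smul (hφ : ∀ i k, (φ i k).IsHomogeneous 1)
    (ht : 1 ≤ t) (hlam : lam.IsHomogeneous 1)
    (hex : ∀ q d, q + t ≤ d → BRExact (fun i k => elimVar lam (φ i k)) q d) {q d : ℕ}
    (hd : q + t ≤ d) {z w : BRModule ι (MvPolynomial (Fin (n + 1)) K) t}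
    (hw : w ∈ brPieces ι (Fin (n + 1)) K t (q + 1) (d + 1))
    (hwz : brD φ (q + 1) w = elimForm lam • z) :
    ∃ u ∈ brPieces ι (Fin (n + 1)) K t (q + 1) d, brD φ (q + 1) u = z := by
  obtain ⟨v, hv, hwv⟩ := exists_lift_of_brExact hlam (hex (q + 1) (d + 1) (by omega)) hw
    (by rw [hwz]; funext a σ; simp [elimVar_elimForm])
  obtain ⟨u, hu, huw⟩ := exists_elimForm_smul_eq hlam (by have := brWt_lt ht (q + 1); omega)
    (sub_mem hw (brD_mem_brPieces hφ ht (by omega) hv)) hwv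
  refine ⟨u, hu, ?_⟩
  have h1 := congrArg (brD φ (q + 1)) huw
  rw [map_sub, brD_comp, sub_zero, map_smul, hwz] at h1
  exact (smul_right_injective _ (elimForm_ne_zero lam) h1).symm

/-- The polynomial `F` annihilates the cokernel of the matrix `φ`. -/
def AnnihilatesCoker {A : Type*} [CommRing A] (φ : Fin t → ι → A) (F : A) : Prop :=
  ∀ i, ∃ u : ι → A, ∀ j, ∑ k, u k * φ j k = if j = i then F else 0

lemma AnnihilatesCoker.map {A B : Type*} [CommRing A] [CommRing B] {φ : Fin t → ι → A} {F : A}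
    (h : AnnihilatesCoker φ F) (f : A →+* B) : AnnihilatesCoker (fun i k => f (φ i k)) (f F) := by
  intro i
  obtain ⟨u, hu⟩ := h i
  refine ⟨fun k => f (u k), fun j => ?_⟩
  simp only [← map_mul, ← map_sum, hu]
  split_ifs <;> simp

lemma AnnihilatesCoker.mul_left {A : Type*} [CommRing A] {φ : Fin t → ι → A} {F : A}
    (h : AnnihilatesCoker φ F) (G : A) : AnnihilatesCoker φ (G * F) := by
  intro i
  obtain ⟨u, hu⟩ := h i
  refine ⟨fun k => G * u k, fun j => ?_⟩
  simp only [mul_assoc, ← Finset.mul_sum, hu]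
  split_ifs <;> simp

lemma AnnihilatesCoker.add {A : Type*} [CommRing A] {φ : Fin t → ι → A} {F G : A}
    (hF : AnnihilatesCoker φ F) (hG : AnnihilatesCoker φ G) : AnnihilatesCoker φ (F + G) := by
  intro i
  obtain ⟨u, hu⟩ := hF i
  obtain ⟨v, hv⟩ := hG i
  refine ⟨fun k => u k + v k, fun j => ?_⟩
  simp only [add_mul, Finset.sum_add_distrib, hu, hv]
  split_ifs <;> simp

lemma AnnihilatesCoker.exists_isHomogeneous {τ : Type*} {φ : Fin t → ι → MvPolynomial τ K}
    (hφ : ∀ i k, (φ i k).IsHomogeneous 1) {F : MvPolynomial τ K} {e : ℕ}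
    (hF : F.IsHomogeneous (e + 1)) (h : AnnihilatesCoker φ F) :
    ∃ u : Fin t → ι → MvPolynomial τ K, (∀ i k, (u i k).IsHomogeneous e) ∧
      ∀ i j, ∑ k, u i k * φ j k = if j = i then F else 0 := by
  choose u hu using h
  refine ⟨fun i k => homogeneousComponent e (u i k),
    fun i k => homogeneousComponent_isHomogeneous _ _, fun i j => ?_⟩
  have h1 := congrArg (homogeneousComponent (1 + e)) (hu i j)
  rw [map_sum] at h1
  simp only [mul_comm (u _ _), homogeneousComponent_mul_of_isHomogeneous (hφ _ _)] at h1
  simp only [mul_comm _ (φ _ _), h1]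
  split_ifs
  · rw [add_comm, homogeneousComponent_eq_self hF]
  · exact map_zero _

/-- If every variable is nilpotent on the cokernel of the matrix `φ` of linear forms, then the
Buchsbaum-Rim complex of `φ` is exact in high degrees. -/
theorem brExact_of_finite_length {n : ℕ} (φ : Fin t → ι → MvPolynomial (Fin n) K)
    (hφ : ∀ i k, (φ i k).IsHomogeneous 1) (ht : 1 ≤ t)
    (hnil : ∀ i : Fin n, ∃ e : ℕ, AnnihilatesCoker φ (X i ^ (e + 1))) (q d : ℕ) (hd : q + t ≤ d) :
    BRExact φ q d := by
  induction n generalizing q d with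
  | zero =>
    intro z hz _
    refine ⟨0, zero_mem _, ?_⟩
    rw [map_zero, eq_comm]
    funext a σ
    by_contra hne
    -- Without variables only degree 0 is nonzero, while by `brWt_lt` the coefficients here have
    -- positive degree.
    have h1 := IsHomogeneous.inj_right ((hz a).1 σ).1 (isHomogeneous_of_isEmpty _ _ _) hne
    have := brWt_lt ht q
    omega
  | succ n ih =>
    have hlam : (0 : MvPolynomial (Fin n) K).IsHomogeneous 1 := isHomogeneous_zero _ _ _
    have hex := ih (fun i k => elimVar 0 (φ i k)) (fun i k => elimVar_isHomogeneous hlam (hφ i k))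
      (fun i => by
        obtain ⟨e, he⟩ := hnil i.succ
        refine ⟨e, ?_⟩
        have := he.map (elimVar (0 : MvPolynomial (Fin n) K)).toRingHom
        simpa [elimVar] using this)
    intro z hz hz0
    obtain ⟨e, he⟩ := hnil 0
    have hF : (X 0 ^ (e + 1) : MvPolynomial (Fin (n + 1)) K).IsHomogeneous (e + 1) :=
      isHomogeneous_X_pow _ _
    obtain ⟨u, hu, huF⟩ := he.exists_isHomogeneous hφ hF
    obtain ⟨w, hw, hwz⟩ := exists_brD_eq_pow_smul hφ hu hF huF ht hd hz hz0
    have hx : elimForm (0 : MvPolynomial (Fin n) K) = X 0 := by simp [elimForm]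
    -- A power of X₀ times the cycle bounds; by injectivity of X₀ on homology the factors are
    -- removed one at a time.
    have key : ∀ m : ℕ, ∀ w ∈ brPieces ι (Fin (n + 1)) K t (q + 1) (d + m),
        brD φ (q + 1) w = (X 0 : MvPolynomial (Fin (n + 1)) K) ^ m • z →
        ∃ w ∈ brPieces ι (Fin (n + 1)) K t (q + 1) d, brD φ (q + 1) w = z := by
      intro m
      induction m with
      | zero => exact fun w hw h => ⟨w, hw, by simpa using h⟩
      | succ m ihm =>
        intro w hw h
        obtain ⟨u, hu, huz⟩ := exists_brD_eq_of_elimForm_smul hφ ht hlam hex (d := d + m)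
          (by omega) hw (z := (X 0 : MvPolynomial (Fin (n + 1)) K) ^ m • z)
          (by rw [h, hx, smul_smul, pow_succ'])
        exact ihm u hu huz
    refine key (t * (e + 1)) w hw ?_
    rw [hwz, ← pow_mul, mul_comm]

variable (ι) in
/-- A vector of polynomials as an element of the term of homological degree `0`. -/
def brOfVector {A : Type*} [CommRing A] (f : Fin t → A) : BRModule ι A t :=
  fun a σ => ∑ i, if a = Pi.single i 1 ∧ σ = ∅ then f i else 0

lemma brOfVector_single {A : Type*} [CommRing A] (f : Fin t → A) (i : Fin t) :
    brOfVector ι f (Pi.single i 1) ∅ = f i := by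
  rw [brOfVector, Finset.sum_eq_single i]
  · simp
  · intro j _ hj
    rw [if_neg fun h => hj (single_one_injective h.1).symm]
  · simp

lemma brOfVector_eq {A : Type*} [CommRing A] {f : Fin t → A} {c : BRModule ι A t}
    (h1 : ∀ i, c (Pi.single i 1) ∅ = f i) (h2 : ∀ a σ, c a σ ≠ 0 → ∃ i, a = Pi.single i 1 ∧ σ = ∅) :
    brOfVector ι f = c := by
  funext a σ
  by_cases h : ∃ i, a = Pi.single i 1 ∧ σ = ∅
  · obtain ⟨i, rfl, rfl⟩ := h
    rw [h1, brOfVector_single]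
  · rw [brOfVector, Finset.sum_eq_zero fun i _ => if_neg fun h' => h ⟨i, h'⟩]
    by_contra hne
    exact h (h2 a σ (Ne.symm hne))

lemma brOfVector_mem {τ : Type*} {f : Fin t → MvPolynomial τ K} {d : ℕ}
    (hf : ∀ i, (f i).IsHomogeneous d) : brOfVector ι f ∈ brPieces ι τ K t 0 d := fun a => by
  have key : ∀ σ, brOfVector ι f a σ ≠ 0 → ∃ i, a = Pi.single i 1 ∧ σ = ∅ := fun σ h => by
    obtain ⟨i, -, hi⟩ := Finset.exists_ne_zero_of_sum_ne_zero h
    exact ⟨i, by by_contra h'; exact hi (if_neg h')⟩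
  refine ⟨fun σ => ⟨IsHomogeneous.sum _ _ _ fun i _ => ?_, fun h => ?_⟩, fun h => ?_⟩
  · split_ifs
    · exact hf i
    · exact isHomogeneous_zero _ _ _
  · obtain ⟨i, -, rfl⟩ := key σ h
    rfl
  · obtain ⟨σ, hσ⟩ := Function.ne_iff.mp h
    obtain ⟨i, rfl, -⟩ := key σ hσ
    simp [brExp]

lemma exists_single_of_mem_brPieces {τ : Type*} {d : ℕ} {c : BRModule ι (MvPolynomial τ K) t}
    (hc : c ∈ brPieces ι τ K t 0 d) (a : Fin t → ℕ) (σ : Finset ι) (h : c a σ ≠ 0) :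
    ∃ i, a = Pi.single i 1 ∧ σ = ∅ := by
  have h1 : ∑ i, a i = 1 := (hc a).2 fun h' => h (by rw [h']; rfl)
  have h2 : σ.card = 0 := ((hc a).1 σ).2 h
  obtain ⟨i, -, hi⟩ := Finset.exists_ne_zero_of_sum_ne_zero (h1 ▸ one_ne_zero)
  have h2' := Finset.add_sum_erase Finset.univ a (Finset.mem_univ i)
  have h3 : ∑ j ∈ Finset.univ.erase i, a j = 0 := by omega
  refine ⟨i, _root_.funext fun j => ?_, Finset.card_eq_zero.mp h2⟩
  rcases eq_or_ne j i with rfl | hj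
  · simp; omega
  · simpa [hj] using Finset.sum_eq_zero_iff.mp h3 j (by simp [hj])

/-- A vector of polynomials as an element of the term of homological degree `1`. -/
def brOfCovector {A : Type*} [CommRing A] (w : ι → A) : BRModule ι A t :=
  fun a σ => ∑ k, if a = 0 ∧ σ = {k} then w k else 0

lemma brOfCovector_zero {A : Type*} [CommRing A] (w : ι → A) (k : ι) :
    (brOfCovector w : BRModule ι A t) 0 {k} = w k := by
  rw [brOfCovector, Finset.sum_eq_single k]
  · simp
  · intro j _ hj
    rw [if_neg fun h => hj (Finset.singleton_injective h.2).symm]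
  · simp

lemma brOfCovector_mem {τ : Type*} {w : ι → MvPolynomial τ K} {d : ℕ}
    (hw : ∀ k, (w k).IsHomogeneous d) :
    (brOfCovector w : BRModule ι _ t) ∈ brPieces ι τ K t 1 (d + 1) := fun a => by
  have key : ∀ σ, (brOfCovector w : BRModule ι _ t) a σ ≠ 0 → ∃ k, a = 0 ∧ σ = {k} :=
    fun σ h => by
      obtain ⟨i, -, hi⟩ := Finset.exists_ne_zero_of_sum_ne_zero h
      exact ⟨i, by by_contra h'; exact hi (if_neg h')⟩
  refine ⟨fun σ => ⟨IsHomogeneous.sum _ _ _ fun i _ => ?_, fun h => ?_⟩, fun h => ?_⟩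
  · split_ifs
    · exact hw i
    · exact isHomogeneous_zero _ _ _
  · obtain ⟨i, -, rfl⟩ := key σ h
    rfl
  · obtain ⟨σ, hσ⟩ := Function.ne_iff.mp h
    obtain ⟨i, rfl, -⟩ := key σ hσ
    simp [brExp]

lemma brAugment_single_empty {A : Type*} [CommRing A] (φ : Fin t → ι → A) (c : BRModule ι A t)
    (i : Fin t) : brAugment φ c (Pi.single i 1) ∅ = ∑ k, φ i k * c 0 {k} := by
  rw [brAugment_single, contraction_apply, Finset.compl_empty]
  exact Finset.sum_congr rfl fun k _ => by simp [posSign]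

/-- For a matrix `φ` of linear forms whose cokernel has finite length modulo the linear form
`elimForm lam`, multiplication by this form is surjective on the cokernel in degrees `≥ t`. -/
theorem coker_surjective (hφ : ∀ i k, (φ i k).IsHomogeneous 1) (ht : 1 ≤ t)
    (hlam : lam.IsHomogeneous 1)
    (hnil : ∀ i : Fin n, ∃ e : ℕ,
      AnnihilatesCoker (fun i k => elimVar lam (φ i k)) (X i ^ (e + 1))) {d : ℕ} (hd : t ≤ d + 1)
    (f : Fin t → MvPolynomial (Fin (n + 1)) K) (hf : ∀ i, (f i).IsHomogeneous (d + 1)) :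
    ∃ (g : Fin t → MvPolynomial (Fin (n + 1)) K) (w : ι → MvPolynomial (Fin (n + 1)) K),
      (∀ i, (g i).IsHomogeneous d) ∧ (∀ k, (w k).IsHomogeneous d) ∧
      ∀ i, f i = elimForm lam * g i + ∑ k, φ i k * w k := by
  have hex := brExact_of_finite_length _ (fun i k => elimVar_isHomogeneous hlam (hφ i k)) ht hnil
  obtain ⟨y, hy, w, hw, -, hyw⟩ := exists_eq_elimForm_smul_add hφ ht hlam hex (q := 0) (d := d)
    (by omega) (brOfVector_mem (ι := ι) hf) rfl
  refine ⟨fun i => y (Pi.single i 1) ∅, fun k => w 0 {k}, fun i => ((hy _).1 _).1,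
    fun k => ((hw _).1 _).1, fun i => ?_⟩
  have h1 := congrFun (congrFun hyw (Pi.single i 1)) ∅
  rw [brOfVector_single] at h1
  rw [h1, ← brAugment_single_empty]
  rfl

/-- For a matrix `φ` of linear forms whose cokernel has finite length modulo the linear form
`elimForm lam`, multiplication by this form is injective on the cokernel in degrees `≥ t`. -/
theorem coker_injective (hφ : ∀ i k, (φ i k).IsHomogeneous 1) (ht : 1 ≤ t)
    (hlam : lam.IsHomogeneous 1)
    (hnil : ∀ i : Fin n, ∃ e : ℕ,
      AnnihilatesCoker (fun i k => elimVar lam (φ i k)) (X i ^ (e + 1))) {d : ℕ} (hd : t ≤ d + 1)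
    (f : Fin t → MvPolynomial (Fin (n + 1)) K)
    (w : ι → MvPolynomial (Fin (n + 1)) K) (hw : ∀ k, (w k).IsHomogeneous (d + 1))
    (hfw : ∀ i, elimForm lam * f i = ∑ k, φ i k * w k) :
    ∃ u : ι → MvPolynomial (Fin (n + 1)) K, (∀ k, (u k).IsHomogeneous d) ∧
      ∀ i, f i = ∑ k, φ i k * u k := by
  have hex := brExact_of_finite_length _ (fun i k => elimVar_isHomogeneous hlam (hφ i k)) ht hnil
  obtain ⟨u, hu, huf⟩ := exists_brD_eq_of_elimForm_smul hφ ht hlam hex (q := 0) (d := d + 1)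
    (by omega) (z := brOfVector ι f) (brOfCovector_mem hw) (by
      have hm : brAugment φ (brOfCovector w) ∈ brPieces ι (Fin (n + 1)) K t 0 (d + 1 + 1) :=
        brD_mem_brPieces hφ ht (by omega) (brOfCovector_mem hw)
      have h1 : brOfVector ι (fun i => elimForm lam * f i) = brAugment φ (brOfCovector w) :=
        brOfVector_eq (fun i => by simp only [brAugment_single_empty, brOfCovector_zero, hfw])
          (exists_single_of_mem_brPieces hm)
      change brAugment φ (brOfCovector w) = _
      rw [← h1]
      funext a σ
      simp [brOfVector, Finset.mul_sum])
  refine ⟨fun k => u 0 {k}, fun k => ((hu _).1 _).1, fun i => ?_⟩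
  rw [← brAugment_single_empty, ← brOfVector_single (ι := ι) f i, ← huf]
  rfl

end Step

end ProjVar

namespace ProjVar

/-! ### Vanishing of Koszul homology under change of the sequence -/

section KoszulHomology

variable {ι K A : Type*} [Field K] [CommRing A] [Algebra K A]

/-- The Koszul chains of homological degree `i` with coefficients of degree `j` on the basis
vectors with indices in `U`. -/
def kChains (G : ℕ → Submodule K A) (U : Finset ι) (i j : ℕ) : Submodule K (Finset ι → A) where
  carrier := {c | ∀ σ, c σ ∈ G j ∧ (c σ ≠ 0 → σ ⊆ U ∧ σ.card = i)}
  add_mem' {a b} ha hb σ := by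
    refine ⟨add_mem (ha σ).1 (hb σ).1, fun h => ?_⟩
    by_cases h1 : a σ = 0
    · exact (hb σ).2 fun h2 => h (by simp [h1, h2])
    · exact (ha σ).2 h1
  zero_mem' σ := ⟨zero_mem _, fun h => absurd rfl h⟩
  smul_mem' r c hc σ := ⟨(G j).smul_mem r (hc σ).1, fun h =>
    (hc σ).2 fun h' => h (by simp [h'])⟩

lemma mul_mem_kChains {G : ℕ → Submodule K A} {U : Finset ι} {i j m : ℕ} {u : A}
    (hu : ∀ a ∈ G j, u * a ∈ G m) {c : Finset ι → A} (hc : c ∈ kChains G U i j) :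
    u • c ∈ kChains G U i m := fun σ =>
  ⟨hu _ (hc σ).1, fun h => (hc σ).2 fun h' => h (by simp [h'])⟩

lemma kChains_mono {G : ℕ → Submodule K A} {U V : Finset ι} (hUV : U ⊆ V) {i j : ℕ} :
    kChains G U i j ≤ kChains G V i j := fun _ hc σ =>
  ⟨(hc σ).1, fun h => ⟨((hc σ).2 h).1.trans hUV, ((hc σ).2 h).2⟩⟩

variable [LinearOrder ι]

lemma posSign_mul_mem (P : Submodule K A) (σ : Finset ι) (k : ι) {a : A} (ha : a ∈ P) :
    posSign A σ k * a ∈ P := by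
  rcases neg_one_pow_eq_or A (σ.filter (fun l => l < k)).card with h | h <;>
    simp only [posSign, h, one_mul, neg_one_mul, ha, neg_mem]

lemma interior_mem_kChains {G : ℕ → Submodule K A} {U : Finset ι} {y : ι} {i j : ℕ}
    {c : Finset ι → A} (hc : c ∈ kChains G (insert y U) (i + 1) j) :
    interior A y c ∈ kChains G U i j := fun σ => by
  rw [interior_apply]
  split_ifs with hy
  · exact ⟨zero_mem _, fun h => absurd rfl h⟩
  · refine ⟨posSign_mul_mem _ _ _ (hc _).1, fun h => ?_⟩
    obtain ⟨h1, h2⟩ := (hc (insert y σ)).2 fun h' => h (by simp [h'])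
    rw [Finset.card_insert_of_notMem hy] at h2
    exact ⟨(Finset.insert_subset_insert_iff hy).mp h1, by omega⟩

lemma interior_eq_zero_of_mem_kChains {G : ℕ → Submodule K A} {U : Finset ι} (y : ι) {j : ℕ}
    {c : Finset ι → A} (hc : c ∈ kChains G U 0 j) : interior A y c = 0 := by
  funext σ
  rw [interior_apply]
  split_ifs with hy
  · rfl
  · by_contra h
    obtain ⟨-, h2⟩ := (hc (insert y σ)).2 fun h' => h (by simp [h'])
    simp at h2

lemma interior_eq_zero_of_notMem {G : ℕ → Submodule K A} {U : Finset ι} {y : ι} (hy : y ∉ U)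
    {i j : ℕ} {c : Finset ι → A} (hc : c ∈ kChains G U i j) : interior A y c = 0 := by
  funext σ
  rw [interior_apply]
  split_ifs
  · rfl
  · by_contra h
    obtain ⟨h1, -⟩ := (hc (insert y σ)).2 fun h' => h (by simp [h'])
    exact hy (h1 (Finset.mem_insert_self y σ))

lemma exterior_mem_kChains {G : ℕ → Submodule K A} {U : Finset ι} {y : ι} {i j : ℕ}
    {c : Finset ι → A} (hc : c ∈ kChains G U i j) :
    exterior A y c ∈ kChains G (insert y U) (i + 1) j := fun σ => by
  rw [exterior_apply]
  split_ifs with hy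
  · refine ⟨posSign_mul_mem _ _ _ (hc _).1, fun h => ?_⟩
    obtain ⟨h1, h2⟩ := (hc (σ.erase y)).2 fun h' => h (by simp [h'])
    exact ⟨Finset.subset_insert_iff.mpr h1, by rw [← h2, Finset.card_erase_add_one hy]⟩
  · exact ⟨zero_mem _, fun h => absurd rfl h⟩

lemma sub_exterior_interior_mem_kChains {G : ℕ → Submodule K A} {U : Finset ι} {y : ι} {i j : ℕ}
    {c : Finset ι → A} (hc : c ∈ kChains G (insert y U) i j) :
    c - exterior A y (interior A y c) ∈ kChains G U i j := fun σ => by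
  rw [Pi.sub_apply, exterior_interior]
  split_ifs with hy
  · rw [sub_self]; exact ⟨zero_mem _, fun h => absurd rfl h⟩
  · rw [sub_zero]
    refine ⟨(hc σ).1, fun h => ⟨fun k hk => ?_, ((hc σ).2 h).2⟩⟩
    exact (Finset.mem_insert.mp (((hc σ).2 h).1 hk)).resolve_left fun h' => hy (h' ▸ hk)

variable [Fintype ι]

lemma wedge_mem_kChains {G : ℕ → Submodule K A} {U : Finset ι} {i j m : ℕ} {u : ι → A}
    (hu : ∀ k, ∀ a ∈ G j, u k * a ∈ G m) (hU : ∀ k ∉ U, u k = 0)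
    {c : Finset ι → A} (hc : c ∈ kChains G U i j) :
    wedge u c ∈ kChains G U (i + 1) m := fun σ => by
  rw [wedge_apply]
  refine ⟨sum_mem fun k _ => posSign_mul_mem _ _ _ (hu k _ (hc _).1), fun h => ?_⟩
  obtain ⟨k, hk, h⟩ := Finset.exists_ne_zero_of_sum_ne_zero h
  obtain ⟨h1, h2⟩ := (hc (σ.erase k)).2 fun h' => h (by simp [h'])
  refine ⟨?_, by rw [← h2, Finset.card_erase_add_one hk]⟩
  rw [← Finset.insert_erase hk]
  refine Finset.insert_subset ?_ h1
  by_contra hkU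
  exact h (by simp [hU k hkU])

/-- The linear form `v` acts with degree one on the graded module. -/
def ActsInDegreeOne (G : ℕ → Submodule K A) (v : ι → A) : Prop :=
  ∀ k j, ∀ a ∈ G j, v k * a ∈ G (j + 1)

variable {G : ℕ → Submodule K A} {v : ι → A} {U : Finset ι} {i j : ℕ}

lemma contraction_mem_kChains (hv : ActsInDegreeOne G v) {c : Finset ι → A}
    (hc : c ∈ kChains G U (i + 1) j) : contraction v c ∈ kChains G U i (j + 1) := fun σ => by
  rw [contraction_apply]
  refine ⟨sum_mem fun k _ => posSign_mul_mem _ _ _ (hv k j _ (hc _).1), fun h => ?_⟩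
  obtain ⟨k, hk, h⟩ := Finset.exists_ne_zero_of_sum_ne_zero h
  obtain ⟨h1, h2⟩ := (hc (insert k σ)).2 fun h' => h (by simp [h'])
  rw [Finset.card_insert_of_notMem (Finset.mem_compl.mp hk)] at h2
  exact ⟨(Finset.subset_insert k σ).trans h1, by omega⟩

variable (G v) in
/-- The `i`-th Koszul homology with respect to the `v k`, `k ∈ U`, vanishes in degree `i + j + 1`,
i.e. where the coefficients of the cycles have degree `j + 1`. -/
def KoszulVanishing (U : Finset ι) (i j : ℕ) : Prop :=
  ∀ c ∈ kChains G U i (j + 1), contraction v c = 0 → ∃ w ∈ kChains G U (i + 1) j, contraction v w = c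

/-- The complex on `insert y U` is the mapping cone of `v y` on the complex on `U`, so its i-th
homology is squeezed between the i-th and the (i-1)-st homology of the latter. -/
lemma KoszulVanishing.insert (hv : ActsInDegreeOne G v) (y : ι)
    (h : KoszulVanishing G v U i j) (h' : ∀ i', i = i' + 1 → KoszulVanishing G v U i' j) :
    KoszulVanishing G v (insert y U) i j := by
  intro c hc hc0
  have hint : contraction v (interior A y c) = 0 := by
    rw [← neg_eq_zero, ← interior_contraction, hc0, map_zero]
  obtain ⟨w, hw, hwc⟩ : ∃ w ∈ kChains G U i j, contraction v w = interior A y c := by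
    cases i with
    | zero => exact ⟨0, zero_mem _, by rw [interior_eq_zero_of_mem_kChains y hc, map_zero]⟩
    | succ i => exact h' i rfl _ (interior_mem_kChains hc) hint
  obtain ⟨x, hx, hxc⟩ := h (c - exterior A y (interior A y c) + v y • w)
    (add_mem (sub_exterior_interior_mem_kChains hc) (mul_mem_kChains (hv y j) hw)) (by
      rw [map_add, map_sub, hc0, contraction_exterior, hint, map_zero, map_smul, hwc]; abel)
  refine ⟨x - exterior A y w, sub_mem (kChains_mono (Finset.subset_insert y U) hx)
    (exterior_mem_kChains hw), ?_⟩
  rw [map_sub, hxc, contraction_exterior, hwc]; abel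

/-- A redundant element acts as zero on the homology on `U`, which therefore embeds in the homology
on `insert y U`. Concretely, the basis vector of y in a bounding chain is replaced by the
combination of the others with coefficients `a`. -/
lemma KoszulVanishing.of_insert_of_mem_span {y : ι} (hyU : y ∉ U) (a : ι → K)
    (ha : ∀ k ∉ U, a k = 0) (hy : v y = ∑ k, a k • v k)
    (h : KoszulVanishing G v (Insert.insert y U) i j) : KoszulVanishing G v U i j := by
  intro c hc hc0
  obtain ⟨x, hx, hxc⟩ := h c (kChains_mono (Finset.subset_insert y U) hc) hc0
  have hw := interior_mem_kChains hx
  have hw0 : contraction v (interior A y x) = 0 := by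
    rw [← neg_eq_zero, ← interior_contraction, hxc, interior_eq_zero_of_notMem hyU hc]
  refine ⟨x - exterior A y (interior A y x) +
      wedge (fun k => algebraMap K A (a k)) (interior A y x),
    add_mem (sub_exterior_interior_mem_kChains hx) (wedge_mem_kChains (fun k b hb => ?_)
      (fun k hk => by rw [ha k hk, map_zero]) hw), ?_⟩
  · rw [← Algebra.smul_def]; exact (G j).smul_mem _ hb
  · have hy' : ∑ k, algebraMap K A (a k) * v k = v y := by
      rw [hy]; exact Finset.sum_congr rfl fun k _ => (Algebra.smul_def _ _).symm
    rw [map_add, map_sub, hxc, contraction_exterior, contraction_wedge, hw0, map_zero, map_zero, hy']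
    abel

/-- In the mapping cone sequence, vanishing in homological degree i+1 makes `v y` injective on the
i-th homology on `U`; but `v y` is nilpotent there, so that homology is zero. All coefficient
degrees from j on are needed, since powers of `v y` raise the degree. -/
lemma KoszulVanishing.of_insert_of_isNilpotent (hv : ActsInDegreeOne G v) {y : ι} (hyU : y ∉ U)
    {N : ℕ} (u : ι → A) (hu : ∀ k j, ∀ a ∈ G j, u k * a ∈ G (j + N)) (huU : ∀ k ∉ U, u k = 0)
    (hy : v y ^ (N + 1) = ∑ k, u k * v k)
    (h : ∀ j' ≥ j, KoszulVanishing G v (Insert.insert y U) (i + 1) j') :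
    KoszulVanishing G v U i j := by
  intro c hc hc0
  have hpow : ∀ m, v y ^ m • c ∈ kChains G U i (j + m + 1) := fun m => by
    induction m with
    | zero => simpa using hc
    | succ m ih =>
      rw [pow_succ', mul_smul]
      exact mul_mem_kChains (hv y _) ih
  have key : ∀ m, ∀ w ∈ kChains G U (i + 1) (j + m), contraction v w = v y ^ m • c →
      ∃ w ∈ kChains G U (i + 1) j, contraction v w = c := by
    intro m
    induction m with
    | zero => exact fun w hw hwc => ⟨w, hw, by simpa using hwc⟩
    | succ m ih =>
      intro w hw hwc
      -- The cone cycle expressing that `v y` annihilates the class of `v y ^ m • c`; the y-part of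
      -- a chain bounding it shows, up to sign, that this class is already zero.
      obtain ⟨x, hx, hxc⟩ := h (j + m) (by omega) (exterior A y (v y ^ m • c) - w)
        (sub_mem (exterior_mem_kChains (hpow m)) (kChains_mono (Finset.subset_insert y U) hw)) (by
          rw [map_sub, hwc, contraction_exterior, map_smul, hc0, smul_zero, map_zero, sub_zero,
            smul_smul, pow_succ', sub_self])
      refine ih (-interior A y x) (neg_mem (interior_mem_kChains hx)) ?_
      rw [map_neg, ← interior_contraction, hxc, map_sub, interior_eq_zero_of_notMem hyU hw, sub_zero]
      have := LinearMap.congr_fun (interior_mul_exterior_self (A := A) y) (v y ^ m • c)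
      rw [LinearMap.add_apply, Module.End.mul_apply, Module.End.mul_apply,
        interior_eq_zero_of_notMem hyU (hpow m), map_zero, add_zero] at this
      exact this
  refine key (N + 1) (wedge u c) ?_ ?_
  · have := wedge_mem_kChains (fun k a ha => hu k (j + 1) a ha) huU hc
    rwa [add_assoc, add_comm 1 N] at this
  · rw [contraction_wedge, hc0, map_zero, sub_zero, hy]

lemma KoszulVanishing.union (hv : ActsInDegreeOne G v) (V : Finset ι) {p : ℕ}
    (h : ∀ i ≤ p, KoszulVanishing G v U i j) : ∀ i ≤ p, KoszulVanishing G v (V ∪ U) i j := by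
  induction V using Finset.induction_on with
  | empty => simpa using h
  | insert y V _ ih =>
    intro i hi
    rw [Finset.insert_union]
    exact (ih i hi).insert hv y fun i' hi' => ih i' (by omega)

lemma KoszulVanishing.of_union_of_mem_span (V : Finset ι)
    (hV : ∀ y ∈ V, ∃ a : ι → K, (∀ k ∉ U, a k = 0) ∧ v y = ∑ k, a k • v k)
    (h : KoszulVanishing G v (V ∪ U) i j) : KoszulVanishing G v U i j := by
  induction V using Finset.induction_on with
  | empty => simpa using h
  | insert y V _ ih =>
    have hV' := fun z hz => hV z (Finset.mem_insert_of_mem hz)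
    rw [Finset.insert_union] at h
    by_cases hy : y ∈ V ∪ U
    · rw [Finset.insert_eq_of_mem hy] at h
      exact ih hV' h
    · obtain ⟨a, ha, hya⟩ := hV y (Finset.mem_insert_self y V)
      exact ih hV' (h.of_insert_of_mem_span hy a
        (fun k hk => ha k fun h' => hk (Finset.mem_union_right _ h')) hya)

lemma KoszulVanishing.of_union_of_isNilpotent (hv : ActsInDegreeOne G v) (V : Finset ι)
    (hVU : Disjoint V U)
    (hV : ∀ y ∈ V, ∃ (N : ℕ) (u : ι → A), (∀ k j, ∀ a ∈ G j, u k * a ∈ G (j + N)) ∧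
      (∀ k ∉ U, u k = 0) ∧ v y ^ (N + 1) = ∑ k, u k * v k) {p j₀ : ℕ}
    (h : ∀ i ≤ p + V.card, ∀ j ≥ j₀, KoszulVanishing G v (V ∪ U) i j) :
    ∀ i ≤ p, ∀ j ≥ j₀, KoszulVanishing G v U i j := by
  induction V using Finset.induction_on with
  | empty => simpa using h
  | insert y V hyV ih =>
    rw [Finset.disjoint_insert_left] at hVU
    refine ih hVU.2 (fun z hz => hV z (Finset.mem_insert_of_mem hz)) fun i hi j hj => ?_
    obtain ⟨N, u, hu, huU, hy⟩ := hV y (Finset.mem_insert_self y V)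
    rw [Finset.card_insert_of_notMem hyV] at h
    refine KoszulVanishing.of_insert_of_isNilpotent hv (by simp [hyV, hVU.1]) u hu
      (fun k hk => huU k fun h' => hk (Finset.mem_union_right _ h')) hy fun j' hj' => ?_
    rw [← Finset.insert_union]
    exact h (i + 1) (by omega) j' (by omega)

/-- Multiplication by a linear form which is surjective and injective on the graded module `G / P`
in the relevant degrees forces the vanishing of the Koszul homology of `G / P`. -/
lemma exists_sub_contraction_mem (hv : ActsInDegreeOne G v) {P : ℕ → Submodule K A}
    (hP : ActsInDegreeOne P v) (a : ι → K)
    (hsurj : ∀ x ∈ G (j + 1), ∃ y ∈ G j, x - (∑ k, a k • v k) * y ∈ P (j + 1))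
    (hinj : ∀ x ∈ G (j + 1), (∑ k, a k • v k) * x ∈ P (j + 2) → x ∈ P (j + 1))
    {c : Finset ι → A} (hc : c ∈ kChains G Finset.univ i (j + 1))
    (hc0 : ∀ σ, contraction v c σ ∈ P (j + 2)) :
    ∃ w ∈ kChains G Finset.univ (i + 1) j, ∀ σ, c σ - contraction v w σ ∈ P (j + 1) := by
  classical
  choose y hy hyP using fun σ => hsurj (c σ) (hc σ).1
  set l := ∑ k, a k • v k with hl
  -- Dividing c by the linear form modulo P; the value 0 where c vanishes keeps the support in
  -- homological degree i.
  set c' : Finset ι → A := fun σ => if c σ = 0 then 0 else y σ with hc'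
  have hc'm : c' ∈ kChains G Finset.univ i j := fun σ => by
    simp only [hc']
    split_ifs with h
    · exact ⟨zero_mem _, fun h => absurd rfl h⟩
    · exact ⟨hy σ, fun _ => (hc σ).2 h⟩
  have hcc' : ∀ σ, c σ - l * c' σ ∈ P (j + 1) := fun σ => by
    simp only [hc']
    split_ifs with h
    · rw [h, mul_zero, sub_zero]; exact zero_mem _
    · exact hyP σ
  have hct : ∀ {b : Finset ι → A} {m : ℕ}, (∀ σ, b σ ∈ P m) →
      ∀ σ, contraction v b σ ∈ P (m + 1) := fun hb σ => by
    rw [contraction_apply]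
    exact sum_mem fun k _ => posSign_mul_mem _ _ _ (hP k _ _ (hb _))
  -- The form times this boundary lies in P, as the boundary of c does; injectivity then makes c' a
  -- cycle modulo P.
  have hc'0 : ∀ σ, contraction v c' σ ∈ P (j + 1) := fun σ => by
    have hm : contraction v c' σ ∈ G (j + 1) := by
      rw [contraction_apply]
      exact sum_mem fun k _ => posSign_mul_mem _ _ _ (hv k j _ (hc'm _).1)
    refine hinj _ hm ?_
    have h1 := hct hcc' σ
    have h2 : contraction v (fun σ => c σ - l * c' σ) = contraction v c - l • contraction v c' := by
      rw [← map_smul, ← map_sub]; rfl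
    rw [h2] at h1
    have := sub_mem (hc0 σ) h1
    simpa using this
  -- Wedging with the coefficient vector of the form is the homotopy showing that the form acts as
  -- zero on homology.
  refine ⟨wedge (fun k => algebraMap K A (a k)) c', wedge_mem_kChains
    (fun k b hb => by rw [← Algebra.smul_def]; exact (G j).smul_mem _ hb) (by simp) hc'm,
    fun σ => ?_⟩
  have hl' : ∑ k, algebraMap K A (a k) * v k = l := by
    rw [hl]; exact Finset.sum_congr rfl fun k _ => (Algebra.smul_def _ _).symm
  have h3 : wedge (fun k => algebraMap K A (a k)) (contraction v c') σ ∈ P (j + 1) := by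
    rw [wedge_apply]
    refine sum_mem fun k _ => posSign_mul_mem _ _ _ ?_
    rw [← Algebra.smul_def]
    exact (P (j + 1)).smul_mem _ (hc'0 _)
  rw [contraction_wedge, hl']
  have := add_mem (hcc' σ) h3
  simpa [sub_sub_eq_add_sub, sub_add_eq_add_sub] using this

end KoszulHomology

end ProjVar

namespace ProjVar

open MvPolynomial

set_option linter.unusedSectionVars false

/-! ### Koszul complexes along order embeddings of the index set -/

section Reindexing

variable {ι κ K A : Type*} [Field K] [CommRing A] [Algebra K A] [LinearOrder ι] [LinearOrder κ]
  [Fintype ι] [Fintype κ] {G : ℕ → Submodule K A} (e : κ ↪o ι) (v : ι → A) {i j : ℕ}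

lemma posSign_map (τ : Finset κ) (k : κ) :
    posSign A (τ.map e.toEmbedding) (e k) = posSign A τ k := by
  unfold posSign
  rw [Finset.filter_map, Finset.card_map]
  congr 2
  ext l
  simp

lemma contraction_comp_map {c : Finset ι → A} (hc : c ∈ kChains G (Finset.univ.map e.toEmbedding) i j)
    (τ : Finset κ) :
    contraction (fun k => v (e k)) (fun τ => c (τ.map e.toEmbedding)) τ =
      contraction v c (τ.map e.toEmbedding) := by
  rw [contraction_apply, contraction_apply]
  have hsub : (τᶜ).map e.toEmbedding ⊆ (τ.map e.toEmbedding)ᶜ := by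
    intro x hx
    obtain ⟨k, hk, rfl⟩ := Finset.mem_map.mp hx
    simpa using hk
  rw [← Finset.sum_subset hsub, Finset.sum_map]
  · refine Finset.sum_congr rfl fun k _ => ?_
    rw [Finset.map_insert]
    congr 1
    exact (posSign_map e τ k).symm
  · intro x hx hx'
    by_contra h
    have h1 := ((hc (insert x (τ.map e.toEmbedding))).2 fun h' => h (by simp [h'])).1
      (Finset.mem_insert_self _ _)
    obtain ⟨k, -, rfl⟩ := Finset.mem_map.mp h1
    refine hx' (Finset.mem_map_of_mem _ ?_)
    rw [Finset.mem_compl] at hx ⊢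
    exact fun hk => hx (Finset.mem_map_of_mem _ hk)

lemma comp_map_mem_kChains {c : Finset ι → A} {U : Finset ι} (hc : c ∈ kChains G U i j) :
    (fun τ => c (τ.map e.toEmbedding)) ∈ kChains G Finset.univ i j := fun τ =>
  ⟨(hc _).1, fun h => ⟨Finset.subset_univ _, by
    rw [← ((hc _).2 h).2, Finset.card_map]⟩⟩

lemma exists_comp_map_eq {c : Finset κ → A} (hc : c ∈ kChains G Finset.univ i j) :
    ∃ c' ∈ kChains G (Finset.univ.map e.toEmbedding) i j,
      (fun τ => c' (τ.map e.toEmbedding)) = c := by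
  classical
  refine ⟨fun σ => if h : ∃ τ : Finset κ, τ.map e.toEmbedding = σ then c h.choose else 0,
    fun σ => ?_, ?_⟩
  · simp only
    split_ifs with h
    · refine ⟨(hc _).1, fun hne => ?_⟩
      have h1 := ((hc _).2 hne).2
      constructor
      · rw [← h.choose_spec]
        exact Finset.map_subset_map.mpr (Finset.subset_univ _)
      · rw [← h1, ← Finset.card_map e.toEmbedding, h.choose_spec]
    · exact ⟨zero_mem _, fun h => absurd rfl h⟩
  · funext τ
    have h : ∃ τ' : Finset κ, τ'.map e.toEmbedding = τ.map e.toEmbedding := ⟨τ, rfl⟩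
    simp only
    rw [dif_pos h, Finset.map_injective _ h.choose_spec]

lemma eq_of_comp_map_eq {i' j' : ℕ} {c d : Finset ι → A}
    (hc : c ∈ kChains G (Finset.univ.map e.toEmbedding) i j)
    (hd : d ∈ kChains G (Finset.univ.map e.toEmbedding) i' j')
    (h : ∀ τ : Finset κ, c (τ.map e.toEmbedding) = d (τ.map e.toEmbedding)) : c = d := by
  funext σ
  by_cases hσ : σ ⊆ Finset.univ.map e.toEmbedding
  · obtain ⟨τ, -, rfl⟩ := Finset.subset_map_iff.mp hσ
    exact h τ
  · have h1 : c σ = 0 := by_contra fun h => hσ ((hc σ).2 h).1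
    have h2 : d σ = 0 := by_contra fun h => hσ ((hd σ).2 h).1
    rw [h1, h2]

lemma koszulVanishing_map_iff (hv : ActsInDegreeOne G v) :
    KoszulVanishing G v (Finset.univ.map e.toEmbedding) i j ↔
      KoszulVanishing G (fun k => v (e k)) Finset.univ i j := by
  constructor
  · intro h c hc hc0
    obtain ⟨c', hc', rfl⟩ := exists_comp_map_eq e hc
    obtain ⟨w, hw, hwc⟩ := h c' hc' (by
      cases i with
      | zero =>
        funext σ
        rw [contraction_apply]
        refine Finset.sum_eq_zero fun k _ => ?_
        by_contra hne
        have := ((hc' (insert k σ)).2 fun h' => hne (by simp [h'])).2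
        simp at this
      | succ i =>
        refine eq_of_comp_map_eq e (contraction_mem_kChains hv hc') (i' := 0) (j' := 0)
          (zero_mem _) fun τ => ?_
        rw [← contraction_comp_map e v hc', hc0]; rfl)
    refine ⟨_, comp_map_mem_kChains e hw, ?_⟩
    funext τ
    rw [contraction_comp_map e v hw, hwc]
  · intro h c hc hc0
    obtain ⟨w, hw, hwc⟩ := h _ (comp_map_mem_kChains e hc) (by
      funext τ
      rw [contraction_comp_map e v hc, hc0]; rfl)
    obtain ⟨w', hw', rfl⟩ := exists_comp_map_eq e hw
    refine ⟨w', hw', eq_of_comp_map_eq e (contraction_mem_kChains hv hw') hc fun τ => ?_⟩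
    rw [← contraction_comp_map e v hw', hwc]

end Reindexing

/-! ### Betti numbers, regularity and degrees of generators -/

section Betti

variable {K : Type*} [Field K] {n : ℕ}

lemma koszulDifferential_eq_contraction (I : Ideal (CoordRing K n))
    (c : Finset (Fin (n + 1)) → CoordRing K n ⧸ I) :
    koszulDifferential I c = contraction (fun k => Ideal.Quotient.mk I (X k)) c := by
  funext τ
  rw [contraction_apply]
  rfl

lemma mem_gradedPiece {I : Ideal (CoordRing K n)} {d : ℕ} {a : CoordRing K n ⧸ I} :
    a ∈ gradedPiece I d ↔ ∃ F : CoordRing K n, F.IsHomogeneous d ∧ Ideal.Quotient.mk I F = a :=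
  Iff.rfl

lemma mk_mul_mem_gradedPiece {I : Ideal (CoordRing K n)} {d e : ℕ} {F : CoordRing K n}
    (hF : F.IsHomogeneous e) {a : CoordRing K n ⧸ I} (ha : a ∈ gradedPiece I d) :
    Ideal.Quotient.mk I F * a ∈ gradedPiece I (d + e) := by
  obtain ⟨H, hH, rfl⟩ := ha
  exact ⟨F * H, add_comm e d ▸ hF.mul hH, map_mul (Ideal.Quotient.mk I) F H⟩

lemma koszulChains_eq_kChains (I : Ideal (CoordRing K n)) (i j m : ℕ) (hm : m = i + j) :
    koszulChains I i m = kChains (gradedPiece I) Finset.univ i j := by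
  subst hm
  ext c
  simp only [koszulChains, Submodule.mem_pi, Set.mem_univ, true_imp_iff]
  refine forall_congr' fun σ => ?_
  by_cases h : σ.card = i
  · simp [h]
  · rw [if_neg fun h' => h h'.1, Submodule.mem_bot]
    exact ⟨fun h' => by rw [h']; exact ⟨zero_mem _, fun h => absurd rfl h⟩,
      fun h' => by_contra fun hne => h (h'.2 hne).2⟩

lemma gradedPiece_fg (I : Ideal (CoordRing K n)) (d : ℕ) : (gradedPiece I d).FG :=
  (homogeneousSubmodule_fg _ _ _).map _

lemma bettiNumber_eq_zero_iff (I : Ideal (CoordRing K n)) (i j : ℕ) :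
    bettiNumber I i (j + 1) = 0 ↔
      KoszulVanishing (gradedPiece I) (fun k => Ideal.Quotient.mk I (X k)) Finset.univ i j := by
  -- Finite dimension is essential: `finrank` would also be 0 on an infinite-dimensional space.
  have hfin : Module.Finite K (koszulChains I i (i + (j + 1))) := by
    refine Module.Finite.iff_fg.mpr (Submodule.fg_pi fun σ => ?_)
    split_ifs
    · exact gradedPiece_fg I _
    · exact Submodule.fg_bot
  have hfin' : Module.Finite K (koszulCycles I i (i + (j + 1))) :=
    Submodule.finiteDimensional_of_le inf_le_left
  rw [bettiNumber, Module.finrank_zero_iff, Submodule.Quotient.subsingleton_iff,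
    Submodule.submoduleOf_eq_top, koszulCycles, koszulBoundaries,
    koszulChains_eq_kChains I i (j + 1) _ rfl,
    koszulChains_eq_kChains I (i + 1) j _ (by omega)]
  simp only [SetLike.le_def, Submodule.mem_inf, LinearMap.mem_ker, Submodule.mem_map,
    koszulDifferential_eq_contraction, and_imp]
  rfl

lemma ringRegularity_le_iff (I : Ideal (CoordRing K n)) (m : ℕ) :
    ringRegularity I ≤ m ↔ ∀ i, ∀ j ≥ m,
      KoszulVanishing (gradedPiece I) (fun k => Ideal.Quotient.mk I (X k)) Finset.univ i j := by
  rw [ringRegularity, sSup_le_iff]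
  constructor
  · intro h i j hj
    rw [← bettiNumber_eq_zero_iff]
    by_contra hne
    have := h _ ⟨i, j + 1, hne, rfl⟩
    rw [Nat.cast_le] at this
    omega
  · rintro h _ ⟨i, j, hne, rfl⟩
    rw [Nat.cast_le]
    by_contra hj
    obtain ⟨j, rfl⟩ : ∃ j', j = j' + 1 := ⟨j - 1, by omega⟩
    exact hne ((bettiNumber_eq_zero_iff I i j).mpr (h i j (by omega)))

lemma actsInDegreeOne_mk_X (I : Ideal (CoordRing K n)) :
    ActsInDegreeOne (gradedPiece I) (fun k => Ideal.Quotient.mk I (X k)) := fun k _ _ ha =>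
  mk_mul_mem_gradedPiece (isHomogeneous_X K k) ha

lemma mem_vanishingIdeal_iff {Z : Set (PSpace K n)} {F : CoordRing K n} {d : ℕ}
    (hF : F.IsHomogeneous d) : F ∈ vanishingIdeal Z ↔ ∀ p ∈ Z, VanishesAt F p := by
  refine ⟨fun h p hp => ?_, fun h => Ideal.subset_span ⟨⟨d, hF⟩, h⟩⟩
  have : vanishingIdeal Z ≤ RingHom.ker (eval p.rep) :=
    Ideal.span_le.mpr fun G hG => hG.2 p hp
  exact this h

lemma homogeneousComponent_mem_vanishingIdeal {Z : Set (PSpace K n)} {F : CoordRing K n}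
    (hF : F ∈ vanishingIdeal Z) (d : ℕ) : homogeneousComponent d F ∈ vanishingIdeal Z := by
  let _ := MvPolynomial.gradedAlgebra (σ := Fin (n + 1)) (R := K)
  refine homogeneousComponent_mem_of_mem (Ideal.homogeneous_span _ _ ?_) hF d
  rintro G ⟨⟨e, he⟩, -⟩
  exact ⟨e, he⟩

lemma contraction_empty {ι A : Type*} [LinearOrder ι] [Fintype ι] [CommRing A] (v : ι → A)
    (c : Finset ι → A) : contraction v c ∅ = ∑ k, v k * c {k} := by
  rw [contraction_apply, Finset.compl_empty]
  exact Finset.sum_congr rfl fun k _ => by simp [posSign]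

lemma exists_eq_sum_X_mul {F : CoordRing K n} {m : ℕ} (hF : F.IsHomogeneous (m + 1)) :
    ∃ f : Fin (n + 1) → CoordRing K n, (∀ k, (f k).IsHomogeneous m) ∧ F = ∑ k, X k * f k := by
  have h1 : F ∈ Ideal.span (Set.range (X : Fin (n + 1) → CoordRing K n)) := by
    rw [← Set.image_univ, mem_ideal_span_X_image]
    intro d hd
    by_contra! h
    have hd0 : d = 0 := by ext i; simpa using h i (Set.mem_univ i)
    have := hF.degree_eq_sum_deg_support hd
    rw [hd0] at this
    simp at this
  obtain ⟨f, hf⟩ := Ideal.mem_span_range_iff_exists_fun.mp h1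
  refine ⟨fun k => homogeneousComponent m (f k), fun k => homogeneousComponent_isHomogeneous _ _, ?_⟩
  have h2 := congrArg (homogeneousComponent (1 + m)) hf
  rw [map_sum, add_comm 1 m, homogeneousComponent_eq_self hF, add_comm m 1] at h2
  rw [← h2]
  refine Finset.sum_congr rfl fun k _ => ?_
  rw [mul_comm (f k), homogeneousComponent_mul_of_isHomogeneous (isHomogeneous_X K k)]

/-- A vector as a chain of homological degree one. -/
def chainOfVector {ι A : Type*} [LinearOrder ι] [Fintype ι] [CommRing A] (f : ι → A) :
    Finset ι → A := fun σ => ∑ k, if σ = {k} then f k else 0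

lemma chainOfVector_singleton {ι A : Type*} [LinearOrder ι] [Fintype ι] [CommRing A] (f : ι → A)
    (k : ι) : chainOfVector f {k} = f k := by
  rw [chainOfVector, Finset.sum_eq_single k]
  · simp
  · intro l _ hl
    rw [if_neg fun h => hl (Finset.singleton_injective h).symm]
  · simp

lemma chainOfVector_mem_kChains {ι A : Type*} [LinearOrder ι] [Fintype ι] [CommRing A]
    [Algebra K A] {G : ℕ → Submodule K A} {j : ℕ} {f : ι → A} (hf : ∀ k, f k ∈ G j) :
    chainOfVector f ∈ kChains G Finset.univ 1 j := fun σ => by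
  refine ⟨sum_mem fun k _ => ?_, fun h => ⟨Finset.subset_univ _, ?_⟩⟩
  · split_ifs
    · exact hf k
    · exact zero_mem _
  · obtain ⟨k, -, hk⟩ := Finset.exists_ne_zero_of_sum_ne_zero h
    have : σ = {k} := by by_contra h'; exact hk (if_neg h')
    rw [this, Finset.card_singleton]

lemma contraction_chainOfVector {ι A : Type*} [LinearOrder ι] [Fintype ι] [CommRing A] {v f : ι → A}
    (h : ∑ k, v k * f k = 0) : contraction v (chainOfVector f) = 0 := by
  funext σ
  rcases σ.eq_empty_or_nonempty with rfl | hσ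
  · rw [contraction_empty, Pi.zero_apply, ← h]
    exact Finset.sum_congr rfl fun k _ => by rw [chainOfVector_singleton]
  · rw [contraction_apply]
    refine Finset.sum_eq_zero fun k hk => ?_
    rw [chainOfVector, Finset.sum_eq_zero fun l _ => if_neg fun hl => ?_, mul_zero, mul_zero]
    have h1 := congrArg Finset.card hl
    rw [Finset.card_insert_of_notMem (Finset.mem_compl.mp hk), Finset.card_singleton] at h1
    have := hσ.card_pos
    omega

/-- If `β_{1,j}(S / I) = 0` for all `j > d`, then `I` is generated in degrees `≤ d + 1`. -/
lemma generatedInDegreesLE_of_koszulVanishing {Z : Set (PSpace K n)} {d : ℕ}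
    (h : ∀ j ≥ d, KoszulVanishing (gradedPiece (vanishingIdeal Z))
      (fun k => Ideal.Quotient.mk (vanishingIdeal Z) (X k)) Finset.univ 1 j) :
    GeneratedInDegreesLE (vanishingIdeal Z) (d + 1) := by
  set I := vanishingIdeal Z with hI
  refine le_antisymm ?_ (Ideal.span_le.mpr fun F hF => hF.1)
  set J := Ideal.span {F | F ∈ I ∧ ∃ e ≤ d + 1, F.IsHomogeneous e} with hJ
  have key : ∀ e, ∀ F ∈ I, F.IsHomogeneous e → F ∈ J := by
    intro e
    induction e using Nat.strong_induction_on with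
    | _ e ih =>
      intro F hFI hF
      by_cases he : e ≤ d + 1
      · exact Ideal.subset_span ⟨hFI, e, he, hF⟩
      obtain ⟨j, rfl⟩ : ∃ j, e = j + 1 + 1 := ⟨e - 2, by omega⟩
      obtain ⟨f, hf, hFf⟩ := exists_eq_sum_X_mul hF
      -- As F lies in I, its coefficients form a Koszul 1-cycle over S/I. Subtracting a lift of a
      -- chain's boundary moves the coefficients into I without changing F, so F comes from elements
      -- of I of smaller degree.
      obtain ⟨w, hw, hwf⟩ := h j (by omega) (chainOfVector fun k => Ideal.Quotient.mk I (f k))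
        (chainOfVector_mem_kChains fun k => ⟨f k, hf k, rfl⟩) (contraction_chainOfVector (by
          simp only [← map_mul, ← map_sum, ← hFf]
          exact Ideal.Quotient.eq_zero_iff_mem.mpr hFI))
      choose g hg hgw using fun σ => mem_gradedPiece.mp (hw σ).1
      have hghom : ∀ k, (contraction X g {k}).IsHomogeneous (j + 1) := fun k => by
        rw [contraction_apply]
        refine IsHomogeneous.sum _ _ _ fun l _ => posSign_mul_isHomogeneous ?_
        exact add_comm 1 j ▸ (isHomogeneous_X K l).mul (hg _)
      have hmem : ∀ k, f k - contraction X g {k} ∈ J := fun k => by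
        refine ih (j + 1) (by omega) _ ?_ ((hf k).sub (hghom k))
        rw [← Ideal.Quotient.eq, map_contraction, ← chainOfVector_singleton
          (fun k => Ideal.Quotient.mk I (f k)) k, ← hwf]
        simp only [hgw]
      have h0 : ∑ k, X k * contraction X g {k} = 0 := by
        rw [← contraction_empty, contraction_contraction_self]; rfl
      have hF' : F = ∑ k, X k * (f k - contraction X g {k}) := by
        simp only [mul_sub, Finset.sum_sub_distrib, h0, sub_zero, hFf]
      rw [hF']
      exact sum_mem fun k _ => Ideal.mul_mem_left _ _ (hmem k)
  intro F hF
  rw [← sum_homogeneousComponent F]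
  exact sum_mem fun e _ => key e _ (homogeneousComponent_mem_vanishingIdeal hF e)
    (homogeneousComponent_isHomogeneous _ _)

end Betti

end ProjVar

namespace ProjVar

open MvPolynomial

/-! ### Graded algebras with a linear presentation over the polynomial ring -/

section LinearCover

variable {K R : Type*} [Field K] [CommRing R] [Algebra K R] {r t : ℕ}

/-- The graded pieces of the image of the polynomial ring. -/
noncomputable def imagePiece (θ : CoordRing K r →ₐ[K] R) (d : ℕ) : Submodule K R :=
  (homogeneousSubmodule (Fin (r + 1)) K d).map θ.toLinearMap

lemma mem_imagePiece {θ : CoordRing K r →ₐ[K] R} {d : ℕ} {a : R} :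
    a ∈ imagePiece θ d ↔ ∃ F : CoordRing K r, F.IsHomogeneous d ∧ θ F = a := Iff.rfl

lemma imagePiece_mul_mem {θ : CoordRing K r →ₐ[K] R} {d e : ℕ} {F : CoordRing K r}
    (hF : F.IsHomogeneous e) {a : R} (ha : a ∈ imagePiece θ d) : θ F * a ∈ imagePiece θ (d + e) := by
  obtain ⟨H, hH, rfl⟩ := ha
  exact ⟨F * H, add_comm e d ▸ hF.mul hH, map_mul θ F H⟩

/-- A graded algebra `G` over the polynomial ring which, as a module, is generated by `1` and
elements `y i` of degree one, with vanishing conditions for its first two Koszul homology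
modules which make the presentation of `G / S` linear. -/
structure IsLinearCover (θ : CoordRing K r →ₐ[K] R) (G : ℕ → Submodule K R) (y : Fin t → R) :
    Prop where
  mul_mem : ∀ {d e : ℕ} {F : CoordRing K r}, F.IsHomogeneous e → ∀ {a : R}, a ∈ G d →
    θ F * a ∈ G (d + e)
  imagePiece_le : ∀ d, imagePiece θ d ≤ G d
  y_mem : ∀ i, y i ∈ G 1
  exists_eq : ∀ a ∈ G 1, ∃ F : CoordRing K r, F.IsHomogeneous 1 ∧ ∃ c : Fin t → K,
    a = θ F + ∑ i, c i • y i
  indep : ∀ F : CoordRing K r, F.IsHomogeneous 1 → ∀ c : Fin t → K,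
    θ F + ∑ i, c i • y i = 0 → c = 0
  vanishing_zero : ∀ j ≥ 1, KoszulVanishing G (fun k => θ (X k)) Finset.univ 0 j
  vanishing_one : ∀ j ≥ 1, KoszulVanishing G (fun k => θ (X k)) Finset.univ 1 j

namespace IsLinearCover

variable {θ : CoordRing K r →ₐ[K] R} {G : ℕ → Submodule K R} {y : Fin t → R}

/-- Vanishing of the zeroth Koszul homology says that there are no new generators in degrees ≥ 2, so
everything comes from degree 1. -/
lemma exists_eq_succ (h : IsLinearCover θ G y) {d : ℕ} {a : R} (ha : a ∈ G (d + 1)) :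
    ∃ (F : CoordRing K r) (f : Fin t → CoordRing K r), F.IsHomogeneous (d + 1) ∧
      (∀ i, (f i).IsHomogeneous d) ∧ a = θ F + ∑ i, θ (f i) * y i := by
  induction d generalizing a with
  | zero =>
    obtain ⟨F, hF, c, rfl⟩ := h.exists_eq a ha
    refine ⟨F, fun i => C (c i), hF, fun i => isHomogeneous_C _ _, ?_⟩
    simp [Algebra.smul_def, ← algebraMap_eq]
  | succ d ih =>
    obtain ⟨w, hw, hwa⟩ := h.vanishing_zero (d + 1) (by omega) (Pi.single ∅ a) (fun σ => by
        by_cases hσ : σ = ∅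
        · subst hσ; simpa using ha
        · simp [hσ]) (by
        funext σ
        rw [contraction_apply]
        refine Finset.sum_eq_zero fun k _ => ?_
        rw [Pi.single_apply, if_neg (Finset.insert_ne_empty k σ), mul_zero, mul_zero])
    have h1 := congrFun hwa ∅
    rw [contraction_empty, Pi.single_eq_same] at h1
    choose F f hF hf hFf using fun k => ih (hw {k}).1
    refine ⟨∑ k, X k * F k, fun i => ∑ k, X k * f k i, ?_, fun i => ?_, ?_⟩
    · exact IsHomogeneous.sum _ _ _ fun k _ => add_comm 1 (d + 1) ▸ (isHomogeneous_X K k).mul (hF k)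
    · exact IsHomogeneous.sum _ _ _ fun k _ => add_comm 1 d ▸ (isHomogeneous_X K k).mul (hf k i)
    · rw [← h1]
      simp only [map_sum, map_mul, hFf, mul_add, Finset.sum_add_distrib, Finset.mul_sum,
        Finset.sum_mul, mul_assoc]
      rw [Finset.sum_comm (s := Finset.univ (α := Fin (r + 1)))]

/-- The linear relations between the generators `y i` modulo the image of the polynomial ring. -/
noncomputable def linearRelations (θ : CoordRing K r →ₐ[K] R) (y : Fin t → R) :
    Submodule K (Fin t → CoordRing K r) :=
  Submodule.pi Set.univ (fun _ => homogeneousSubmodule (Fin (r + 1)) K 1) ⊓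
    (imagePiece θ 2).comap
      (∑ i, (LinearMap.mulRight K (y i)) ∘ₗ θ.toLinearMap ∘ₗ LinearMap.proj i)

lemma mem_linearRelations {f : Fin t → CoordRing K r} :
    f ∈ linearRelations θ y ↔
      (∀ i, (f i).IsHomogeneous 1) ∧ ∑ i, θ (f i) * y i ∈ imagePiece θ 2 := by
  simp [linearRelations, Submodule.mem_inf, Submodule.mem_pi, LinearMap.coe_sum]

lemma exists_presentation (θ : CoordRing K r →ₐ[K] R) (y : Fin t → R) :
    ∃ (b : ℕ) (φ : Fin t → Fin b → CoordRing K r), (∀ i k, (φ i k).IsHomogeneous 1) ∧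
      (∀ k, ∑ i, θ (φ i k) * y i ∈ imagePiece θ 2) ∧
      ∀ f ∈ linearRelations θ y, ∃ u : Fin b → K, ∀ i, f i = ∑ k, φ i k * C (u k) := by
  have hfin : Module.Finite K (linearRelations θ y) := by
    have : Module.Finite K (Submodule.pi Set.univ
        (fun _ : Fin t => homogeneousSubmodule (Fin (r + 1)) K 1)) :=
      Module.Finite.iff_fg.mpr (Submodule.fg_pi fun _ => homogeneousSubmodule_fg _ _ _)
    exact Submodule.finiteDimensional_of_le inf_le_left
  obtain ⟨b, s, hs⟩ := Submodule.fg_iff_exists_fin_generating_family.mp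
    (Module.Finite.iff_fg.mp hfin)
  have hmem : ∀ k, s k ∈ linearRelations θ y := fun k => hs ▸ Submodule.subset_span ⟨k, rfl⟩
  refine ⟨b, fun i k => s k i, fun i k => (mem_linearRelations.mp (hmem k)).1 i,
    fun k => (mem_linearRelations.mp (hmem k)).2, fun f hf => ?_⟩
  rw [← hs, Submodule.mem_span_range_iff_exists_fun] at hf
  obtain ⟨u, rfl⟩ := hf
  refine ⟨u, fun i => ?_⟩
  rw [Finset.sum_apply]
  exact Finset.sum_congr rfl fun k _ => by rw [Pi.smul_apply, smul_eq_C_mul, mul_comm]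

variable {b : ℕ} {φ : Fin t → Fin b → CoordRing K r}

/-- The module `G / S` is presented by the linear relations between the `y i`. -/
lemma exists_eq_sum_of_mem_imagePiece (h : IsLinearCover θ G y)
    (hφ : ∀ f ∈ linearRelations θ y, ∃ u : Fin b → K, ∀ i, f i = ∑ k, φ i k * C (u k)) {d : ℕ}
    (f : Fin t → CoordRing K r) (hf : ∀ i, (f i).IsHomogeneous d)
    (hfy : ∑ i, θ (f i) * y i ∈ imagePiece θ (d + 1)) :
    ∃ u : Fin b → CoordRing K r, ∀ i, f i = ∑ k, φ i k * u k := by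
  match d with
  | 0 =>
    obtain ⟨F, hF, hFf⟩ := hfy
    have hc : ∀ i, f i = C (coeff 0 (f i)) := fun i => by
      rw [← homogeneousComponent_zero, homogeneousComponent_eq_self (hf i)]
    have h0 := h.indep (-F) hF.neg (fun i => coeff 0 (f i)) (by
      have h1 : θ F = ∑ i, θ (f i) * y i := hFf
      rw [map_neg, h1, neg_add_eq_zero]
      refine Finset.sum_congr rfl fun i _ => ?_
      conv_lhs => rw [hc i]
      rw [Algebra.smul_def, ← algebraMap_eq, AlgHom.commutes])
    refine ⟨0, fun i => ?_⟩
    rw [hc i, show coeff 0 (f i) = 0 from congrFun h0 i]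
    simp
  | 1 =>
    obtain ⟨u, hu⟩ := hφ f (mem_linearRelations.mpr ⟨hf, hfy⟩)
    exact ⟨fun k => C (u k), hu⟩
  | d + 2 =>
    obtain ⟨F, hF, hFf⟩ := mem_imagePiece.mp hfy
    obtain ⟨F', hF', hFF'⟩ := exists_eq_sum_X_mul hF
    choose f' hf' hff' using fun i => exists_eq_sum_X_mul (hf i)
    -- Splitting a variable off each coefficient turns the relation into a Koszul 1-cycle. Once a
    -- boundary is subtracted, the relation is a combination, with the variables as coefficients, of
    -- relations of degree one less, to which the recursion applies.
    obtain ⟨w, hw, hwr⟩ := h.vanishing_one (d + 1) (by omega)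
      (chainOfVector fun k => ∑ i, θ (f' i k) * y i - θ (F' k))
      (chainOfVector_mem_kChains fun k => sub_mem (sum_mem fun i _ => by
        have := h.mul_mem (hf' i k) (h.y_mem i)
        rwa [add_comm 1] at this) (h.imagePiece_le _ ⟨F' k, hF' k, rfl⟩))
      (contraction_chainOfVector (by
        simp only [mul_sub, Finset.sum_sub_distrib, Finset.mul_sum]
        rw [Finset.sum_comm, sub_eq_zero]
        simp only [← mul_assoc, ← Finset.sum_mul, ← map_mul, ← map_sum, ← hff', ← hFF', hFf]))
    choose H g hH hg hw' using fun σ => h.exists_eq_succ (hw σ).1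
    have hcX : ∀ (g : Finset (Fin (r + 1)) → CoordRing K r) (m : ℕ),
        (∀ σ, (g σ).IsHomogeneous m) → ∀ σ, (contraction X g σ).IsHomogeneous (m + 1) :=
      fun g m hg σ => by
        rw [contraction_apply]
        refine IsHomogeneous.sum _ _ _ fun l _ => posSign_mul_isHomogeneous ?_
        exact add_comm 1 m ▸ (isHomogeneous_X K l).mul (hg _)
    have hmap : ∀ (g : Finset (Fin (r + 1)) → CoordRing K r) (σ : Finset (Fin (r + 1))),
        θ (contraction X g σ) = contraction (fun k => θ (X k)) (fun σ => θ (g σ)) σ :=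
      fun g σ => map_contraction θ.toRingHom X g σ
    have hk : ∀ k, ∑ i, θ (f' i k) * y i - θ (F' k) =
        θ (contraction X H {k}) + ∑ i, θ (contraction X (fun σ => g σ i) {k}) * y i := fun k => by
      rw [← chainOfVector_singleton (fun k => ∑ i, θ (f' i k) * y i - θ (F' k)) k, ← hwr]
      have hw'' : w = (fun σ => θ (H σ)) + ∑ i, y i • fun σ => θ (g σ i) := by
        funext σ
        rw [hw' σ, Pi.add_apply, Finset.sum_apply]
        congr 1
        exact Finset.sum_congr rfl fun i _ => mul_comm _ _
      rw [hw'', map_add, map_sum, Pi.add_apply, Finset.sum_apply, hmap]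
      congr 1
      refine Finset.sum_congr rfl fun i _ => ?_
      rw [map_smul, hmap, Pi.smul_apply, smul_eq_mul, mul_comm]
    choose u hu using fun k => exists_eq_sum_of_mem_imagePiece h hφ
      (fun i => f' i k - contraction X (fun σ => g σ i) {k})
      (fun i => (hf' i k).sub (hcX _ d (fun σ => hg σ i) _))
      (mem_imagePiece.mpr ⟨F' k + contraction X H {k}, (hF' k).add (hcX H (d + 1) hH _), by
        simp only [map_sub, map_add, sub_mul, Finset.sum_sub_distrib]
        rw [eq_sub_iff_add_eq, add_assoc, ← hk k]; abel⟩)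
    refine ⟨fun l => ∑ k, X k * u k l, fun i => ?_⟩
    have h0 : ∑ k, X k * contraction X (fun σ => g σ i) {k} = 0 := by
      rw [← contraction_empty, contraction_contraction_self]; rfl
    have h1 : f i = ∑ k, X k * (f' i k - contraction X (fun σ => g σ i) {k}) := by
      simp only [mul_sub, Finset.sum_sub_distrib, h0, sub_zero]
      exact hff' i
    rw [h1]
    simp only [hu, Finset.mul_sum]
    rw [Finset.sum_comm]
    exact Finset.sum_congr rfl fun l _ => Finset.sum_congr rfl fun k _ => by ring

lemma annihilatesCoker (h : IsLinearCover θ G y)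
    (hφ : ∀ f ∈ linearRelations θ y, ∃ u : Fin b → K, ∀ i, f i = ∑ k, φ i k * C (u k)) {e : ℕ}
    {F : CoordRing K r} (hF : F.IsHomogeneous e)
    (hFy : ∀ i, θ F * y i ∈ imagePiece θ (e + 1)) : AnnihilatesCoker φ F := by
  intro i
  obtain ⟨u, hu⟩ := h.exists_eq_sum_of_mem_imagePiece hφ (fun j => if j = i then F else 0)
    (fun j => by split_ifs; exacts [hF, isHomogeneous_zero _ _ _]) (by
      rw [Finset.sum_eq_single i]
      · simpa using hFy i
      · intro j _ hj; simp [hj]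
      · simp)
  exact ⟨u, fun j => by simp only [mul_comm (u _), ← hu]⟩

lemma sum_mem_imagePiece (hφy : ∀ k, ∑ i, θ (φ i k) * y i ∈ imagePiece θ 2) {d : ℕ}
    {w : Fin b → CoordRing K r} (hw : ∀ k, (w k).IsHomogeneous d) :
    ∑ i, θ (∑ k, φ i k * w k) * y i ∈ imagePiece θ (d + 2) := by
  have h1 : ∑ i, θ (∑ k, φ i k * w k) * y i = ∑ k, θ (w k) * ∑ i, θ (φ i k) * y i := by
    simp only [map_sum, map_mul, Finset.sum_mul, Finset.mul_sum]
    rw [Finset.sum_comm]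
    exact Finset.sum_congr rfl fun l _ => Finset.sum_congr rfl fun k _ => by ring
  rw [h1, add_comm]
  exact sum_mem fun k _ => imagePiece_mul_mem (hw k) (hφy k)

/-- Translation of `coker_surjective`: the cokernel of φ is G modulo the image of the polynomial
ring, shifted by one because the generators `y i` have degree 1. -/
lemma surjective_of_nilpotent (h : IsLinearCover θ G y) (ht : 1 ≤ t)
    (hφ1 : ∀ i k, (φ i k).IsHomogeneous 1)
    (hφy : ∀ k, ∑ i, θ (φ i k) * y i ∈ imagePiece θ 2) {lam : MvPolynomial (Fin r) K}
    (hlam : lam.IsHomogeneous 1)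
    (hnil : ∀ i : Fin r, ∃ e : ℕ,
      AnnihilatesCoker (fun i k => elimVar lam (φ i k)) (X i ^ (e + 1))) {j : ℕ} (hj : t ≤ j)
    (a : R) (ha : a ∈ G (j + 1)) :
    ∃ a' ∈ G j, a - θ (elimForm lam) * a' ∈ imagePiece θ (j + 1) := by
  obtain ⟨d, rfl⟩ : ∃ d, j = d + 1 := ⟨j - 1, by omega⟩
  obtain ⟨F, f, hF, hf, rfl⟩ := h.exists_eq_succ ha
  obtain ⟨g, w, hg, hw, hfgw⟩ := coker_surjective hφ1 ht hlam hnil hj f hf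
  refine ⟨∑ i, θ (g i) * y i, sum_mem fun i _ => add_comm 1 d ▸ h.mul_mem (hg i) (h.y_mem i), ?_⟩
  have h1 : θ F + ∑ i, θ (f i) * y i - θ (elimForm lam) * ∑ i, θ (g i) * y i =
      θ F + ∑ i, θ (∑ k, φ i k * w k) * y i := by
    rw [Finset.mul_sum, add_sub_assoc, ← Finset.sum_sub_distrib]
    congr 1
    refine Finset.sum_congr rfl fun i _ => ?_
    rw [hfgw i, map_add, map_mul]; ring
  rw [h1]
  exact add_mem ⟨F, hF, rfl⟩ (sum_mem_imagePiece hφy hw)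

lemma injective_of_nilpotent (h : IsLinearCover θ G y) (ht : 1 ≤ t)
    (hφ1 : ∀ i k, (φ i k).IsHomogeneous 1)
    (hφy : ∀ k, ∑ i, θ (φ i k) * y i ∈ imagePiece θ 2)
    (hφ : ∀ f ∈ linearRelations θ y, ∃ u : Fin b → K, ∀ i, f i = ∑ k, φ i k * C (u k))
    {lam : MvPolynomial (Fin r) K} (hlam : lam.IsHomogeneous 1)
    (hnil : ∀ i : Fin r, ∃ e : ℕ,
      AnnihilatesCoker (fun i k => elimVar lam (φ i k)) (X i ^ (e + 1))) {j : ℕ} (hj : t ≤ j)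
    (a : R) (ha : a ∈ G (j + 1)) (hla : θ (elimForm lam) * a ∈ imagePiece θ (j + 2)) :
    a ∈ imagePiece θ (j + 1) := by
  obtain ⟨d, rfl⟩ : ∃ d, j = d + 1 := ⟨j - 1, by omega⟩
  obtain ⟨F, f, hF, hf, rfl⟩ := h.exists_eq_succ ha
  have hl := elimForm_isHomogeneous hlam
  have hlf : ∀ i, (elimForm lam * f i).IsHomogeneous (d + 2) := fun i =>
    add_comm 1 (d + 1) ▸ hl.mul (hf i)
  obtain ⟨u, hu⟩ := h.exists_eq_sum_of_mem_imagePiece hφ (fun i => elimForm lam * f i) hlf (by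
    have h1 : ∑ i, θ (elimForm lam * f i) * y i =
        θ (elimForm lam) * (θ F + ∑ i, θ (f i) * y i) - θ (elimForm lam * F) := by
      simp only [map_mul, mul_add, Finset.mul_sum, mul_assoc]; abel
    rw [h1]
    exact sub_mem hla ⟨_, add_comm 1 (d + 1 + 1) ▸ hl.mul hF, rfl⟩)
  obtain ⟨w, hw, hfw⟩ := coker_injective hφ1 ht hlam hnil hj f
    (fun k => homogeneousComponent (d + 1) (u k))
    (fun k => homogeneousComponent_isHomogeneous _ _) (fun i => by
      have h1 := congrArg (homogeneousComponent (1 + (d + 1))) (hu i)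
      rw [map_sum, add_comm 1 (d + 1), homogeneousComponent_eq_self (hlf i),
        add_comm (d + 1) 1] at h1
      simpa only [homogeneousComponent_mul_of_isHomogeneous (hφ1 _ _)] using h1)
  refine add_mem ⟨F, hF, rfl⟩ ?_
  simp only [hfw]
  exact sum_mem_imagePiece hφy hw

end IsLinearCover

end LinearCover

end ProjVar

namespace ProjVar

open MvPolynomial

/-! ### Pullback of forms along a linear map -/

section LinearForms

variable {K : Type*} [Field K] {n m : ℕ}

lemma eval_smul_of_isHomogeneous {F : CoordRing K n} {d : ℕ} (hF : F.IsHomogeneous d) (a : K)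
    (v : Fin (n + 1) → K) : eval (a • v) F = a ^ d * eval v F := by
  rw [eval_eq', eval_eq', Finset.mul_sum]
  refine Finset.sum_congr rfl fun s hs => ?_
  have hd : ∑ i, s i = d := by
    rw [← hF (mem_support_iff.mp hs), Finsupp.weight_apply, Finsupp.sum_fintype _ _ (by simp)]
    simp
  simp only [Pi.smul_apply, smul_eq_mul, mul_pow, Finset.prod_mul_distrib]
  rw [Finset.prod_pow_eq_pow_sum, hd]
  ring

lemma vanishesAt_mk_iff {F : CoordRing K n} {d : ℕ} (hF : F.IsHomogeneous d)
    (v : Fin (n + 1) → K) (hv : v ≠ 0) :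
    VanishesAt F (Projectivization.mk K v hv) ↔ eval v F = 0 := by
  obtain ⟨a, ha⟩ := Projectivization.exists_smul_eq_mk_rep K v hv
  have ha' : (a : K) • v = (Projectivization.mk K v hv).rep := ha
  rw [VanishesAt, ← ha', eval_smul_of_isHomogeneous hF]
  simp

/-- The linear forms which are the coordinates of the linear map `L`. -/
noncomputable def coordForm (L : (Fin (n + 1) → K) →ₗ[K] (Fin (m + 1) → K)) (j : Fin (m + 1)) :
    CoordRing K n :=
  ∑ k, C (L (Pi.single k 1) j) * X k

lemma coordForm_isHomogeneous (L : (Fin (n + 1) → K) →ₗ[K] (Fin (m + 1) → K)) (j : Fin (m + 1)) :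
    (coordForm L j).IsHomogeneous 1 :=
  IsHomogeneous.sum _ _ _ fun _ _ => isHomogeneous_C_mul_X _ _

lemma eval_coordForm (L : (Fin (n + 1) → K) →ₗ[K] (Fin (m + 1) → K)) (j : Fin (m + 1))
    (v : Fin (n + 1) → K) : eval v (coordForm L j) = L v j := by
  conv_rhs => rw [LinearMap.pi_apply_eq_sum_univ L v]
  simp only [coordForm, map_sum, map_mul, eval_C, eval_X, Finset.sum_apply, Pi.smul_apply,
    smul_eq_mul, mul_comm]
  refine Finset.sum_congr rfl fun x _ => ?_
  have h1 : (Pi.single x 1 : Fin (n + 1) → K) = fun i => if x = i then 1 else 0 := by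
    funext i
    simp [Pi.single_apply, eq_comm]
  rw [h1]

/-- The pullback of polynomials along the linear map `L`. -/
noncomputable def pullback (L : (Fin (n + 1) → K) →ₗ[K] (Fin (m + 1) → K)) :
    CoordRing K m →ₐ[K] CoordRing K n :=
  aeval (coordForm L)

lemma pullback_X (L : (Fin (n + 1) → K) →ₗ[K] (Fin (m + 1) → K)) (j : Fin (m + 1)) :
    pullback L (X j) = coordForm L j := aeval_X _ _

lemma pullback_isHomogeneous (L : (Fin (n + 1) → K) →ₗ[K] (Fin (m + 1) → K)) {F : CoordRing K m}
    {d : ℕ} (hF : F.IsHomogeneous d) : (pullback L F).IsHomogeneous d := by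
  rw [← one_mul d]
  exact hF.aeval _ (coordForm_isHomogeneous L)

lemma eval_aeval {σ τ : Type*} (g : σ → MvPolynomial τ K) (F : MvPolynomial σ K) (v : τ → K) :
    eval v (aeval g F) = eval (fun j => eval v (g j)) F := by
  induction F using MvPolynomial.induction_on with
  | C a => simp
  | add f g hf hg => rw [map_add, map_add, hf, hg, map_add]
  | mul_X f i hf => rw [map_mul, map_mul, hf, aeval_X, map_mul, eval_X]

lemma eval_pullback (L : (Fin (n + 1) → K) →ₗ[K] (Fin (m + 1) → K)) (F : CoordRing K m)
    (v : Fin (n + 1) → K) : eval v (pullback L F) = eval (L v) F := by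
  rw [pullback, eval_aeval]
  simp only [eval_coordForm]

end LinearForms

/-! ### The ring homomorphism attached to a linear projection -/

section Projection

variable {K : Type*} [Field K] {r r' : ℕ}

/-- The homomorphism from the coordinate ring of the target of a linear projection to the
homogeneous coordinate ring of a subset of its source. -/
noncomputable def projHom (L : (Fin (r' + 1) → K) →ₗ[K] (Fin (r + 1) → K))
    (X' : Set (PSpace K r')) : CoordRing K r →ₐ[K] CoordRing K r' ⧸ vanishingIdeal X' :=
  (Ideal.Quotient.mkₐ K (vanishingIdeal X')).comp (pullback L)

lemma projHom_apply (L : (Fin (r' + 1) → K) →ₗ[K] (Fin (r + 1) → K)) (X' : Set (PSpace K r'))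
    (F : CoordRing K r) :
    projHom L X' F = Ideal.Quotient.mk (vanishingIdeal X') (pullback L F) := rfl

variable {L : (Fin (r' + 1) → K) →ₗ[K] (Fin (r + 1) → K)} {X' : Set (PSpace K r')}

lemma mk_eq_zero_iff_eval {F : CoordRing K r'} {d : ℕ} (hF : F.IsHomogeneous d) :
    Ideal.Quotient.mk (vanishingIdeal X') F = 0 ↔ ∀ p ∈ X', eval p.rep F = 0 := by
  rw [Ideal.Quotient.eq_zero_iff_mem, mem_vanishingIdeal_iff hF]
  rfl

lemma mk_eq_mk_iff_eval {F H : CoordRing K r'} {d : ℕ} (hF : F.IsHomogeneous d)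
    (hH : H.IsHomogeneous d) :
    Ideal.Quotient.mk (vanishingIdeal X') F = Ideal.Quotient.mk (vanishingIdeal X') H ↔
      ∀ p ∈ X', eval p.rep F = eval p.rep H := by
  rw [← sub_eq_zero, ← map_sub, mk_eq_zero_iff_eval (hF.sub hH)]
  simp [sub_eq_zero]

lemma map_rep_ne_zero (hc : X' ∩ center L = ∅) {p : PSpace K r'} (hp : p ∈ X') : L p.rep ≠ 0 :=
  fun h => (hc ▸ (⟨hp, h⟩ : p ∈ X' ∩ center L) : p ∈ (∅ : Set (PSpace K r')))

lemma linearProjection_eq_mk (hc : X' ∩ center L = ∅) {p : PSpace K r'} (hp : p ∈ X') :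
    linearProjection L p = Projectivization.mk K (L p.rep) (map_rep_ne_zero hc hp) :=
  dif_pos (map_rep_ne_zero hc hp)

lemma projHom_eq_zero_iff (hc : X' ∩ center L = ∅) {F : CoordRing K r} {d : ℕ}
    (hF : F.IsHomogeneous d) :
    projHom L X' F = 0 ↔ F ∈ vanishingIdeal (linearProjection L '' X') := by
  rw [projHom_apply, mk_eq_zero_iff_eval (pullback_isHomogeneous L hF), mem_vanishingIdeal_iff hF,
    Set.forall_mem_image]
  refine forall₂_congr fun p hp => ?_
  rw [eval_pullback, linearProjection_eq_mk hc hp, vanishesAt_mk_iff hF]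

lemma projHom_mem_gradedPiece {F : CoordRing K r} {d : ℕ} (hF : F.IsHomogeneous d) :
    projHom L X' F ∈ gradedPiece (vanishingIdeal X') d :=
  ⟨_, pullback_isHomogeneous L hF, rfl⟩

lemma projHom_eq_zero_of_mem (hc : X' ∩ center L = ∅) {F : CoordRing K r}
    (hF : F ∈ vanishingIdeal (linearProjection L '' X')) : projHom L X' F = 0 := by
  have hle : vanishingIdeal (linearProjection L '' X') ≤ RingHom.ker (projHom L X') := by
    rw [vanishingIdeal, Ideal.span_le]
    rintro F ⟨⟨d, hd⟩, hF⟩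
    exact (projHom_eq_zero_iff hc hd).mpr ((mem_vanishingIdeal_iff hd).mpr hF)
  exact hle hF

lemma projHom_mul_mem {d e : ℕ} {F : CoordRing K r} (hF : F.IsHomogeneous e)
    {a : CoordRing K r' ⧸ vanishingIdeal X'} (ha : a ∈ gradedPiece (vanishingIdeal X') d) :
    projHom L X' F * a ∈ gradedPiece (vanishingIdeal X') (d + e) :=
  mk_mul_mem_gradedPiece (pullback_isHomogeneous L hF) ha

lemma imagePiece_le_gradedPiece (d : ℕ) :
    imagePiece (projHom L X') d ≤ gradedPiece (vanishingIdeal X') d := by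
  rintro _ ⟨F, hF, rfl⟩
  exact projHom_mem_gradedPiece hF

end Projection

/-! ### Two forms of the Nullstellensatz -/

section Nullstellensatz

variable {K : Type*} [Field K] [IsAlgClosed K]

lemma exists_X_pow_mem {σ : Type*} [Finite σ] {I : Ideal (MvPolynomial σ K)}
    (hI : ∀ v : σ → K, (∀ F ∈ I, eval v F = 0) → v = 0) (k : σ) : ∃ N : ℕ, X k ^ (N + 1) ∈ I := by
  have h : X k ∈ I.radical := by
    rw [← vanishingIdeal_zeroLocus_eq_radical (K := K) I, MvPolynomial.mem_vanishingIdeal_iff]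
    intro v hv
    have := hI v (fun F hF => by simpa [aeval_eq_eval] using hv F hF)
    simp [this]
  obtain ⟨N, hN⟩ := h
  exact ⟨N, pow_succ (X k : MvPolynomial σ K) N ▸ I.mul_mem_right _ hN⟩

lemma one_mem_of_forall_ne {σ : Type*} [Finite σ] {I : Ideal (MvPolynomial σ K)}
    (hI : ∀ v : σ → K, ∃ F ∈ I, eval v F ≠ 0) : I = ⊤ := by
  by_contra h
  have h1 : (1 : MvPolynomial σ K) ∈ I.radical := by
    rw [← vanishingIdeal_zeroLocus_eq_radical (K := K) I, MvPolynomial.mem_vanishingIdeal_iff]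
    intro v hv
    obtain ⟨F, hF, hne⟩ := hI v
    exact absurd (by simpa [aeval_eq_eval] using hv F hF) hne
  exact h ((Ideal.radical_eq_top).mp ((Ideal.eq_top_iff_one _).mpr h1))

end Nullstellensatz

end ProjVar

namespace ProjVar

open MvPolynomial

/-! ### Closed sets and homogeneous components -/

section ClosedSubset

variable {K : Type*} [Field K] {n m : ℕ}

lemma isClosed_iff_isAlgebraicSet {Z : Set (PSpace K n)} : IsClosed Z ↔ IsAlgebraicSet Z := by
  rw [← isOpen_compl_iff]
  change Zᶜᶜ ∈ {Z | IsAlgebraicSet Z} ↔ _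
  rw [compl_compl]
  rfl

lemma mk_mem_of_isClosed {Z : Set (PSpace K n)} (hZ : IsClosed Z) {v : Fin (n + 1) → K} (hv : v ≠ 0)
    (h : ∀ F ∈ vanishingIdeal Z, eval v F = 0) : Projectivization.mk K v hv ∈ Z := by
  obtain ⟨T, hT, rfl⟩ := isClosed_iff_isAlgebraicSet.mp hZ
  intro F hF
  obtain ⟨d, hd⟩ := hT F hF
  rw [vanishesAt_mk_iff hd]
  exact h F ((mem_vanishingIdeal_iff hd).mpr fun p hp => hp F hF)

lemma exists_isHomogeneous_of_notMem {Z : Set (PSpace K n)} (hZ : IsClosed Z) {p : PSpace K n}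
    (hp : p ∉ Z) : ∃ (d : ℕ) (F : CoordRing K n), F.IsHomogeneous d ∧ eval p.rep F ≠ 0 ∧
      ∀ q ∈ Z, VanishesAt F q := by
  obtain ⟨T, hT, rfl⟩ := isClosed_iff_isAlgebraicSet.mp hZ
  simp only [zeroSet, Set.mem_ofPred_eq, not_forall] at hp
  obtain ⟨F, hF, hFp⟩ := hp
  obtain ⟨d, hd⟩ := hT F hF
  exact ⟨d, F, hd, hFp, fun q hq => hq F hF⟩

lemma pullback_homogeneousComponent (L : (Fin (n + 1) → K) →ₗ[K] (Fin (m + 1) → K))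
    (F : CoordRing K m) (d : ℕ) :
    pullback L (homogeneousComponent d F) = homogeneousComponent d (pullback L F) := by
  have h1 : pullback L F =
      ∑ i ∈ Finset.range (F.totalDegree + 1), pullback L (homogeneousComponent i F) := by
    conv_lhs => rw [← sum_homogeneousComponent F]
    rw [map_sum]
  rw [h1, map_sum]
  have h2 : ∀ i, homogeneousComponent d (pullback L (homogeneousComponent i F)) =
      if i = d then pullback L (homogeneousComponent d F) else 0 := fun i => by
    rw [homogeneousComponent_of_mem ((mem_homogeneousSubmodule _ _).mpr
      (pullback_isHomogeneous L (homogeneousComponent_isHomogeneous i F)))]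
    by_cases h : i = d
    · subst h; simp
    · simp [h, Ne.symm h]
  simp only [h2, Finset.sum_ite_eq', Finset.mem_range]
  split_ifs with h
  · rfl
  · rw [homogeneousComponent_eq_zero _ _ (by omega), map_zero]

end ClosedSubset

/-- Nakayama's lemma for R, which is a finite S-module generated by 1 and the `y i`. -/
lemma exists_sub_one_mem_of_map_eq_top {S R : Type*} [CommRing S] [CommRing R] {t : ℕ} (f : S →+* R)
    (y : Fin t → R) (hy : ∀ a, ∃ (s : S) (u : Fin t → S), a = f s + ∑ i, f (u i) * y i)
    (m : Ideal S) (hm : m.map f = ⊤) : ∃ s, s - 1 ∈ m ∧ f s = 0 := by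
  let _ : Algebra S R := f.toAlgebra
  have hsmul : ∀ (s : S) (a : R), s • a = f s * a := fun s a => rfl
  have hfg : (⊤ : Submodule S R).FG := by
    refine Submodule.fg_def.mpr ⟨insert 1 (Set.range y), (Set.finite_range y).insert 1, ?_⟩
    refine eq_top_iff.mpr fun a _ => ?_
    obtain ⟨s, u, rfl⟩ := hy a
    refine add_mem ?_ (sum_mem fun i _ => ?_)
    · rw [← mul_one (f s), ← hsmul]
      exact Submodule.smul_mem _ _ (Submodule.subset_span (Set.mem_insert _ _))
    · rw [← hsmul]
      exact Submodule.smul_mem _ _ (Submodule.subset_span (Set.mem_insert_of_mem _ ⟨i, rfl⟩))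
  have hle : (⊤ : Submodule S R) ≤ m • ⊤ := by
    have h2 : m.map (algebraMap S R) = ⊤ := hm
    rw [Ideal.smul_top_eq_map, h2]
    exact le_refl _
  obtain ⟨s, hs, hs0⟩ := Submodule.exists_sub_one_mem_and_smul_eq_zero_of_fg_of_le_smul m ⊤ hfg hle
  refine ⟨s, hs, ?_⟩
  rw [← mul_one (f s), ← hsmul]
  exact hs0 1 trivial

/-! ### Finiteness of the projection and closedness of its image -/

section Projection

variable {K : Type*} [Field K] {r r' : ℕ}
variable {L : (Fin (r' + 1) → K) →ₗ[K] (Fin (r + 1) → K)} {X' : Set (PSpace K r')}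

lemma map_mk_ne_zero (hc : X' ∩ center L = ∅) {v : Fin (r' + 1) → K} (hv : v ≠ 0)
    (hp : Projectivization.mk K v hv ∈ X') : L v ≠ 0 := by
  obtain ⟨a, ha⟩ := Projectivization.exists_smul_eq_mk_rep K v hv
  have ha' : (a : K) • v = (Projectivization.mk K v hv).rep := ha
  have h1 := map_rep_ne_zero hc hp
  rw [← ha', map_smul] at h1
  exact (smul_ne_zero_iff.mp h1).2

lemma linearProjection_mk (hc : X' ∩ center L = ∅) {v : Fin (r' + 1) → K} (hv : v ≠ 0)
    (hp : Projectivization.mk K v hv ∈ X') : linearProjection L (Projectivization.mk K v hv) =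
      Projectivization.mk K (L v) (map_mk_ne_zero hc hv hp) := by
  obtain ⟨a, ha⟩ := Projectivization.exists_smul_eq_mk_rep K v hv
  rw [linearProjection_eq_mk hc hp, Projectivization.mk_eq_mk_iff]
  exact ⟨a, by rw [← ha]; exact (map_smul L (a : K) v).symm⟩

/-- The coordinate functions are nilpotent modulo the coordinates of a linear projection whose
center does not meet the closed set. -/
lemma exists_mk_X_pow_eq_sum [IsAlgClosed K] (hX' : IsClosed X') (hc : X' ∩ center L = ∅)
    (k : Fin (r' + 1)) : ∃ (N : ℕ) (u : Fin (r + 1) → CoordRing K r' ⧸ vanishingIdeal X'),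
      (∀ j, u j ∈ gradedPiece (vanishingIdeal X') N) ∧
      Ideal.Quotient.mk (vanishingIdeal X') (X k) ^ (N + 1) = ∑ j, projHom L X' (X j) * u j := by
  -- A common zero of I_{X'} and the coordinates of L would be a point of X' on the center.
  obtain ⟨N, hN⟩ := exists_X_pow_mem
    (I := vanishingIdeal X' ⊔ Ideal.span (Set.range (coordForm L))) (fun v hv => by
      by_contra hne
      have h1 := mk_mem_of_isClosed hX' hne fun F hF => hv F (Ideal.mem_sup_left hF)
      refine map_mk_ne_zero hc hne h1 (_root_.funext fun j => ?_)
      rw [← eval_coordForm]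
      exact hv _ (Ideal.mem_sup_right (Ideal.subset_span ⟨j, rfl⟩))) k
  obtain ⟨f, hf, g, hg, hfg⟩ := Submodule.mem_sup.mp hN
  obtain ⟨a, rfl⟩ := Ideal.mem_span_range_iff_exists_fun.mp hg
  refine ⟨N, fun j => Ideal.Quotient.mk _ (homogeneousComponent N (a j)),
    fun j => ⟨_, homogeneousComponent_isHomogeneous N _, rfl⟩, ?_⟩
  have hX : (X k ^ (N + 1) : CoordRing K r').IsHomogeneous (N + 1) := isHomogeneous_X_pow k (N + 1)
  have h1 := congrArg (homogeneousComponent (N + 1)) hfg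
  rw [homogeneousComponent_eq_self hX, map_add, map_sum] at h1
  rw [← map_pow, ← h1, map_add, Ideal.Quotient.eq_zero_iff_mem.mpr
    (homogeneousComponent_mem_vanishingIdeal hf (N + 1)), zero_add, map_sum]
  refine Finset.sum_congr rfl fun j _ => ?_
  rw [projHom_apply, pullback_X, ← map_mul, mul_comm (a j), add_comm N 1,
    homogeneousComponent_mul_of_isHomogeneous (coordForm_isHomogeneous L j)]

variable {t : ℕ} {y : Fin t → CoordRing K r' ⧸ vanishingIdeal X'}

lemma IsLinearCover.span_eq_top
    (h : IsLinearCover (projHom L X') (gradedPiece (vanishingIdeal X')) y)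
    (a : CoordRing K r' ⧸ vanishingIdeal X') : ∃ (F : CoordRing K r) (f : Fin t → CoordRing K r),
      a = projHom L X' F + ∑ i, projHom L X' (f i) * y i := by
  obtain ⟨P, rfl⟩ := Ideal.Quotient.mk_surjective a
  have h1 : ∀ d, ∃ (F : CoordRing K r) (f : Fin t → CoordRing K r),
      Ideal.Quotient.mk (vanishingIdeal X') (homogeneousComponent d P) =
        projHom L X' F + ∑ i, projHom L X' (f i) * y i := by
    intro d
    cases d with
    | zero =>
      refine ⟨C (coeff 0 P), 0, ?_⟩
      rw [homogeneousComponent_zero, projHom_apply, pullback, aeval_C, algebraMap_eq]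
      simp
    | succ d =>
      obtain ⟨F, f, -, -, hFf⟩ := h.exists_eq_succ
        (a := Ideal.Quotient.mk (vanishingIdeal X') (homogeneousComponent (d + 1) P))
        ⟨_, homogeneousComponent_isHomogeneous (d + 1) P, rfl⟩
      exact ⟨F, f, hFf⟩
  choose F f hFf using h1
  refine ⟨∑ d ∈ Finset.range (P.totalDegree + 1), F d,
    fun i => ∑ d ∈ Finset.range (P.totalDegree + 1), f d i, ?_⟩
  conv_lhs => rw [← sum_homogeneousComponent P]
  simp only [map_sum, hFf, Finset.sum_add_distrib, Finset.sum_mul]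
  rw [Finset.sum_comm]

/-- The image of the finite morphism is closed: over a vector representing a point outside it the
fibre of the affine cone is empty, so Nakayama gives an element of S that kills R and has value 1
there. Some homogeneous component of it is the required form. -/
lemma IsLinearCover.exists_projHom_eq_zero [IsAlgClosed K]
    (h : IsLinearCover (projHom L X') (gradedPiece (vanishingIdeal X')) y) (hX' : IsClosed X')
    (hc : X' ∩ center L = ∅) {w : PSpace K r} (hw : w ∉ linearProjection L '' X') :
    ∃ (e : ℕ) (F : CoordRing K r), F.IsHomogeneous e ∧ eval w.rep F ≠ 0 ∧ projHom L X' F = 0 := by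
  let m : Ideal (CoordRing K r) := RingHom.ker (eval w.rep)
  have h1 : vanishingIdeal X' ⊔ m.map (pullback L) = ⊤ := by
    refine one_mem_of_forall_ne fun u => ?_
    by_contra! hu
    have hLu : L u = w.rep := by
      funext j
      have h2 := hu (pullback L (X j - C (w.rep j)))
        (Ideal.mem_sup_right (Ideal.mem_map_of_mem _ (by simp [m, RingHom.mem_ker])))
      rw [eval_pullback] at h2
      simpa [sub_eq_zero] using h2
    have hu0 : u ≠ 0 := by
      rintro rfl
      rw [map_zero] at hLu
      exact w.rep_nonzero hLu.symm
    have h2 := mk_mem_of_isClosed hX' hu0 fun F hF => hu F (Ideal.mem_sup_left hF)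
    refine hw ⟨_, h2, ?_⟩
    rw [linearProjection_mk hc hu0 h2]
    simp only [hLu, Projectivization.mk_rep]
  obtain ⟨F, hF, hF0⟩ := exists_sub_one_mem_of_map_eq_top (projHom L X').toRingHom y
    h.span_eq_top m (by
      have h3 := congrArg (Ideal.map (Ideal.Quotient.mk (vanishingIdeal X'))) h1
      rw [Ideal.map_sup, Ideal.map_quotient_self, bot_sup_eq, Ideal.map_top] at h3
      rw [← h3]
      exact (Ideal.map_map (pullback L).toRingHom (Ideal.Quotient.mk (vanishingIdeal X'))).symm)
  have hF1 : eval w.rep F = 1 := by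
    have : eval w.rep (F - 1) = 0 := hF
    simpa [sub_eq_zero] using this
  have hF2 : pullback L F ∈ vanishingIdeal X' := by
    rw [← Ideal.Quotient.eq_zero_iff_mem, ← projHom_apply]
    exact hF0
  obtain ⟨e, -, he⟩ : ∃ e ∈ Finset.range (F.totalDegree + 1),
      eval w.rep (homogeneousComponent e F) ≠ 0 := by
    refine Finset.exists_ne_zero_of_sum_ne_zero ?_
    rw [← map_sum, sum_homogeneousComponent, hF1]
    exact one_ne_zero
  refine ⟨e, homogeneousComponent e F, homogeneousComponent_isHomogeneous e F, he, ?_⟩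
  rw [projHom_apply, pullback_homogeneousComponent, Ideal.Quotient.eq_zero_iff_mem]
  exact homogeneousComponent_mem_vanishingIdeal hF2 e

end Projection

end ProjVar

namespace ProjVar

open MvPolynomial

/-! ### Support of the cokernel on the singular locus -/

section Projection

variable {K : Type*} [Field K] {r r' : ℕ}
variable {L : (Fin (r' + 1) → K) →ₗ[K] (Fin (r + 1) → K)} {X' : Set (PSpace K r')}

/-- Where the projection is an isomorphism, the coordinate functions of the source are fractions
of forms of the target. -/
lemma exists_projHom_mul_mem_of_isIsoBetween (hc : X' ∩ center L = ∅) {W : Set (PSpace K r)}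
    (hW : IsClosed W)
    (hiso : IsIsoBetween (linearProjection L) (X' \ linearProjection L ⁻¹' W)
      (linearProjection L '' X' \ W))
    {w : PSpace K r} (hw : w ∈ linearProjection L '' X' \ W) :
    ∃ (e : ℕ) (F : CoordRing K r), F.IsHomogeneous e ∧ eval w.rep F ≠ 0 ∧
      ∀ a ∈ gradedPiece (vanishingIdeal X') 1, projHom L X' F * a ∈ imagePiece (projHom L X') (e + 1)
    := by
  obtain ⟨-, -, g, -, hg, hgl, -⟩ := hiso
  obtain ⟨d, G, hG, hG0, hgG⟩ := hg w hw
  obtain ⟨e, H, hH, hHw, hHW⟩ := exists_isHomogeneous_of_notMem hW hw.2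
  -- the inverse is given by `G` at every point where `G` does not vanish
  have key : ∀ p ∈ X', linearProjection L p ∉ W →
      (fun j => eval (L p.rep) (G j)) ≠ 0 →
      ∃ b : K, b • (fun j => eval (L p.rep) (G j)) = p.rep := by
    intro p hp hpW hne
    obtain ⟨a, ha⟩ := Projectivization.exists_smul_eq_mk_rep K _ (map_rep_ne_zero hc hp)
    rw [← linearProjection_eq_mk hc hp] at ha
    have ha' : (a : K) • L p.rep = (linearProjection L p).rep := ha
    have h1 : (fun j => eval (linearProjection L p).rep (G j)) =
        (a : K) ^ d • (fun j => eval (L p.rep) (G j)) := by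
      funext j
      rw [← ha', eval_smul_of_isHomogeneous (hG j)]
      rfl
    have h2 : (fun j => eval (linearProjection L p).rep (G j)) ≠ 0 := by
      rw [h1]
      exact smul_ne_zero (pow_ne_zero d a.ne_zero) hne
    have h3 := hgG _ ⟨⟨p, hp, rfl⟩, hpW⟩ h2
    rw [hgl ⟨hp, hpW⟩] at h3
    obtain ⟨b, hb⟩ := Projectivization.exists_smul_eq_mk_rep K _ h2
    rw [← h3] at hb
    refine ⟨b * (a : K) ^ d, ?_⟩
    rw [mul_smul, ← h1]
    exact hb
  obtain ⟨p, hp, rfl⟩ := hw.1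
  obtain ⟨a, ha⟩ := Projectivization.exists_smul_eq_mk_rep K _ (map_rep_ne_zero hc hp)
  rw [← linearProjection_eq_mk hc hp] at ha
  have ha' : (a : K) • L p.rep = (linearProjection L p).rep := ha
  -- Near the point, L composed with G is a multiple of the identity on cone points; it is nonzero
  -- since p is off the center, so some coordinate of it can serve as a denominator.
  obtain ⟨k, hk⟩ : ∃ k, eval (linearProjection L p).rep (aeval G (coordForm L k)) ≠ 0 := by
    have h1 : (fun j => eval (L p.rep) (G j)) ≠ 0 := by
      intro h0
      refine hG0 (_root_.funext fun j => ?_)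
      have := congrFun h0 j
      rw [← ha', eval_smul_of_isHomogeneous (hG j)]
      rw [show eval (L p.rep) (G j) = 0 from this, mul_zero]
      rfl
    obtain ⟨b, hb⟩ := key p hp hw.2 h1
    by_contra! hk
    refine map_rep_ne_zero hc hp ?_
    rw [← hb, map_smul]
    have h2 : L (fun j => eval (L p.rep) (G j)) = 0 := by
      funext k
      have h3 := hk k
      have hdk : (aeval G (coordForm L k)).IsHomogeneous (d * 1) :=
        (coordForm_isHomogeneous L k).aeval _ hG
      rw [← ha', eval_smul_of_isHomogeneous hdk, eval_aeval, eval_coordForm] at h3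
      exact (mul_eq_zero.mp h3).resolve_left (pow_ne_zero _ a.ne_zero)
    rw [h2, smul_zero]
  have hdk : (aeval G (coordForm L k)).IsHomogeneous d :=
    mul_one d ▸ (coordForm_isHomogeneous L k).aeval _ hG
  refine ⟨e + d, H * aeval G (coordForm L k), hH.mul hdk, ?_, ?_⟩
  · rw [map_mul]
    exact mul_ne_zero hHw hk
  rintro _ ⟨Q, hQ', rfl⟩
  have hQ : Q.IsHomogeneous 1 := hQ'
  have hdQ : (aeval G Q).IsHomogeneous d := mul_one d ▸ hQ.aeval _ hG
  have hR : (H * X k * aeval G Q).IsHomogeneous (e + d + 1) :=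
    (add_right_comm e 1 d) ▸ (hH.mul (isHomogeneous_X K k)).mul hdQ
  -- On points q = b·G(Lq) of X', the product L_k(G(Lq))·Q(q) equals (Lq)_k·Q(G(Lq)). Over W both
  -- sides are killed by H, and where G vanishes both are zero, so the identity holds on all of X'.
  refine ⟨H * X k * aeval G Q, hR, ?_⟩
  refine (mk_eq_mk_iff_eval (pullback_isHomogeneous L hR)
    ((pullback_isHomogeneous L (hH.mul hdk)).mul hQ)).mpr fun q hq => ?_
  simp only [map_mul, eval_pullback, eval_X, eval_aeval, eval_coordForm]
  by_cases hqW : linearProjection L q ∈ W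
  · have h1 := hHW _ hqW
    rw [linearProjection_eq_mk hc hq, vanishesAt_mk_iff hH] at h1
    rw [h1]; ring
  by_cases hne : (fun j => eval (L q.rep) (G j)) = 0
  · rw [hne, map_zero]
    have h0 : eval (0 : Fin (r' + 1) → K) Q = 0 := by
      have := eval_smul_of_isHomogeneous hQ 0 0
      simpa using this
    rw [h0]; simp
  · obtain ⟨b, hb⟩ := key q hq hqW hne
    have h1 : L q.rep k = b * L (fun j => eval (L q.rep) (G j)) k := by
      conv_lhs => rw [← hb]
      rw [map_smul]; rfl
    have h2 : eval q.rep Q = b * eval (fun j => eval (L q.rep) (G j)) Q := by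
      conv_lhs => rw [← hb]
      rw [eval_smul_of_isHomogeneous hQ, pow_one]
    rw [h1, h2]
    ring

variable {t : ℕ} {y : Fin t → CoordRing K r' ⧸ vanishingIdeal X'}

lemma IsLinearCover.exists_projHom_mul_mem [IsAlgClosed K]
    (h : IsLinearCover (projHom L X') (gradedPiece (vanishingIdeal X')) y) (hX' : IsClosed X')
    (hc : X' ∩ center L = ∅) {w : PSpace K r} (hw : w ∉ singularLocus (linearProjection L) X') :
    ∃ (e : ℕ) (F : CoordRing K r), F.IsHomogeneous e ∧ eval w.rep F ≠ 0 ∧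
      ∀ i, projHom L X' F * y i ∈ imagePiece (projHom L X') (e + 1) := by
  simp only [singularLocus, Set.mem_sInter, not_forall] at hw
  obtain ⟨W, ⟨-, hW, hiso⟩, hwW⟩ := hw
  by_cases hwX : w ∈ linearProjection L '' X'
  · obtain ⟨e, F, hF, hFw, hFa⟩ := exists_projHom_mul_mem_of_isIsoBetween hc hW hiso ⟨hwX, hwW⟩
    exact ⟨e, F, hF, hFw, fun i => hFa _ (h.y_mem i)⟩
  · obtain ⟨e, F, hF, hFw, hF0⟩ := h.exists_projHom_eq_zero hX' hc hwX
    exact ⟨e, F, hF, hFw, fun i => by rw [hF0, zero_mul]; exact zero_mem _⟩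

/-- For a general linear form `X₀ - lam`, the forms in the variables `X₁, …, X_r` of large degree
annihilate the cokernel of the presentation modulo `X₀ - lam`. -/
lemma IsLinearCover.exists_elimVar_nilpotent [IsAlgClosed K]
    (h : IsLinearCover (projHom L X') (gradedPiece (vanishingIdeal X')) y) (hX' : IsClosed X')
    (hc : X' ∩ center L = ∅) (hsing : IsAlmostNonsingular (linearProjection L) X')
    {b : ℕ} {φ : Fin t → Fin b → CoordRing K r}
    (hφ : ∀ f ∈ linearRelations (projHom L X') y,
      ∃ u : Fin b → K, ∀ i, f i = ∑ k, φ i k * C (u k)) :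
    ∃ lam : MvPolynomial (Fin r) K, lam.IsHomogeneous 1 ∧ ∀ i : Fin r, ∃ e : ℕ,
      AnnihilatesCoker (fun i k => elimVar lam (φ i k)) (X i ^ (e + 1)) := by
  have hfin : Finite (singularLocus (linearProjection L) X') := hsing
  -- A hyperplane avoiding the finite singular locus. It is also kept away from the first coordinate
  -- point, so that X₀ can be eliminated.
  obtain ⟨f, hf⟩ := Module.exists_dual_forall_apply_ne_zero (K := K)
    (fun o : Option (singularLocus (linearProjection L) X') =>
      o.elim (Pi.single 0 1 : Fin (r + 1) → K) (fun w => w.1.rep)) (by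
      rintro (_ | w)
      · simp
      · exact w.1.rep_nonzero)
  have hf0 : f (Pi.single 0 1) ≠ 0 := hf none
  let lam : MvPolynomial (Fin r) K :=
    ∑ i, C (-(f (Pi.single i.succ 1) / f (Pi.single 0 1))) * X i
  have hlam : lam.IsHomogeneous 1 := IsHomogeneous.sum _ _ _ fun _ _ => isHomogeneous_C_mul_X _ _
  have heval : ∀ v : Fin (r + 1) → K, f v = f (Pi.single 0 1) * eval v (elimForm lam) := by
    intro v
    have h1 : f v = ∑ k, v k * f (Pi.single k 1) := by
      conv_lhs => rw [pi_eq_sum_univ' v]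
      simp only [map_sum, map_smul, smul_eq_mul]
    rw [h1, Fin.sum_univ_succ, elimForm]
    simp only [lam, map_sub, map_sum, map_mul, rename_C, rename_X, eval_C, eval_X, mul_sub,
      Finset.mul_sum]
    rw [sub_eq_add_neg, ← Finset.sum_neg_distrib, mul_comm (v 0)]
    congr 1
    refine Finset.sum_congr rfl fun i _ => ?_
    field_simp
  refine ⟨lam, hlam, fun i => ?_⟩
  let J : Ideal (CoordRing K r) :=
    { carrier := {F | AnnihilatesCoker (fun i k => elimVar lam (φ i k)) (elimVar lam F)}
      add_mem' := fun {F G} hF hG => by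
        have := AnnihilatesCoker.add hF hG
        rwa [← map_add] at this
      zero_mem' := fun i => ⟨0, fun j => by simp⟩
      smul_mem' := fun G F hF => by
        have := AnnihilatesCoker.mul_left hF (elimVar lam G)
        rwa [← map_mul] at this }
  -- J contains X₀ - lam and the forms annihilating the cokernel. A nonzero common zero would lie on
  -- the hyperplane, hence off the singular locus, where some annihilating form does not vanish.
  obtain ⟨N, hN⟩ := exists_X_pow_mem (I := J) (fun v hv => by
    by_contra hne
    have hfv : f v = 0 := by
      rw [heval v, hv _ (show elimForm lam ∈ J from fun i => ⟨0, fun j => by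
        simp [elimVar_elimForm]⟩), mul_zero]
    obtain ⟨a, ha⟩ := Projectivization.exists_smul_eq_mk_rep K v hne
    have ha' : (a : K) • v = (Projectivization.mk K v hne).rep := ha
    obtain ⟨e, F, hF, hFw, hFy⟩ := h.exists_projHom_mul_mem hX' hc
      (w := Projectivization.mk K v hne) (fun hmem => by
        refine hf (some ⟨_, hmem⟩) ?_
        change f (Projectivization.mk K v hne).rep = 0
        rw [← ha', map_smul, hfv, smul_zero])
    refine hFw ?_
    rw [← ha', eval_smul_of_isHomogeneous hF,
      hv F ((h.annihilatesCoker hφ hF hFy).map (elimVar lam).toRingHom), mul_zero]) i.succ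
  refine ⟨N, ?_⟩
  have h1 : elimVar lam (X i.succ ^ (N + 1)) = X i ^ (N + 1) := by
    rw [map_pow, elimVar, aeval_X, Fin.cons_succ]
  exact h1 ▸ hN

end Projection

end ProjVar

namespace ProjVar

open MvPolynomial

/-! ### Descent of Koszul vanishing to the image -/

section Descent

variable {K : Type*} [Field K] {r r' t : ℕ}
variable {L : (Fin (r' + 1) → K) →ₗ[K] (Fin (r + 1) → K)} {X' : Set (PSpace K r')}
variable {y : Fin t → CoordRing K r' ⧸ vanishingIdeal X'}

lemma actsInDegreeOne_projHom :
    ActsInDegreeOne (gradedPiece (vanishingIdeal X')) (fun k => projHom L X' (X k)) :=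
  fun k _ _ ha => projHom_mul_mem (isHomogeneous_X K k) ha

lemma actsInDegreeOne_imagePiece :
    ActsInDegreeOne (imagePiece (projHom L X')) (fun k => projHom L X' (X k)) :=
  fun k _ _ ha => imagePiece_mul_mem (isHomogeneous_X K k) ha

lemma exists_eq_sum_smul_X {n : ℕ} {F : CoordRing K n} (hF : F.IsHomogeneous 1) :
    ∃ a : Fin (n + 1) → K, F = ∑ k, a k • X k := by
  obtain ⟨f, hf, hlf⟩ := exists_eq_sum_X_mul hF
  refine ⟨fun k => coeff 0 (f k), ?_⟩
  rw [hlf]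
  refine Finset.sum_congr rfl fun k _ => ?_
  have h1 : f k = C (coeff 0 (f k)) := by
    rw [← homogeneousComponent_zero, homogeneousComponent_eq_self (hf k)]
  conv_lhs => rw [h1, mul_comm, ← smul_eq_C_mul]

/-- In large degrees, chains of the Koszul complex of the source whose boundary comes from the
target come from the target up to boundaries. -/
lemma IsLinearCover.exists_sub_contraction_mem [IsAlgClosed K]
    (h : IsLinearCover (projHom L X') (gradedPiece (vanishingIdeal X')) y) (hX' : IsClosed X')
    (hc : X' ∩ center L = ∅) (hsing : IsAlmostNonsingular (linearProjection L) X') {i j : ℕ}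
    (hj : t ≤ j) {c : Finset (Fin (r + 1)) → CoordRing K r' ⧸ vanishingIdeal X'}
    (hcm : c ∈ kChains (gradedPiece (vanishingIdeal X')) Finset.univ i (j + 1))
    (hc0 : ∀ σ, contraction (fun k => projHom L X' (X k)) c σ ∈ imagePiece (projHom L X') (j + 2)) :
    ∃ w ∈ kChains (gradedPiece (vanishingIdeal X')) Finset.univ (i + 1) j,
      ∀ σ, c σ - contraction (fun k => projHom L X' (X k)) w σ ∈
        imagePiece (projHom L X') (j + 1) := by
  -- For t = 0 there are no extra generators, so every chain in positive degree already comes from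
  -- S.
  rcases Nat.eq_zero_or_pos t with rfl | ht
  · refine ⟨0, zero_mem _, fun σ => ?_⟩
    obtain ⟨F, f, hF, -, hFc⟩ := h.exists_eq_succ (hcm σ).1
    rw [map_zero, Pi.zero_apply, sub_zero, hFc]
    exact ⟨F, hF, by simp⟩
  obtain ⟨b, φ, hφ1, hφy, hφ⟩ := exists_presentation (projHom L X') y
  obtain ⟨lam, hlam, hnil⟩ := h.exists_elimVar_nilpotent hX' hc hsing hφ
  obtain ⟨a, hla⟩ := exists_eq_sum_smul_X (elimForm_isHomogeneous hlam)
  have ha : projHom L X' (elimForm lam) = ∑ k, a k • projHom L X' (X k) := by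
    rw [hla]
    simp only [map_sum, map_smul]
  refine ProjVar.exists_sub_contraction_mem actsInDegreeOne_projHom actsInDegreeOne_imagePiece a
    (fun x hx => ?_) (fun x hx hlx => ?_) hcm hc0
  · rw [← ha]
    exact h.surjective_of_nilpotent ht hφ1 hφy hlam hnil hj x hx
  · rw [← ha] at hlx
    exact h.injective_of_nilpotent ht hφ1 hφy hφ hlam hnil hj x hx hlx

/-- The vanishing of the Koszul homology of the source passes to the image in large degrees. -/
lemma IsLinearCover.koszulVanishing_image [IsAlgClosed K]
    (h : IsLinearCover (projHom L X') (gradedPiece (vanishingIdeal X')) y) (hX' : IsClosed X')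
    (hc : X' ∩ center L = ∅) (hsing : IsAlmostNonsingular (linearProjection L) X') {i j : ℕ}
    (hj : t + 1 ≤ j)
    (hKV : KoszulVanishing (gradedPiece (vanishingIdeal X')) (fun k => projHom L X' (X k))
      Finset.univ i j) :
    KoszulVanishing (gradedPiece (vanishingIdeal (linearProjection L '' X')))
      (fun k => Ideal.Quotient.mk _ (X k)) Finset.univ i j := by
  obtain ⟨j, rfl⟩ : ∃ m, j = m + 1 := ⟨j - 1, by omega⟩
  set θ := projHom L X'
  set I := vanishingIdeal (linearProjection L '' X')
  intro c hcm hc0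
  -- Zero is lifted to zero so that the lifted chain keeps its homological degree.
  have hlift : ∀ σ, ∃ F : CoordRing K r, F.IsHomogeneous (j + 1 + 1) ∧
      Ideal.Quotient.mk I F = c σ ∧ (c σ = 0 → F = 0) := by
    intro σ
    by_cases h0 : c σ = 0
    · exact ⟨0, isHomogeneous_zero _ _ _, by rw [h0]; exact map_zero _, fun _ => rfl⟩
    · obtain ⟨F, hF, hFc⟩ := mem_gradedPiece.mp (hcm σ).1
      exact ⟨F, hF, hFc, fun h => absurd h h0⟩
  choose F hF hFc hF0 using hlift
  have hmapθ : ∀ (g : Finset (Fin (r + 1)) → CoordRing K r) (σ : Finset (Fin (r + 1))),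
      θ (contraction X g σ) = contraction (fun k => θ (X k)) (fun σ => θ (g σ)) σ :=
    fun g σ => map_contraction θ.toRingHom X g σ
  have hmapI : ∀ (g : Finset (Fin (r + 1)) → CoordRing K r) (σ : Finset (Fin (r + 1))),
      Ideal.Quotient.mk I (contraction X g σ) =
        contraction (fun k => Ideal.Quotient.mk I (X k)) (fun σ => Ideal.Quotient.mk I (g σ)) σ :=
    fun g σ => map_contraction (Ideal.Quotient.mk I) X g σ
  obtain ⟨w, hw, hwc⟩ := hKV (fun σ => θ (F σ))
    (fun σ => ⟨projHom_mem_gradedPiece (hF σ), fun hne => (hcm σ).2 fun h0 => hne (by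
      simp only [hF0 σ h0, map_zero])⟩) (by
      funext σ
      rw [← hmapθ]
      refine projHom_eq_zero_of_mem hc (Ideal.Quotient.eq_zero_iff_mem.mp ?_)
      rw [hmapI]
      simp only [hFc]
      exact congrFun hc0 σ)
  -- The cycle bounds w over R, and w is a cycle modulo the image of S. Changing w by a boundary
  -- moves it into that image without changing its own boundary; injectivity of S/I_X → R then gives
  -- the relation over S/I_X.
  obtain ⟨v, hv, hwv⟩ := h.exists_sub_contraction_mem hX' hc hsing (by omega : t ≤ j) hw (fun σ => by
    rw [hwc]
    exact ⟨F σ, hF σ, rfl⟩)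
  have hwvm : w - contraction (fun k => θ (X k)) v ∈
      kChains (gradedPiece (vanishingIdeal X')) Finset.univ (i + 1) (j + 1) :=
    sub_mem hw (contraction_mem_kChains actsInDegreeOne_projHom hv)
  have hlift' : ∀ σ, ∃ H : CoordRing K r, H.IsHomogeneous (j + 1) ∧
      θ H = (w - contraction (fun k => θ (X k)) v) σ ∧
      ((w - contraction (fun k => θ (X k)) v) σ = 0 → H = 0) := by
    intro σ
    by_cases h0 : (w - contraction (fun k => θ (X k)) v) σ = 0
    · exact ⟨0, isHomogeneous_zero _ _ _, by rw [h0]; exact map_zero _, fun _ => rfl⟩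
    · obtain ⟨H, hH, hHw⟩ := mem_imagePiece.mp (hwv σ)
      exact ⟨H, hH, hHw, fun h => absurd h h0⟩
  choose H hH hHw hH0 using hlift'
  refine ⟨fun σ => Ideal.Quotient.mk I (H σ), fun σ => ⟨⟨H σ, hH σ, rfl⟩, fun hne =>
    (hwvm σ).2 fun h0 => hne (by simp only [hH0 σ h0, map_zero])⟩, ?_⟩
  funext σ
  have hcX : (contraction X H σ).IsHomogeneous (j + 1 + 1) := by
    rw [contraction_apply]
    exact IsHomogeneous.sum _ _ _ fun l _ => posSign_mul_isHomogeneous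
      (add_comm 1 (j + 1) ▸ (isHomogeneous_X K l).mul (hH _))
  rw [← hFc σ, ← hmapI, ← sub_eq_zero, ← map_sub, Ideal.Quotient.eq_zero_iff_mem,
    ← projHom_eq_zero_iff hc (hcX.sub (hF σ)), map_sub, sub_eq_zero]
  change θ _ = θ _
  rw [hmapθ]
  simp only [hHw]
  change contraction (fun k => θ (X k)) (w - contraction (fun k => θ (X k)) v) σ = _
  rw [map_sub, contraction_contraction_self, sub_zero, hwc]

end Descent

end ProjVar

namespace ProjVar

open MvPolynomial

/-! ### Passage between two systems of linear forms -/

section ChangeOfVariables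

variable {K A : Type*} [Field K] [CommRing A] [Algebra K A] {G : ℕ → Submodule K A} {n m t : ℕ}

/-- The vanishing of Koszul homology with respect to `Y` implies that with respect to `x`, when
`t` of the elements `Y`, nilpotent modulo `x`, span all of `Y` together with `x`. -/
lemma KoszulVanishing.of_span_of_isNilpotent {Y : Fin n → A} {x : Fin m → A}
    (hY : ActsInDegreeOne G Y) (hx : ActsInDegreeOne G x) {τ : Fin t → Fin n}
    (hspan : ∀ k, ∃ (c : Fin m → K) (d : Fin t → K), Y k = ∑ j, c j • x j + ∑ i, d i • Y (τ i))
    (hnil : ∀ i, ∃ (N : ℕ) (u : Fin m → A), (∀ k j, ∀ a ∈ G j, u k * a ∈ G (j + N)) ∧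
      Y (τ i) ^ (N + 1) = ∑ k, x k * u k) {p j₀ : ℕ}
    (h : ∀ i ≤ p + t, ∀ j ≥ j₀, KoszulVanishing G Y Finset.univ i j) :
    ∀ i ≤ p, ∀ j ≥ j₀, KoszulVanishing G x Finset.univ i j := by
  classical
  -- Both systems are placed in one sequence. Starting from Y, the x are added, then the Y are
  -- dropped except for the `t` chosen ones, which together with x span the rest; finally those are
  -- dropped by nilpotency, at the cost of at most `t` homological degrees.
  set v : Fin (n + m) → A := Fin.append Y x with hv
  have hvY : ∀ k, v (Fin.castAdd m k) = Y k := Fin.append_left Y x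
  have hvx : ∀ k, v (Fin.natAdd n k) = x k := Fin.append_right Y x
  have hact : ActsInDegreeOne G v := by
    intro k
    refine Fin.addCases (fun k => ?_) (fun k => ?_) k
    · rw [hvY]; exact hY k
    · rw [hvx]; exact hx k
  set U := Finset.univ.map (Fin.castAddOrderEmb (n := n) m).toEmbedding
  set V := Finset.univ.map (Fin.natAddOrderEmb (m := m) n).toEmbedding
  set T : Finset (Fin (n + m)) := Finset.univ.image fun i => Fin.castAdd m (τ i)
  have hV : ∀ k, Fin.natAdd n k ∈ V := fun k => Finset.mem_map.mpr ⟨k, Finset.mem_univ _, rfl⟩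
  have hVm : ∀ k ∈ V, ∃ l, Fin.natAdd n l = k := fun k hk => by
    obtain ⟨l, -, hl⟩ := Finset.mem_map.mp hk
    exact ⟨l, hl⟩
  have hTcard : T.card ≤ t := Finset.card_image_le.trans (by simp)
  have hTV : Disjoint T V := by
    rw [Finset.disjoint_left]
    intro k hkT hkV
    obtain ⟨i, -, rfl⟩ := Finset.mem_image.mp hkT
    obtain ⟨l, hl⟩ := hVm _ hkV
    have h1 := congrArg Fin.val hl
    simp only [Fin.val_natAdd, Fin.val_castAdd] at h1
    omega
  have h1 : ∀ i ≤ p + T.card, ∀ j ≥ j₀, KoszulVanishing G v (T ∪ V) i j := by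
    intro i hi j hj
    refine KoszulVanishing.of_union_of_mem_span U (fun k hk => ?_) ?_
    · obtain ⟨k, -, rfl⟩ := Finset.mem_map.mp hk
      obtain ⟨c, d, hcd⟩ := hspan k
      refine ⟨Fin.append (fun k => ∑ i, if τ i = k then d i else 0) c, fun l => ?_, ?_⟩
      · refine Fin.addCases (fun l hl => ?_) (fun l hl => ?_) l
        · rw [Fin.append_left]
          refine Finset.sum_eq_zero fun i _ => if_neg ?_
          rintro rfl
          exact hl (Finset.mem_union_left _ (Finset.mem_image_of_mem _ (Finset.mem_univ i)))
        · exact absurd (Finset.mem_union_right _ (hV l)) hl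
      · change v (Fin.castAdd m k) = _
        rw [Fin.sum_univ_add, hvY, hcd, add_comm]
        simp only [Fin.append_left, Fin.append_right, hvY, hvx, Finset.sum_smul, ite_smul, zero_smul]
        rw [Finset.sum_comm]
        simp
    · rw [Finset.union_comm]
      refine KoszulVanishing.union hact (T ∪ V) (p := p + t) (fun i hi => ?_) i (by omega)
      exact (koszulVanishing_map_iff _ v hact).mpr (by
        have h0 : (fun k => v (Fin.castAddOrderEmb m k)) = Y := _root_.funext hvY
        rw [h0]
        exact h i hi j hj)
  intro i hi j hj
  have h2 := KoszulVanishing.of_union_of_isNilpotent hact T hTV (fun k hk => by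
    obtain ⟨i, -, rfl⟩ := Finset.mem_image.mp hk
    obtain ⟨N, u, hu, hYu⟩ := hnil i
    refine ⟨N, Fin.append 0 u, fun k => ?_, fun k => ?_, ?_⟩
    · refine Fin.addCases (fun k => ?_) (fun k => ?_) k
      · simp
      · rw [Fin.append_right]; exact hu k
    · refine Fin.addCases (fun k _ => by simp) (fun k hk => absurd (hV k) hk) k
    · rw [hvY, hYu, Fin.sum_univ_add]
      simp [hvx, mul_comm]) h1 i hi j hj
  have h0 : (fun k => v (Fin.natAddOrderEmb n k)) = x := _root_.funext hvx
  exact h0 ▸ (koszulVanishing_map_iff _ v hact).mp h2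

end ChangeOfVariables

/-! ### Completing the rows of a matrix to a basis -/

section LinearAlgebra

variable {K : Type*} [Field K] {r t : ℕ}

/-- The rows of a surjective matrix can be completed to a basis by standard basis vectors. -/
lemma exists_completion {n : ℕ} (L : (Fin n → K) →ₗ[K] (Fin r → K)) (hL : Function.Surjective L)
    (hn : n = r + t) :
    ∃ τ : Fin t → Fin n,
      (∀ u : Fin n → K, ∃ (c : Fin r → K) (d : Fin t → K),
        u = ∑ j, c j • (fun k => L (Pi.single k 1) j) + ∑ i, d i • Pi.single (τ i) (1 : K)) ∧
      ∀ (c : Fin r → K) (d : Fin t → K),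
        ∑ j, c j • (fun k => L (Pi.single k 1) j) + ∑ i, d i • Pi.single (τ i) (1 : K) = 0 →
          d = 0 := by
  let row : (Fin r → K) →ₗ[K] (Fin n → K) :=
    Fintype.linearCombination K fun j k => L (Pi.single k 1) j
  have hrow : ∀ c, row c = ∑ j, c j • (fun k => L (Pi.single k 1) j) := fun c =>
    Fintype.linearCombination_apply K _ c
  have hinj : Function.Injective row := by
    rw [injective_iff_map_eq_zero]
    intro c hc
    have h1 : ∀ v, ∑ j, c j * L v j = 0 := by
      intro v
      have h2 : ∀ j, L v j = ∑ k, v k * L (Pi.single k 1) j := fun j => by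
        conv_lhs => rw [pi_eq_sum_univ' v]
        simp [map_sum]
      simp only [h2, Finset.mul_sum]
      rw [Finset.sum_comm]
      refine Finset.sum_eq_zero fun k _ => ?_
      have h3 := congrFun hc k
      rw [hrow, Finset.sum_apply] at h3
      simp only [Pi.smul_apply, smul_eq_mul, Pi.zero_apply] at h3
      simp only [mul_left_comm (c _), ← Finset.mul_sum, h3, mul_zero]
    funext j
    obtain ⟨v, hv⟩ := hL (Pi.single j 1)
    simpa [hv, Pi.single_apply] using h1 v
  let q := (LinearMap.range row).mkQ
  -- Standard basis vectors forming a basis modulo the row space; surjectivity of L makes the rows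
  -- independent, which yields the count `t`.
  obtain ⟨b, -, -, hb, hli⟩ := exists_linearIndepOn_extension (K := K)
    (v := fun k : Fin n => q (Pi.single k 1)) (s := ∅) (t := Set.univ)
    (linearIndepOn_empty K _) (Set.empty_subset _)
  have htop : Submodule.span K (Set.range fun k : b => q (Pi.single k.1 1)) = ⊤ := by
    rw [eq_top_iff]
    rintro a -
    obtain ⟨u, rfl⟩ := Submodule.mkQ_surjective _ a
    change q u ∈ _
    rw [pi_eq_sum_univ' u, map_sum]
    refine sum_mem fun k _ => ?_
    rw [map_smul]
    refine Submodule.smul_mem _ _ ?_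
    have h1 := hb ⟨k, trivial, rfl⟩
    rwa [Set.image_eq_range] at h1
  have := Fintype.ofFinite b
  have hcard : Fintype.card b = t := by
    have h1 := finrank_span_eq_card hli
    have h2 := Submodule.finrank_quotient_add_finrank (LinearMap.range row)
    rw [LinearMap.finrank_range_of_inj hinj] at h2
    simp only [Module.finrank_fin_fun] at h2
    rw [← h1, htop, finrank_top]
    omega
  let e : Fin t ≃ b := (Fintype.equivFinOfCardEq hcard).symm
  refine ⟨fun i => (e i).1, fun u => ?_, fun c d hcd => ?_⟩
  · have h1 : q u ∈ Submodule.span K (Set.range fun k : b => q (Pi.single k.1 1)) :=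
      htop ▸ Submodule.mem_top
    rw [← e.surjective.range_comp, Submodule.mem_span_range_iff_exists_fun] at h1
    obtain ⟨d, hd⟩ := h1
    have h2 : u - ∑ i, d i • Pi.single (e i).1 (1 : K) ∈ LinearMap.range row := by
      rw [← Submodule.Quotient.mk_eq_zero, ← Submodule.mkQ_apply, map_sub, sub_eq_zero, map_sum]
      simp only [map_smul]
      exact hd.symm
    obtain ⟨c, hc⟩ := h2
    exact ⟨c, d, by rw [← hrow, hc, sub_add_cancel]⟩
  · have h1 := congrArg q hcd
    have h3 : q (row c) = 0 := (Submodule.Quotient.mk_eq_zero _).mpr ⟨c, rfl⟩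
    rw [map_add, ← hrow, h3, zero_add, map_zero, map_sum] at h1
    simp only [map_smul] at h1
    have h2 := (linearIndependent_equiv e).mpr hli
    exact _root_.funext (Fintype.linearIndependent_iff.mp h2 d h1)

end LinearAlgebra

end ProjVar

namespace ProjVar

open MvPolynomial

/-! ### The coordinate ring of X' as a linear cover -/

section Cover

variable {K : Type*} [Field K] {n : ℕ}

lemma koszulVanishing_mk_X_zero (I : Ideal (CoordRing K n)) (j : ℕ) :
    KoszulVanishing (gradedPiece I) (fun k => Ideal.Quotient.mk I (X k)) Finset.univ 0 j := by
  intro c hc _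
  obtain ⟨F, hF, hFc⟩ := mem_gradedPiece.mp (hc ∅).1
  obtain ⟨f, hf, hFf⟩ := exists_eq_sum_X_mul hF
  have hw : chainOfVector (fun k => Ideal.Quotient.mk I (f k)) ∈
      kChains (gradedPiece I) Finset.univ (0 + 1) j :=
    chainOfVector_mem_kChains fun k => ⟨f k, hf k, rfl⟩
  refine ⟨_, hw, ?_⟩
  funext σ
  by_cases hσ : σ = ∅
  · subst hσ
    rw [contraction_empty, ← hFc, hFf, map_sum]
    simp only [chainOfVector_singleton, map_mul]
  · have h0 : ∀ {b : Finset (Fin (n + 1)) → CoordRing K n ⧸ I} {d : ℕ},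
        b ∈ kChains (gradedPiece I) Finset.univ 0 d → b σ = 0 := fun hb => by
      by_contra hne
      exact hσ (Finset.card_eq_zero.mp ((hb σ).2 hne).2)
    rw [h0 hc, h0 (contraction_mem_kChains (actsInDegreeOne_mk_X I) hw)]

variable {r r' t : ℕ}
variable {L : (Fin (r' + 1) → K) →ₗ[K] (Fin (r + 1) → K)} {X' : Set (PSpace K r')}

lemma projHom_X (j : Fin (r + 1)) : projHom L X' (X j) =
    ∑ k, L (Pi.single k 1) j • Ideal.Quotient.mk (vanishingIdeal X') (X k) := by
  rw [projHom_apply, pullback_X, coordForm, map_sum]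
  refine Finset.sum_congr rfl fun k _ => ?_
  rw [← smul_eq_C_mul]
  exact map_smul (Ideal.Quotient.mkₐ K (vanishingIdeal X')) _ _

lemma linearCombination_mk_X (c : Fin (r + 1) → K) (d : Fin t → K) (τ : Fin t → Fin (r' + 1)) :
    Fintype.linearCombination K (fun k => Ideal.Quotient.mk (vanishingIdeal X') (X k))
      (∑ j, c j • (fun k => L (Pi.single k 1) j) + ∑ i, d i • Pi.single (τ i) (1 : K)) =
    ∑ j, c j • projHom L X' (X j) +
      ∑ i, d i • Ideal.Quotient.mk (vanishingIdeal X') (X (τ i)) := by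
  rw [map_add, map_sum, map_sum]
  congr 1
  · refine Finset.sum_congr rfl fun j _ => ?_
    rw [map_smul, Fintype.linearCombination_apply, projHom_X]
  · refine Finset.sum_congr rfl fun i _ => ?_
    rw [map_smul, Fintype.linearCombination_apply_single, one_smul]

lemma mk_sum_smul_X (I : Ideal (CoordRing K r')) (u : Fin (r' + 1) → K) :
    Ideal.Quotient.mk I (∑ k, u k • X k) =
      Fintype.linearCombination K (fun k => Ideal.Quotient.mk I (X k)) u := by
  rw [Fintype.linearCombination_apply, map_sum]
  exact Finset.sum_congr rfl fun k _ => map_smul (Ideal.Quotient.mkₐ K I) _ _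

/-- Non-degeneracy enters here: the variables stay linearly independent in R, so the `t` extra
generators are minimal. -/
lemma IsNondegenerate.eq_zero_of_linearCombination_eq_zero (hnd : IsNondegenerate X')
    {u : Fin (r' + 1) → K} (hu : Fintype.linearCombination K
      (fun k => Ideal.Quotient.mk (vanishingIdeal X') (X k)) u = 0) : u = 0 := by
  have hF : (∑ k, u k • X k : CoordRing K r').IsHomogeneous 1 :=
    IsHomogeneous.sum _ _ _ fun k _ => (homogeneousSubmodule (Fin (r' + 1)) K 1).smul_mem _
      (isHomogeneous_X K k)
  rw [← mk_sum_smul_X] at hu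
  have h0 : (∑ k, u k • X k : CoordRing K r') = 0 := hnd _ hF ((mk_eq_zero_iff_eval hF).mp hu)
  funext k
  have h1 := congrArg (eval (Pi.single k 1)) h0
  simpa [Pi.single_apply, smul_eval] using h1

/-- The Koszul homology of the homogeneous coordinate ring over the coordinate ring of the target
of the projection. -/
lemma koszulVanishing_projHom [IsAlgClosed K] (hX' : IsClosed X') (hc : X' ∩ center L = ∅)
    {τ : Fin t → Fin (r' + 1)}
    (hτ : ∀ u : Fin (r' + 1) → K, ∃ (c : Fin (r + 1) → K) (d : Fin t → K),
      u = ∑ j, c j • (fun k => L (Pi.single k 1) j) + ∑ i, d i • Pi.single (τ i) (1 : K))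
    {p j₀ : ℕ} (h : ∀ i ≤ p + t, ∀ j ≥ j₀, KoszulVanishing (gradedPiece (vanishingIdeal X'))
      (fun k => Ideal.Quotient.mk _ (X k)) Finset.univ i j) :
    ∀ i ≤ p, ∀ j ≥ j₀, KoszulVanishing (gradedPiece (vanishingIdeal X'))
      (fun k => projHom L X' (X k)) Finset.univ i j := by
  refine KoszulVanishing.of_span_of_isNilpotent (actsInDegreeOne_mk_X _) actsInDegreeOne_projHom
    (τ := τ) (fun k => ?_) (fun i => ?_) h
  · obtain ⟨c, d, hcd⟩ := hτ (Pi.single k 1)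
    refine ⟨c, d, ?_⟩
    rw [← linearCombination_mk_X, ← hcd, Fintype.linearCombination_apply_single, one_smul]
  · obtain ⟨N, u, hu, hXu⟩ := exists_mk_X_pow_eq_sum hX' hc (τ i)
    refine ⟨N, u, fun k j a ha => ?_, hXu⟩
    obtain ⟨F, hF, hFu⟩ := mem_gradedPiece.mp (hu k)
    rw [← hFu]
    exact mk_mul_mem_gradedPiece hF ha

/-- The homogeneous coordinate ring of a nondegenerate closed set satisfying `N_{2,t+1}`, as a
module over the coordinate ring of the target of a projection to codimension `t`. -/
lemma isLinearCover_projHom (hnd : IsNondegenerate X') {τ : Fin t → Fin (r' + 1)}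
    (hτ : ∀ u : Fin (r' + 1) → K, ∃ (c : Fin (r + 1) → K) (d : Fin t → K),
      u = ∑ j, c j • (fun k => L (Pi.single k 1) j) + ∑ i, d i • Pi.single (τ i) (1 : K))
    (hτ0 : ∀ (c : Fin (r + 1) → K) (d : Fin t → K),
      ∑ j, c j • (fun k => L (Pi.single k 1) j) + ∑ i, d i • Pi.single (τ i) (1 : K) = 0 → d = 0)
    (h : ∀ i ≤ 1, ∀ j ≥ 1, KoszulVanishing (gradedPiece (vanishingIdeal X'))
      (fun k => projHom L X' (X k)) Finset.univ i j) :
    IsLinearCover (projHom L X') (gradedPiece (vanishingIdeal X'))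
      (fun i => Ideal.Quotient.mk _ (X (τ i))) where
  mul_mem hF _ ha := projHom_mul_mem hF ha
  imagePiece_le := imagePiece_le_gradedPiece
  y_mem i := ⟨X (τ i), isHomogeneous_X K _, rfl⟩
  exists_eq a ha := by
    obtain ⟨Q, hQ, rfl⟩ := mem_gradedPiece.mp ha
    obtain ⟨u, rfl⟩ := exists_eq_sum_smul_X hQ
    obtain ⟨c, d, hcd⟩ := hτ u
    refine ⟨∑ j, c j • X j, IsHomogeneous.sum _ _ _ fun k _ =>
      (homogeneousSubmodule (Fin (r + 1)) K 1).smul_mem _ (isHomogeneous_X K k), d, ?_⟩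
    rw [mk_sum_smul_X, hcd, linearCombination_mk_X, map_sum]
    simp only [map_smul]
  indep F hF d hd := by
    obtain ⟨c, rfl⟩ := exists_eq_sum_smul_X hF
    refine hτ0 c d (hnd.eq_zero_of_linearCombination_eq_zero ?_)
    rw [linearCombination_mk_X, ← hd, map_sum]
    simp only [map_smul]
  vanishing_zero := h 0 zero_le_one
  vanishing_one := h 1 le_rfl

end Cover

end ProjVar

/-! ### The theorem -/

theorem theorem2p5 {K : Type*} [Field K] [IsAlgClosed K] (r r' : ℕ) (hr : r ≤ r')
    (X' : Set (ProjVar.PSpace K r')) (hX' : ProjVar.IsVariety X')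
    (hnd : ProjVar.IsNondegenerate X') (hdim : 2 ≤ topologicalKrullDim X')
    (p : ℕ) (hp : max 2 (r' - r + 1) ≤ p) (hN : ProjVar.SatisfiesN2 X' p)
    (L : (Fin (r' + 1) → K) →ₗ[K] (Fin (r + 1) → K)) (hL : Function.Surjective L)
    (hcenter : X' ∩ ProjVar.center L = ∅)
    (X : Set (ProjVar.PSpace K r)) (hX : X = ProjVar.linearProjection L '' X')
    (hsing : ProjVar.IsAlmostNonsingular (ProjVar.linearProjection L) X') :
    ProjVar.GeneratedInDegreesLE (ProjVar.vanishingIdeal X) (r' - r + 2) ∧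
      ProjVar.regularity X ≤ max (ProjVar.regularity X') ((r' - r + 2 : ℕ) : ℕ∞) := by
  subst hX
  set t := r' - r with ht
  have htp : t + 1 ≤ p := (le_max_right _ _).trans hp
  obtain ⟨τ, hτ, hτ0⟩ := ProjVar.exists_completion (t := t) L hL (by omega)
  have hY : ∀ i ≤ p, ∀ j ≥ 1, ProjVar.KoszulVanishing
      (ProjVar.gradedPiece (ProjVar.vanishingIdeal X'))
      (fun k => Ideal.Quotient.mk _ (MvPolynomial.X k)) Finset.univ i j := by
    intro i hi j hj
    rcases Nat.eq_zero_or_pos i with rfl | hi0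
    · exact ProjVar.koszulVanishing_mk_X_zero _ _
    · exact (ProjVar.bettiNumber_eq_zero_iff _ _ _).mp (hN i (j + 1) hi0 hi (by omega))
  -- Of the t+1 homological degrees granted by N_{2,p}, t are spent on the change of rings; degrees
  -- 0 and 1 remain, which is what a linear presentation needs.
  have hx := ProjVar.koszulVanishing_projHom hX'.1 hcenter hτ (p := 1) (j₀ := 1)
    fun i hi j hj => hY i (by omega) j hj
  have hcover := ProjVar.isLinearCover_projHom hnd hτ hτ0 hx
  refine ⟨ProjVar.generatedInDegreesLE_of_koszulVanishing fun j hj =>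
    hcover.koszulVanishing_image hX'.1 hcenter hsing hj (hx 1 le_rfl j (by omega)), ?_⟩
  rw [ProjVar.regularity, ProjVar.regularity]
  by_cases h : ProjVar.ringRegularity (ProjVar.vanishingIdeal X') = ⊤
  · rw [h]
    exact le_max_of_le_left le_top
  · obtain ⟨m, hm'⟩ := ENat.ne_top_iff_exists.mp h
    rw [← hm']
    have hm := (ProjVar.ringRegularity_le_iff _ m).mp hm'.ge
    -- The regularity bound holds in all homological degrees, so the loss of t of them is harmless
    -- here.
    have hxm := fun i => ProjVar.koszulVanishing_projHom hX'.1 hcenter hτ (p := i) (j₀ := m)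
      (fun i _ j hj => hm i j hj) i le_rfl
    have h1 := (ProjVar.ringRegularity_le_iff (ProjVar.vanishingIdeal
      (ProjVar.linearProjection L '' X')) (max m (t + 1))).mpr fun i j hj =>
        hcover.koszulVanishing_image hX'.1 hcenter hsing (by omega) (hxm i j (by omega))
    refine (add_le_add_left h1 1).trans ?_
    have h2 : max m (t + 1) + 1 ≤ max (m + 1) (t + 2) := by omega
    have h3 : ((max m (t + 1) + 1 : ℕ) : ℕ∞) ≤ ((max (m + 1) (t + 2) : ℕ) : ℕ∞) := by
      exact_mod_cast h2
    rw [(Nat.mono_cast (α := ℕ∞)).map_max] at h3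
    exact_mod_cast h3
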